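/- Call a set $L$ of lines in the plane \emph{separating} for a finite point set $P\subset\mathbb{R}^2$ if any two distinct points of $P$ lie strictly on different sides of some line of $L$; the \emph{separability} of $P$ is the minimum number of lines in a separating set for $P$. A \emph{(possibly unbounded) triangle} is an intersection of three closed half-planes with non-empty interior. A \emph{triangulation of the plane} is a finite family of such triangles that covers the plane and in which any two distinct triangles intersect in a common face of both (the empty set, a vertex, or a side). \textbf{Lemma.} For every constant $c$ there is a constant $C>0$, depending only on $c$, such that the following holds. Let $P$ be a set of $n$ points in the plane whose separability is at most $c\sqrt{n}$, and let $r$ be a real number with $2\le r\le n$. Then there is a triangulation of the plane into at most $C\,r\log^2 r$ triangles such that each (closed) triangle contains at most $n/r$ points of $P$, and every line intersects at most $C\sqrt{r}\,\log^2 r$ of the (closed) triangles. -/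

import Mathlib

/-- The Euclidean plane. -/
abbrev Plane : Type := EuclideanSpace ℝ (Fin 2)

/-- A line in the plane: a one-dimensional affine subspace. (The empty affine subspace has
direction `⊥`, hence is not a line.) -/
def IsLine (ℓ : AffineSubspace ℝ Plane) : Prop :=
  Module.finrank ℝ ℓ.direction = 1

/-- A set `L` of lines separates `P` if any two distinct points of `P` lie strictly on different
sides of some line of `L`. -/
def Separates (L : Set (AffineSubspace ℝ Plane)) (P : Set Plane) : Prop :=
  ∀ p ∈ P, ∀ q ∈ P, p ≠ q → ∃ ℓ ∈ L, ℓ.SOppSide p q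

/-- The separability of a finite point set: the least size of a set of lines separating it. -/
noncomputable def separability (P : Finset Plane) : ℕ :=
  sInf {m : ℕ | ∃ L : Finset (AffineSubspace ℝ Plane),
    (∀ ℓ ∈ L, IsLine ℓ) ∧ Separates (L : Set (AffineSubspace ℝ Plane)) (P : Set Plane) ∧
      L.card = m}

/-- The infimum in the definition of the separability is always a minimum. -/
theorem exists_separates_card_eq_separability (P : Finset Plane) :
    ∃ L : Finset (AffineSubspace ℝ Plane), (∀ ℓ ∈ L, IsLine ℓ) ∧
      Separates (L : Set (AffineSubspace ℝ Plane)) (P : Set Plane) ∧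
      L.card = separability P := by
  classical
  refine Nat.sInf_mem (s := {m : ℕ | ∃ L : Finset (AffineSubspace ℝ Plane),
    (∀ ℓ ∈ L, IsLine ℓ) ∧ Separates (L : Set (AffineSubspace ℝ Plane)) (P : Set Plane) ∧
      L.card = m}) ?_
  refine ⟨_, (P.offDiag).image (fun x => AffineSubspace.perpBisector x.1 x.2), ?_, ?_, rfl⟩
  · intro ℓ hℓ
    obtain ⟨⟨p, q⟩, hx, rfl⟩ := Finset.mem_image.1 hℓ
    have hne : p ≠ q := (Finset.mem_offDiag.1 hx).2.2
    have : Fact (Module.finrank ℝ Plane = 1 + 1) := ⟨by simp⟩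
    unfold IsLine
    rw [AffineSubspace.direction_perpBisector]
    exact Submodule.finrank_orthogonal_span_singleton (vsub_ne_zero.2 hne.symm)
  · intro p hp q hq hne
    refine ⟨AffineSubspace.perpBisector p q, ?_, ⟨midpoint ℝ p q,
      AffineSubspace.midpoint_mem_perpBisector p q, midpoint ℝ p q,
      AffineSubspace.midpoint_mem_perpBisector p q, ?_⟩, ?_, ?_⟩
    · simp only [Finset.coe_image, Set.mem_image]
      exact ⟨(p, q), Finset.mem_coe.2 (Finset.mem_offDiag.2 ⟨hp, hq, hne⟩), rfl⟩
    · rw [left_vsub_midpoint, midpoint_vsub_right]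
      exact SameRay.rfl
    · rwa [AffineSubspace.left_mem_perpBisector]
    · rwa [AffineSubspace.right_mem_perpBisector]

/-- A (closed, possibly unbounded) triangle: the intersection of three closed half-planes
`{x | ⟪a i, x⟫ ≤ b i}` that has an interior point. The bounded ones are exactly the ordinary
nondegenerate triangles; unbounded ones are needed for finitely many triangles to cover the
plane. -/
def IsTriangle (T : Set Plane) : Prop :=
  (∃ (a : Fin 3 → Plane) (b : Fin 3 → ℝ),
    (∀ i, a i ≠ 0) ∧ T = {x : Plane | ∀ i, inner ℝ (a i) x ≤ b i}) ∧
  (interior T).Nonempty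

/-- A triangulation of the plane: finitely many (possibly unbounded) closed triangles that cover
the plane and meet face to face, i.e. two distinct ones meet in a common face (empty, or
a vertex, or a whole common side) of both. -/
structure IsPlaneTriangulation (𝒯 : Finset (Set Plane)) : Prop where
  isTriangle : ∀ T ∈ 𝒯, IsTriangle T
  cover : ∀ x : Plane, ∃ T ∈ 𝒯, x ∈ T
  face_to_face : ∀ T ∈ 𝒯, ∀ T' ∈ 𝒯, T ≠ T' →
    IsExposed ℝ T (T ∩ T') ∧ IsExposed ℝ T' (T ∩ T')

/-- Distinct triangles of a triangulation have disjoint interiors. -/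
theorem IsPlaneTriangulation.disjoint_interior {𝒯 : Finset (Set Plane)}
    (h : IsPlaneTriangulation 𝒯) {T T' : Set Plane} (hT : T ∈ 𝒯) (hT' : T' ∈ 𝒯)
    (hne : T ≠ T') : Disjoint (interior T) (interior T') := by
  have key : ∀ A B : Set Plane, IsExposed ℝ A B → (interior A ∩ B).Nonempty → A ⊆ B := by
    rintro A B hAB ⟨x, hxA, hxB⟩
    obtain ⟨l, hl⟩ := hAB ⟨x, hxB⟩
    have hx := hl ▸ hxB
    have hmax : IsLocalMax l x :=
      Filter.mem_of_superset (mem_interior_iff_mem_nhds.1 hxA) (fun y hy => hx.2 y hy)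
    have h0 : l = 0 := by
      have := hmax.fderiv_eq_zero
      rwa [ContinuousLinearMap.fderiv] at this
    intro y hy
    rw [hl, h0]
    exact ⟨hy, fun z _ => le_rfl⟩
  rw [Set.disjoint_left]
  intro x hx hx'
  obtain ⟨h1, h2⟩ := h.face_to_face T hT T' hT' hne
  have hm : x ∈ T ∩ T' := ⟨interior_subset hx, interior_subset hx'⟩
  exact hne (Set.Subset.antisymm
    (fun y hy => (key T _ h1 ⟨x, hx, hm⟩ hy).2)
    (fun y hy => (key T' _ h2 ⟨x, hx', hm⟩ hy).1))

/-! Take a separating set of m ≤ c√n lines. A random sample of N = O(√r log r) of them, together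
with the four sides of a square enclosing P, cuts the square into convex cells. The cells are
triangulated without new vertices, and the outside of the square is cut into unbounded triangles,
radially over the boundary edges.

Points per triangle: a pair of vertices of the arrangement is defined by four lines, so a union
bound (`exists_sample`) gives a sample such that any two vertices not separated by a sampled line
are separated by at most κ = √(n/r)/6 of the m lines. A line separating two points of a triangle
separates two of its corners, so at most 3κ lines separate points of P in one triangle. These points
lie in distinct cells of those lines, hence are O(κ²) in number (`card_filter_mem_hull_le`), and the
constants make this at most n/r.

Counts: a line meets O(N) closed cells (`card_cells_meeting_line_le`), a consequence of the
Sauer–Shelah bound on sign vectors. Double counting then bounds the total number of cell vertices,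
hence of triangles, by O(N²). Each cell is triangulated by repeatedly halving its boundary
(`exists_balanced_chain`). A line meets boundedly many boundary edges, so it meets O(log N)
triangles of each cell, and O(N log N) in all.

Face to face: hulls of vertices separated by a line that carries at most two of these vertices meet
in a common face (`convexHull_inter_subset_of_separated`). Outside the square, radial scaling
reduces every intersection to one on the boundary. -/

/-! ### Affine functions and convex hulls -/

/-- The value at `x` of the affine function with coefficients `h`. -/
def ev (h : ℝ × ℝ × ℝ) (x : Plane) : ℝ := h.1 * x 0 + h.2.1 * x 1 - h.2.2

/-- The affine function with coefficients `h` is not constant. -/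
def NonConst (h : ℝ × ℝ × ℝ) : Prop := h.1 ≠ 0 ∨ h.2.1 ≠ 0

theorem ev_combo (h : ℝ × ℝ × ℝ) (x y : Plane) {a b : ℝ} (hab : a + b = 1) :
    ev h (a • x + b • y) = a * ev h x + b * ev h y := by
  obtain rfl : b = 1 - a := by linarith
  simp [ev]; ring

theorem ev_neg (h : ℝ × ℝ × ℝ) (x : Plane) : ev (-h) x = - ev h x := by
  simp [ev]; ring

theorem ev_smul (c : ℝ) (h : ℝ × ℝ × ℝ) (x : Plane) : ev (c • h) x = c * ev h x := by
  simp [ev]; ring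

theorem ev_sum {ι : Type*} (s : Finset ι) (h : ι → ℝ × ℝ × ℝ) (x : Plane) :
    ev (∑ i ∈ s, h i) x = ∑ i ∈ s, ev (h i) x := by
  simp [ev, Prod.fst_sum, Prod.snd_sum, Finset.sum_mul, Finset.sum_add_distrib,
    Finset.sum_sub_distrib]

theorem continuous_ev (h : ℝ × ℝ × ℝ) : Continuous (ev h) := by
  unfold ev; fun_prop

theorem convex_ev_le (h : ℝ × ℝ × ℝ) (c : ℝ) : Convex ℝ {x | ev h x ≤ c} := by
  intro x hx y hy a b ha hb hab
  simp only [Set.mem_ofPred_eq] at *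
  rw [ev_combo h x y hab]
  obtain rfl : b = 1 - a := by linarith
  nlinarith

theorem convex_le_ev (h : ℝ × ℝ × ℝ) (c : ℝ) : Convex ℝ {x | c ≤ ev h x} := by
  intro x hx y hy a b ha hb hab
  simp only [Set.mem_ofPred_eq] at *
  rw [ev_combo h x y hab]
  obtain rfl : b = 1 - a := by linarith
  nlinarith

theorem ev_nonneg_of_mem_convexHull {h : ℝ × ℝ × ℝ} {V : Set Plane} (hV : ∀ v ∈ V, 0 ≤ ev h v)
    {x : Plane} (hx : x ∈ convexHull ℝ V) : 0 ≤ ev h x :=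
  convexHull_min (t := {x | 0 ≤ ev h x}) hV (convex_le_ev h 0) hx

theorem ev_nonpos_of_mem_convexHull {h : ℝ × ℝ × ℝ} {V : Set Plane} (hV : ∀ v ∈ V, ev h v ≤ 0)
    {x : Plane} (hx : x ∈ convexHull ℝ V) : ev h x ≤ 0 :=
  convexHull_min (t := {x | ev h x ≤ 0}) hV (convex_ev_le h 0) hx

theorem ev_pos_of_mem_convexHull {h : ℝ × ℝ × ℝ} {V : Set Plane} (hV : ∀ v ∈ V, 0 < ev h v)
    {x : Plane} (hx : x ∈ convexHull ℝ V) : 0 < ev h x := by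
  refine convexHull_min (t := {x | 0 < ev h x}) hV ?_ hx
  intro x hx y hy a b ha hb hab
  simp only [Set.mem_ofPred_eq] at *
  rw [ev_combo h x y hab]
  rcases ha.eq_or_lt with rfl | ha
  · obtain rfl : b = 1 := by linarith
    simpa using hy
  · have := mul_pos ha hx
    have := mul_nonneg hb hy.le
    linarith

/-- A point of a convex hull lying on a supporting line is in the hull of the generators on it. -/
theorem mem_convexHull_zero {h : ℝ × ℝ × ℝ} {V : Set Plane} (hV : ∀ v ∈ V, 0 ≤ ev h v)
    {x : Plane} (hx : x ∈ convexHull ℝ V) (h0 : ev h x = 0) :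
    x ∈ convexHull ℝ (V ∩ {v | ev h v = 0}) := by
  -- The implication is kept inside the set because the nonnegativity together with it is a convex
  -- condition: a proper combination of nonnegative values vanishes only if both do.
  have key : convexHull ℝ V ⊆
      {x | 0 ≤ ev h x ∧ (ev h x = 0 → x ∈ convexHull ℝ (V ∩ {v | ev h v = 0}))} := by
    refine convexHull_min (fun v hv => ⟨hV v hv, fun h1 => subset_convexHull ℝ _ ⟨hv, h1⟩⟩) ?_
    rintro x ⟨hx, hx'⟩ y ⟨hy, hy'⟩ a b ha hb hab
    rcases ha.eq_or_lt with rfl | ha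
    · obtain rfl : b = 1 := by linarith
      simpa using ⟨hy, hy'⟩
    rcases hb.eq_or_lt with rfl | hb
    · obtain rfl : a = 1 := by linarith
      simpa using ⟨hx, hx'⟩
    simp only [Set.mem_ofPred_eq]
    rw [ev_combo h x y hab]
    have h1 := mul_nonneg ha.le hx
    have h2 := mul_nonneg hb.le hy
    refine ⟨by linarith, fun h3 => ?_⟩
    have h4 : a * ev h x = 0 := by linarith
    have h5 : b * ev h y = 0 := by linarith
    exact convex_convexHull ℝ _ (hx' ((mul_eq_zero.1 h4).resolve_left ha.ne'))
      (hy' ((mul_eq_zero.1 h5).resolve_left hb.ne')) ha.le hb.le hab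
  exact (key hx).2 h0

/-- Two is the right bound: with three collinear generators the middle one lies in the hull of the
outer two without being one of them. -/
theorem mem_convexHull_inter_of_subset_pair {p q x : Plane} {A B : Set Plane} (hA : A ⊆ {p, q})
    (hB : B ⊆ {p, q}) (hxA : x ∈ convexHull ℝ A) (hxB : x ∈ convexHull ℝ B) :
    x ∈ convexHull ℝ (A ∩ B) := by
  rcases Set.subset_pair_iff_eq.1 hA with rfl | rfl | rfl | rfl
  · simp at hxA
  · rcases Set.subset_pair_iff_eq.1 hB with rfl | rfl | rfl | rfl
    · simp at hxB
    · simpa using hxA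
    · simp only [convexHull_singleton, Set.mem_singleton_iff] at hxA hxB
      subst hxA; subst hxB; simp
    · rwa [Set.inter_eq_left.2 hA]
  · rcases Set.subset_pair_iff_eq.1 hB with rfl | rfl | rfl | rfl
    · simp at hxB
    · simp only [convexHull_singleton, Set.mem_singleton_iff] at hxA hxB
      subst hxA; subst hxB; simp
    · simpa using hxA
    · rwa [Set.inter_eq_left.2 hA]
  · rwa [Set.inter_eq_right.2 hB]

/-- Two hulls separated by a line on which at most two generators lie meet in a common face. -/
theorem convexHull_inter_subset_of_separated {h : ℝ × ℝ × ℝ} {W W' : Set Plane} {p q : Plane}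
    (hW : ∀ w ∈ W, 0 ≤ ev h w) (hW' : ∀ w ∈ W', ev h w ≤ 0)
    (h0 : ∀ w ∈ W, ev h w = 0 → w = p ∨ w = q) (h0' : ∀ w ∈ W', ev h w = 0 → w = p ∨ w = q) :
    convexHull ℝ W ∩ convexHull ℝ W' ⊆ convexHull ℝ (W ∩ W') := by
  rintro x ⟨hx, hx'⟩
  have hz : ev h x = 0 :=
    le_antisymm (ev_nonpos_of_mem_convexHull hW' hx') (ev_nonneg_of_mem_convexHull hW hx)
  have h1 := mem_convexHull_zero hW hx hz
  have h2 := mem_convexHull_zero (h := -h) (V := W') (by simpa [ev_neg] using hW') hx'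
    (by simpa [ev_neg] using hz)
  refine convexHull_mono (Set.inter_subset_inter Set.inter_subset_left Set.inter_subset_left)
    (mem_convexHull_inter_of_subset_pair (p := p) (q := q) ?_ ?_ h1 h2)
  · rintro w ⟨hw, hw0⟩
    exact h0 w hw hw0
  · rintro w ⟨hw, hw0⟩
    exact h0' w hw (by simpa [ev_neg] using hw0)

/-! ### Counting sign vectors by shattering -/

/-- A combination ∑ w φ that is constant on `Y` obstructs shattering: the pattern {w > 0} would make
it positive, the pattern {w < 0} would make it nonpositive. -/
theorem not_shatters_of_relation {α : Type*} (t : Finset α) (φ : α → Plane → ℝ) (w : α → ℝ)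
    {a₀ : α} (ha₀ : a₀ ∈ t) (hw : w a₀ ≠ 0) (Y : Set Plane)
    (hc : ∀ y ∈ Y, ∀ y' ∈ Y, ∑ a ∈ t, w a * φ a y = ∑ a ∈ t, w a * φ a y') :
    ¬ ∀ U ⊆ t, ∃ y ∈ Y, ∀ a ∈ t, (a ∈ U ↔ 0 < φ a y) := by
  classical
  wlog hpos : 0 < w a₀ generalizing w
  · refine this (fun a => - w a) (neg_ne_zero.2 hw) (fun y hy y' hy' => ?_) ?_
    · simp only [neg_mul, Finset.sum_neg_distrib, hc y hy y' hy']
    · have := lt_of_le_of_ne (not_lt.1 hpos) hw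
      linarith
  intro H
  obtain ⟨y, hy, h1⟩ := H (t.filter (fun a => 0 < w a)) (Finset.filter_subset _ _)
  obtain ⟨z, hz, h2⟩ := H (t.filter (fun a => w a < 0)) (Finset.filter_subset _ _)
  have e1 : 0 < ∑ a ∈ t, w a * φ a y := by
    refine Finset.sum_pos' (fun a ha => ?_) ⟨a₀, ha₀, mul_pos hpos ((h1 a₀ ha₀).1 (Finset.mem_filter.2 ⟨ha₀, hpos⟩))⟩
    by_cases hwa : 0 < w a
    · exact (mul_pos hwa ((h1 a ha).1 (Finset.mem_filter.2 ⟨ha, hwa⟩))).le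
    · have : ¬ 0 < φ a y := fun h => hwa (Finset.mem_filter.1 ((h1 a ha).2 h)).2
      exact mul_nonneg_of_nonpos_of_nonpos (not_lt.1 hwa) (not_lt.1 this)
  have e2 : ∑ a ∈ t, w a * φ a z ≤ 0 := by
    refine Finset.sum_nonpos (fun a ha => ?_)
    by_cases hwa : w a < 0
    · exact (mul_neg_of_neg_of_pos hwa ((h2 a ha).1 (Finset.mem_filter.2 ⟨ha, hwa⟩))).le
    · have : ¬ 0 < φ a z := fun h => hwa (Finset.mem_filter.1 ((h2 a ha).2 h)).2
      exact mul_nonpos_of_nonneg_of_nonpos (not_lt.1 hwa) (not_lt.1 this)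
  rw [hc y hy z hz] at e1
  exact absurd e1 (not_lt.2 e2)

/-- The Sauer–Shelah lemma for families shattering no set of `d + 1` elements. -/
theorem card_le_sum_choose_of_not_shatters {α : Type*} [Fintype α] [DecidableEq α]
    (𝒜 : Finset (Finset α)) (d : ℕ) (h : ∀ t : Finset α, t.card = d + 1 → ¬ 𝒜.Shatters t) :
    𝒜.card ≤ ∑ k ∈ Finset.range (d + 1), (Fintype.card α).choose k := by
  refine (Finset.card_le_card_shatterer 𝒜).trans
    (Finset.card_shatterer_le_sum_vcDim.trans (Finset.sum_le_sum_of_subset ?_))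
  intro k hk
  rw [Finset.mem_Iic] at hk
  rw [Finset.mem_range, Nat.lt_succ_iff]
  refine hk.trans (Finset.sup_le fun t ht => ?_)
  by_contra! hlt
  obtain ⟨t', ht', hc⟩ := Finset.exists_subset_card_eq (Nat.succ_le_of_lt hlt)
  exact h t' hc ((Finset.mem_shatterer.1 ht).mono_right ht')

/-- Points pairwise strictly separated by `n` lines number at most `1 + n + n(n-1)/2`. -/
theorem card_le_of_pairwise_separated {α : Type*} [Fintype α] (g : α → ℝ × ℝ × ℝ)
    (Q : Finset Plane)
    (hQ : ∀ p ∈ Q, ∀ q ∈ Q, p ≠ q → ∃ a, ev (g a) p * ev (g a) q < 0) :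
    Q.card ≤ 1 + Fintype.card α + (Fintype.card α).choose 2 := by
  classical
  let S : Plane → Finset α := fun p => Finset.univ.filter (fun a => 0 < ev (g a) p)
  have hinj : Set.InjOn S Q := by
    intro p hp q hq hpq
    by_contra hne
    obtain ⟨a, ha⟩ := hQ p hp q hq hne
    have h1 : (0 < ev (g a) p ↔ 0 < ev (g a) q) := by
      simpa [S] using Finset.ext_iff.1 hpq a
    rcases mul_neg_iff.1 ha with h | h
    · exact absurd (h1.1 h.1) (not_lt.2 h.2.le)
    · exact absurd (h1.2 h.2) (not_lt.2 h.1.le)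
  rw [← Finset.card_image_of_injOn hinj]
  refine (card_le_sum_choose_of_not_shatters _ 2 ?_).trans (by simp [Finset.sum_range_succ])
  intro t ht hsh
  -- Three normals in ℝ² are dependent, so some combination of the three affine functions is
  -- constant on the plane.
  have hdep : ¬ LinearIndependent ℝ (fun a : t => ((g a).1, (g a).2.1)) := by
    intro hli
    have := hli.fintype_card_le_finrank
    simp [ht] at this
  obtain ⟨w, hw, a₀, ha₀⟩ := Fintype.not_linearIndependent_iff.1 hdep
  let w' : α → ℝ := fun a => if h : a ∈ t then w ⟨a, h⟩ else 0
  have hw' : ∀ a : t, w' a = w a := fun a => by simp [w']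
  have e1 : ∑ a ∈ t, w' a * (g a).1 = 0 := by
    rw [← Finset.sum_coe_sort]
    have := congrArg Prod.fst hw
    simpa [Prod.fst_sum, hw'] using this
  have e2 : ∑ a ∈ t, w' a * (g a).2.1 = 0 := by
    rw [← Finset.sum_coe_sort]
    have := congrArg Prod.snd hw
    simpa [Prod.snd_sum, hw'] using this
  have e3 : ∀ y : Plane, ∑ a ∈ t, w' a * ev (g a) y = - ∑ a ∈ t, w' a * (g a).2.2 := by
    intro y
    have : ∑ a ∈ t, w' a * ev (g a) y = (∑ a ∈ t, w' a * (g a).1) * y 0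
        + (∑ a ∈ t, w' a * (g a).2.1) * y 1 - ∑ a ∈ t, w' a * (g a).2.2 := by
      simp only [Finset.sum_mul, ← Finset.sum_add_distrib, ← Finset.sum_sub_distrib]
      exact Finset.sum_congr rfl fun a _ => by simp only [ev]; ring
    rw [this, e1, e2]; ring
  refine not_shatters_of_relation t (fun a => ev (g a)) w' a₀.2 (by rwa [hw' a₀]) Set.univ
    (fun y _ y' _ => by rw [e3, e3]) ?_
  intro U hU
  obtain ⟨u, hu, htu⟩ := hsh hU
  obtain ⟨p, -, rfl⟩ := Finset.mem_image.1 hu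
  refine ⟨p, trivial, fun a ha => ?_⟩
  rw [← htu]
  simp [S, ha]

/-- A line meets the interiors of at most `n + 1` cells of an arrangement of `n` lines. -/
theorem card_le_of_interior_on_line {α : Type*} [Fintype α] (g : α → ℝ × ℝ × ℝ)
    {h : ℝ × ℝ × ℝ} (hh : NonConst h) (c : ℝ) (𝒮 : Finset (Finset α))
    (h𝒮 : ∀ S ∈ 𝒮, ∃ y, ev h y = c ∧ (∀ a ∈ S, 0 < ev (g a) y) ∧ ∀ a ∉ S, ev (g a) y < 0) :
    𝒮.card ≤ 1 + Fintype.card α := by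
  classical
  refine (card_le_sum_choose_of_not_shatters _ 1 ?_).trans (by simp [Finset.sum_range_succ])
  intro t ht hsh
  -- On a line one dimension is lost: adjoining the normal of `h` to two normals forces a relation,
  -- which makes a combination of the two functions constant on the line.
  let v : Option t → ℝ × ℝ := fun o => o.elim (h.1, h.2.1) (fun a => ((g a).1, (g a).2.1))
  have hdep : ¬ LinearIndependent ℝ v := by
    intro hli
    have := hli.fintype_card_le_finrank
    simp [ht] at this
  obtain ⟨w, hw, o, ho⟩ := Fintype.not_linearIndependent_iff.1 hdep
  rw [Fintype.sum_option] at hw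
  let w' : α → ℝ := fun a => if h : a ∈ t then w (some ⟨a, h⟩) else 0
  have hw' : ∀ a : t, w' a = w (some a) := fun a => by simp [w']
  have e1 : w none * h.1 + ∑ a ∈ t, w' a * (g a).1 = 0 := by
    rw [← Finset.sum_coe_sort]
    have := congrArg Prod.fst hw
    simpa [Prod.fst_sum, hw', v] using this
  have e2 : w none * h.2.1 + ∑ a ∈ t, w' a * (g a).2.1 = 0 := by
    rw [← Finset.sum_coe_sort]
    have := congrArg Prod.snd hw
    simpa [Prod.snd_sum, hw', v] using this
  obtain ⟨a₀, ha₀⟩ : ∃ a : t, w (some a) ≠ 0 := by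
    by_contra! hall
    have hz : ∀ a ∈ t, w' a = 0 := fun a ha => by rw [hw' ⟨a, ha⟩]; exact hall _
    rw [Finset.sum_eq_zero (fun a ha => by rw [hz a ha, zero_mul]), add_zero] at e1 e2
    have hn : w none ≠ 0 := by
      cases o with
      | none => exact ho
      | some a => exact absurd (hall a) ho
    rcases hh with hh | hh
    · exact (mul_ne_zero hn hh) e1
    · exact (mul_ne_zero hn hh) e2
  have e3 : ∀ y : Plane, ev h y = c → ∑ a ∈ t, w' a * ev (g a) y
      = - w none * (c + h.2.2) - ∑ a ∈ t, w' a * (g a).2.2 := by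
    intro y hy
    have : ∑ a ∈ t, w' a * ev (g a) y = (∑ a ∈ t, w' a * (g a).1) * y 0
        + (∑ a ∈ t, w' a * (g a).2.1) * y 1 - ∑ a ∈ t, w' a * (g a).2.2 := by
      simp only [Finset.sum_mul, ← Finset.sum_add_distrib, ← Finset.sum_sub_distrib]
      exact Finset.sum_congr rfl fun a _ => by simp only [ev]; ring
    rw [this, eq_neg_of_add_eq_zero_right e1, eq_neg_of_add_eq_zero_right e2, ← hy]
    simp only [ev]; ring
  refine not_shatters_of_relation t (fun a => ev (g a)) w' a₀.2 (by rwa [hw' a₀]) {y | ev h y = c}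
    (fun y hy y' hy' => by rw [e3 y hy, e3 y' hy']) ?_
  intro U hU
  obtain ⟨u, hu, htu⟩ := hsh hU
  obtain ⟨y, hy, h1, h2⟩ := h𝒮 u hu
  refine ⟨y, hy, fun a ha => ?_⟩
  rw [← htu, Finset.mem_inter]
  refine ⟨fun h => h1 a h.2, fun h => ⟨ha, ?_⟩⟩
  by_contra hn
  exact absurd h (not_lt.2 (h2 a hn).le)

/-! ### Orientation, triangles and exposed faces -/

/-- The oriented line through `p` and `q`: positive to the left. -/
def side (p q : Plane) : ℝ × ℝ × ℝ :=
  (p 1 - q 1, q 0 - p 0, (p 1 - q 1) * p 0 + (q 0 - p 0) * p 1)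

theorem ev_side (p q x : Plane) :
    ev (side p q) x = (q 0 - p 0) * (x 1 - p 1) - (q 1 - p 1) * (x 0 - p 0) := by
  simp only [ev, side]; ring

theorem ev_side_left (p q : Plane) : ev (side p q) p = 0 := by rw [ev_side]; ring

theorem ev_side_right (p q : Plane) : ev (side p q) q = 0 := by rw [ev_side]; ring

theorem ev_side_rotate (p q x : Plane) : ev (side p q) x = ev (side q x) p := by
  rw [ev_side, ev_side]; ring

theorem ev_side_swap (p q x : Plane) : ev (side q p) x = - ev (side p q) x := by
  rw [ev_side, ev_side]; ring

theorem nonConst_of_ev_ne {h : ℝ × ℝ × ℝ} {x y : Plane} (hxy : ev h x ≠ ev h y) : NonConst h := by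
  by_contra hn
  simp only [NonConst, not_or, not_not] at hn
  exact hxy (by simp [ev, hn.1, hn.2])

theorem inner_normal (h : ℝ × ℝ × ℝ) (x : Plane) :
    inner ℝ (!₂[h.1, h.2.1] : Plane) x = ev h x + h.2.2 := by
  simp [ev, PiLp.inner_apply, Fin.sum_univ_two]; ring

theorem plane_ext {x y : Plane} (h0 : x 0 = y 0) (h1 : x 1 = y 1) : x = y := by
  ext i; fin_cases i <;> assumption

theorem normal_ne_zero {h : ℝ × ℝ × ℝ} (hh : NonConst h) : (!₂[h.1, h.2.1] : Plane) ≠ 0 := by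
  intro h0
  rcases hh with hh | hh
  · exact hh (by simpa using congrArg (fun x : Plane => x 0) h0)
  · exact hh (by simpa using congrArg (fun x : Plane => x 1) h0)

theorem isTriangle_of_ev (h : Fin 3 → ℝ × ℝ × ℝ) (hh : ∀ i, NonConst (h i))
    (hint : ∃ x, ∀ i, 0 < ev (h i) x) : IsTriangle {x | ∀ i, 0 ≤ ev (h i) x} := by
  refine ⟨⟨fun i => !₂[(-h i).1, (-h i).2.1], fun i => (-h i).2.2,
    fun i => normal_ne_zero ?_, ?_⟩, ?_⟩
  · simpa [NonConst] using hh i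
  · ext x
    refine forall_congr' fun i => ?_
    rw [inner_normal, ev_neg]
    constructor <;> intro h <;> linarith
  · obtain ⟨x, hx⟩ := hint
    refine ⟨x, ?_⟩
    have ho : IsOpen {x | ∀ i, 0 < ev (h i) x} := by
      simp only [Set.ofPred_forall]
      exact isOpen_iInter_of_finite fun i => isOpen_lt continuous_const (continuous_ev (h i))
    exact interior_maximal (fun y hy i => (hy i).le) ho hx

theorem isExposed_zero {h : ℝ × ℝ × ℝ} {A : Set Plane} (hA : ∀ x ∈ A, 0 ≤ ev h x) :
    IsExposed ℝ A (A ∩ {x | ev h x = 0}) := by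
  rintro ⟨x₀, hx₀, h0⟩
  refine ⟨-(innerSL ℝ (!₂[h.1, h.2.1] : Plane)), ?_⟩
  have e : ∀ x : Plane, (-(innerSL ℝ (!₂[h.1, h.2.1] : Plane))) x = - ev h x - h.2.2 := by
    intro x
    simp only [neg_apply, innerSL_apply_apply, inner_normal]; ring
  ext x
  simp only [Set.mem_inter_iff, Set.mem_ofPred_eq, e]
  refine and_congr_right fun hx => ⟨fun h1 y hy => ?_, fun h1 => ?_⟩
  · have := hA y hy; linarith
  · have := h1 x₀ hx₀
    have h0' : ev h x₀ = 0 := h0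
    have := hA x hx; linarith

theorem convexHull_inter_zero {h : ℝ × ℝ × ℝ} {V : Set Plane} (hV : ∀ v ∈ V, 0 ≤ ev h v) :
    convexHull ℝ V ∩ {x | ev h x = 0} = convexHull ℝ (V ∩ {x | ev h x = 0}) := by
  refine Set.Subset.antisymm (fun x hx => mem_convexHull_zero hV hx.1 hx.2) (fun x hx =>
    ⟨convexHull_mono Set.inter_subset_left hx, le_antisymm ?_ ?_⟩)
  · exact ev_nonpos_of_mem_convexHull (fun v hv => le_of_eq hv.2) hx
  · exact ev_nonneg_of_mem_convexHull (fun v hv => le_of_eq hv.2.symm) hx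

/-- Each side function vanishes at two corners and takes the value `ev (side p q) s` at the third;
adding those opposite to the corners outside `A` gives a supporting function whose zero corners are
exactly `A`. -/
theorem isExposed_convexHull_of_subset_triple {p q s : Plane} (ho : 0 < ev (side p q) s)
    {A : Set Plane} (hA : A ⊆ {p, q, s}) :
    IsExposed ℝ (convexHull ℝ {p, q, s}) (convexHull ℝ A) := by
  classical
  let c : Plane → ℝ := fun v => if v ∈ A then 0 else 1
  have c0 : ∀ v, 0 ≤ c v := fun v => by simp only [c]; split_ifs <;> norm_num
  let h : ℝ × ℝ × ℝ := c p • side q s + c q • side s p + c s • side p q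
  have eh : ∀ x, ev h x = c p * ev (side q s) x + c q * ev (side s p) x + c s * ev (side p q) x := by
    intro x; simp [h, ev]; ring
  have hv : ∀ v ∈ ({p, q, s} : Set Plane), ev h v = c v * ev (side p q) s := by
    rintro v (rfl | rfl | rfl)
    · rw [eh, ev_side_left, ev_side_right, ← ev_side_rotate]; ring
    · rw [eh, ev_side_left, ev_side_right, ev_side_rotate]; ring
    · rw [eh, ev_side_left, ev_side_right]; ring
  have hV : ∀ v ∈ ({p, q, s} : Set Plane), 0 ≤ ev h v := fun v hv' => by
    rw [hv v hv']; exact mul_nonneg (c0 v) ho.le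
  have : A = {p, q, s} ∩ {x | ev h x = 0} := by
    ext v
    refine ⟨fun hvA => ⟨hA hvA, ?_⟩, fun hvA => ?_⟩
    · change ev h v = 0
      rw [hv v (hA hvA)]; simp [c, hvA]
    · by_contra hn
      have h1 : ev h v = 0 := hvA.2
      rw [hv v hvA.1] at h1
      simp [c, hn, ho.ne'] at h1
  rw [this, ← convexHull_inter_zero hV]
  exact isExposed_zero fun x hx => ev_nonneg_of_mem_convexHull hV hx

theorem combo_mem_convexHull_triple (p q s : Plane) {a b c : ℝ} (ha : 0 ≤ a) (hb : 0 ≤ b)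
    (hc : 0 ≤ c) (habc : a + b + c = 1) :
    a • p + b • q + c • s ∈ convexHull ℝ ({p, q, s} : Set Plane) := by
  have := (convex_convexHull ℝ ({p, q, s} : Set Plane)).sum_mem (t := Finset.univ)
    (w := ![a, b, c]) (z := ![p, q, s]) ?_ ?_ ?_
  · simpa [Fin.sum_univ_three] using this
  · intro i _; fin_cases i <;> assumption
  · simpa [Fin.sum_univ_three] using habc
  · intro i _; fin_cases i <;> exact subset_convexHull ℝ _ (by simp)

theorem mem_convexHull_triple_iff {p q s : Plane} (ho : 0 < ev (side p q) s) {x : Plane} :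
    x ∈ convexHull ℝ ({p, q, s} : Set Plane) ↔
      0 ≤ ev (side p q) x ∧ 0 ≤ ev (side q s) x ∧ 0 ≤ ev (side s p) x := by
  constructor
  · intro hx
    refine ⟨?_, ?_, ?_⟩ <;> refine ev_nonneg_of_mem_convexHull ?_ hx
    · rintro v (rfl | rfl | rfl)
      · rw [ev_side_left]
      · rw [ev_side_right]
      · exact ho.le
    · rintro v (rfl | rfl | rfl)
      · rw [← ev_side_rotate]; exact ho.le
      · rw [ev_side_left]
      · rw [ev_side_right]
    · rintro v (rfl | rfl | rfl)
      · rw [ev_side_right]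
      · rw [ev_side_rotate]; exact ho.le
      · rw [ev_side_left]
  · rintro ⟨h1, h2, h3⟩
    set D := ev (side p q) s with hD
    have hsum : ev (side q s) x + ev (side s p) x + ev (side p q) x = D := by
      rw [hD]; simp only [ev_side]; ring
    -- Barycentric coordinates are ratios of oriented areas.
    have hx : x = (ev (side q s) x / D) • p + (ev (side s p) x / D) • q
        + (ev (side p q) x / D) • s := by
      have hD0 := ho.ne'
      apply plane_ext <;> simp <;> field_simp <;> rw [hD] <;> simp only [ev_side] <;> ring
    rw [hx]
    refine combo_mem_convexHull_triple p q s (by positivity) (by positivity) (by positivity) ?_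
    rw [← add_div, ← add_div, hsum, div_self ho.ne']

theorem isTriangle_convexHull {p q s : Plane} (ho : 0 < ev (side p q) s) :
    IsTriangle (convexHull ℝ ({p, q, s} : Set Plane)) := by
  have h1 : ev (side q s) p = ev (side p q) s := (ev_side_rotate p q s).symm
  have h2 : ev (side s p) q = ev (side p q) s := ev_side_rotate s p q
  have : convexHull ℝ ({p, q, s} : Set Plane) =
      {x | ∀ i, 0 ≤ ev ((![side p q, side q s, side s p] : Fin 3 → ℝ × ℝ × ℝ) i) x} := by
    ext x
    rw [mem_convexHull_triple_iff ho]
    simp [Fin.forall_fin_succ]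
  rw [this]
  refine isTriangle_of_ev _ (fun i => ?_)
    ⟨(1 / 3 : ℝ) • p + (1 / 3 : ℝ) • q + (1 / 3 : ℝ) • s, fun i => ?_⟩
  · fin_cases i
    · exact nonConst_of_ev_ne (x := s) (y := p) (by simpa [ev_side_left] using ho.ne')
    · exact nonConst_of_ev_ne (x := p) (y := q) (by simpa [ev_side_left, h1] using ho.ne')
    · exact nonConst_of_ev_ne (x := q) (y := s) (by simpa [ev_side_left, h2] using ho.ne')
  · have e : ∀ i : Fin 3, ev ((![side p q, side q s, side s p] : Fin 3 → ℝ × ℝ × ℝ) i)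
        ((1 / 3 : ℝ) • p + (1 / 3 : ℝ) • q + (1 / 3 : ℝ) • s) = ev (side p q) s / 3 := by
      intro i
      fin_cases i <;> simp [ev_side] <;> ring
    rw [e]; positivity

/-! ### Balanced triangulation of a convex polygon -/

/-- `v 0, …, v (k - 1)` are in counterclockwise strictly convex position. -/
def ConvexSeq (v : ℕ → Plane) (k : ℕ) : Prop :=
  ∀ i j l, i < j → j < l → l < k → 0 < ev (side (v i) (v j)) (v l)

namespace ConvexSeq

variable {v : ℕ → Plane} {k : ℕ}

theorem pos_of_lt (hv : ConvexSeq v k) {i j l : ℕ} (hli : l < i) (hij : i < j) (hj : j < k) :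
    0 < ev (side (v i) (v j)) (v l) := by
  rw [← ev_side_rotate]
  exact hv l i j hli hij hj

theorem neg_of_between (hv : ConvexSeq v k) {i j l : ℕ} (hil : i < l) (hlj : l < j) (hj : j < k) :
    ev (side (v i) (v j)) (v l) < 0 := by
  have := hv i l j hil hlj hj
  rw [ev_side_rotate, ev_side_rotate, ev_side_swap] at this
  linarith

theorem nonneg_outside (hv : ConvexSeq v k) {i j l : ℕ} (hij : i < j) (hj : j < k) (hl : l < k)
    (h : l ≤ i ∨ j ≤ l) : 0 ≤ ev (side (v i) (v j)) (v l) ∧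
      (ev (side (v i) (v j)) (v l) = 0 → v l = v i ∨ v l = v j) := by
  rcases h with h | h
  · rcases h.eq_or_lt with rfl | h
    · exact ⟨(ev_side_left _ _).ge, fun _ => Or.inl rfl⟩
    · have := hv.pos_of_lt h hij hj
      exact ⟨this.le, fun h0 => absurd h0 this.ne'⟩
  · rcases h.eq_or_lt with rfl | h
    · exact ⟨(ev_side_right _ _).ge, fun _ => Or.inr rfl⟩
    · have := hv i j l hij h hl
      exact ⟨this.le, fun h0 => absurd h0 this.ne'⟩

theorem nonpos_between (hv : ConvexSeq v k) {i j l : ℕ} (hj : j < k) (hil : i ≤ l) (hlj : l ≤ j) :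
    ev (side (v i) (v j)) (v l) ≤ 0 ∧
      (ev (side (v i) (v j)) (v l) = 0 → v l = v i ∨ v l = v j) := by
  rcases hil.eq_or_lt with rfl | hil
  · exact ⟨(ev_side_left _ _).le, fun _ => Or.inl rfl⟩
  rcases hlj.eq_or_lt with rfl | hlj
  · exact ⟨(ev_side_right _ _).le, fun _ => Or.inr rfl⟩
  have := hv.neg_of_between hil hlj hj
  exact ⟨this.le, fun h0 => absurd h0 this.ne⟩

/-- The chord through `v p` and `v q` has the vertices between them on its right and the others on
its left, and passes through no further vertex. -/
theorem inter_subset_of_chord (hv : ConvexSeq v k) {p q : ℕ} (hpq : p < q) (hq : q < k)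
    {A B : Set Plane} (hA : ∀ w ∈ A, ∃ i, p ≤ i ∧ i ≤ q ∧ w = v i)
    (hB : ∀ w ∈ B, ∃ i, i < k ∧ (i ≤ p ∨ q ≤ i) ∧ w = v i) :
    convexHull ℝ B ∩ convexHull ℝ A ⊆ convexHull ℝ (B ∩ A) := by
  refine convexHull_inter_subset_of_separated (h := side (v p) (v q)) (p := v p) (q := v q)
    ?_ ?_ ?_ ?_
  · intro w hw
    obtain ⟨i, hi, hi', rfl⟩ := hB w hw
    exact (hv.nonneg_outside hpq hq hi hi').1
  · intro w hw
    obtain ⟨i, hi, hi', rfl⟩ := hA w hw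
    exact (hv.nonpos_between hq hi hi').1
  · intro w hw
    obtain ⟨i, hi, hi', rfl⟩ := hB w hw
    exact (hv.nonneg_outside hpq hq hi hi').2
  · intro w hw
    obtain ⟨i, hi, hi', rfl⟩ := hA w hw
    exact (hv.nonpos_between hq hi hi').2

end ConvexSeq

theorem not_nonConst_of_zero {h : ℝ × ℝ × ℝ} {a b c : Plane} (ho : ev (side a b) c ≠ 0)
    (ha : ev h a = 0) (hb : ev h b = 0) (hc : ev h c = 0) : ¬ NonConst h := by
  rw [ev_side] at ho
  simp only [ev] at ha hb hc
  have h1 : h.1 * ((b 0 - a 0) * (c 1 - a 1) - (b 1 - a 1) * (c 0 - a 0)) = 0 := by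
    linear_combination (c 1 - a 1) * (hb - ha) - (b 1 - a 1) * (hc - ha)
  have h2 : h.2.1 * ((b 0 - a 0) * (c 1 - a 1) - (b 1 - a 1) * (c 0 - a 0)) = 0 := by
    linear_combination (b 0 - a 0) * (hc - ha) - (c 0 - a 0) * (hb - ha)
  rintro (h0 | h0)
  · exact mul_ne_zero h0 ho h1
  · exact mul_ne_zero h0 ho h2

/-- The diagonals of a convex quadrilateral cross, which yields a linear relation with positive
coefficients between the values of `h` at a, c and those at b, d. The signs +, −, +, − force all
values to vanish, impossible for a nonconstant `h`. -/
theorem ConvexSeq.no_alternation {v : ℕ → Plane} {k : ℕ} (hv : ConvexSeq v k) {h : ℝ × ℝ × ℝ}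
    (hh : NonConst h) {a b c d : ℕ} (hab : a < b) (hbc : b < c) (hcd : c < d) (hd : d < k)
    (ha' : 0 ≤ ev h (v a)) (hb' : ev h (v b) ≤ 0) (hc' : 0 ≤ ev h (v c))
    (hd' : ev h (v d) ≤ 0) : False := by
  have hA := hv b c d hbc hcd hd
  have hB := hv a c d (hab.trans hbc) hcd hd
  have hC := hv a b d hab (hbc.trans hcd) hd
  have hD := hv a b c hab hbc (hcd.trans hd)
  have key : ev (side (v b) (v c)) (v d) * ev h (v a) + ev (side (v a) (v b)) (v d) * ev h (v c)
      = ev (side (v a) (v c)) (v d) * ev h (v b) + ev (side (v a) (v b)) (v c) * ev h (v d) := by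
    simp only [ev_side]; simp only [ev]; ring
  have e1 := mul_nonneg hA.le ha'
  have e2 := mul_nonneg hC.le hc'
  have e3 := mul_nonpos_of_nonneg_of_nonpos hB.le hb'
  have e4 := mul_nonpos_of_nonneg_of_nonpos hD.le hd'
  refine not_nonConst_of_zero hD.ne' ?_ ?_ ?_ hh
  · exact (mul_eq_zero.1 (by linarith : _ * ev h (v a) = 0)).resolve_left hA.ne'
  · exact (mul_eq_zero.1 (by linarith : _ * ev h (v b) = 0)).resolve_left hB.ne'
  · exact (mul_eq_zero.1 (by linarith : _ * ev h (v c) = 0)).resolve_left hC.ne'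

open Classical in
/-- The edges `v i, v (i + 1)` of a sequence that meet the line `h`. -/
noncomputable def critical (v : ℕ → Plane) (h : ℝ × ℝ × ℝ) (lo hi : ℕ) : Finset ℕ :=
  (Finset.Ico lo hi).filter (fun i => ev h (v i) * ev h (v (i + 1)) ≤ 0)

/-- Four pairwise disjoint edges meeting the line would offer endpoints with signs +, −, +, − in
order. -/
theorem ConvexSeq.card_le_three {v : ℕ → Plane} {k : ℕ} (hv : ConvexSeq v k) {h : ℝ × ℝ × ℝ}
    (hh : NonConst h) (s : Finset ℕ)
    (hs : ∀ i ∈ s, i + 1 < k ∧ ev h (v i) * ev h (v (i + 1)) ≤ 0)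
    (hgap : ∀ i ∈ s, ∀ j ∈ s, i < j → i + 1 < j) : s.card ≤ 3 := by
  by_contra! hlt
  obtain ⟨t, hts, ht⟩ := Finset.exists_subset_card_eq (Nat.succ_le_of_lt hlt)
  let e := t.orderEmbOfFin ht
  have hm : ∀ i, e i ∈ s := fun i => hts (t.orderEmbOfFin_mem ht i)
  have hg : ∀ i j : Fin 4, i < j → e i + 1 < e j := fun i j hij =>
    hgap _ (hm i) _ (hm j) (e.strictMono hij)
  have hpos : ∀ i ∈ s, ∃ a, i ≤ a ∧ a ≤ i + 1 ∧ 0 ≤ ev h (v a) := by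
    intro i hi
    rcases mul_nonpos_iff.1 (hs i hi).2 with h1 | h1
    · exact ⟨i, le_rfl, by omega, h1.1⟩
    · exact ⟨i + 1, by omega, le_rfl, h1.2⟩
  have hneg : ∀ i ∈ s, ∃ a, i ≤ a ∧ a ≤ i + 1 ∧ ev h (v a) ≤ 0 := by
    intro i hi
    rcases mul_nonpos_iff.1 (hs i hi).2 with h1 | h1
    · exact ⟨i + 1, by omega, le_rfl, h1.2⟩
    · exact ⟨i, le_rfl, by omega, h1.1⟩
  obtain ⟨a, ha, ha', ha0⟩ := hpos _ (hm 0)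
  obtain ⟨b, hb, hb', hb0⟩ := hneg _ (hm 1)
  obtain ⟨c, hc, hc', hc0⟩ := hpos _ (hm 2)
  obtain ⟨d, hd, hd', hd0⟩ := hneg _ (hm 3)
  have h01 := hg 0 1 (by decide)
  have h12 := hg 1 2 (by decide)
  have h23 := hg 2 3 (by decide)
  have hk := (hs _ (hm 3)).1
  exact hv.no_alternation hh (by omega) (by omega) (by omega) (by omega) ha0 hb0 hc0 hd0

/-- Edges whose indices have equal parity are pairwise disjoint, so each parity class contributes at
most three. -/
theorem ConvexSeq.card_critical_le {v : ℕ → Plane} {k : ℕ} (hv : ConvexSeq v k) {h : ℝ × ℝ × ℝ}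
    (hh : NonConst h) (lo hi : ℕ) (hhi : hi < k) : (critical v h lo hi).card ≤ 6 := by
  classical
  rw [← Finset.card_filter_add_card_filter_not (s := critical v h lo hi) (fun i => Even i)]
  have hs : ∀ i ∈ critical v h lo hi, i + 1 < k ∧ ev h (v i) * ev h (v (i + 1)) ≤ 0 := by
    intro i hi'
    rw [critical, Finset.mem_filter, Finset.mem_Ico] at hi'
    exact ⟨by omega, hi'.2⟩
  have h1 := hv.card_le_three hh ((critical v h lo hi).filter (fun i => Even i))
    (fun i hi' => hs i (Finset.mem_filter.1 hi').1) (by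
      intro i hi' j hj hij
      have e1 := Nat.even_iff.1 (Finset.mem_filter.1 hi').2
      have e2 := Nat.even_iff.1 (Finset.mem_filter.1 hj).2
      omega)
  have h2 := hv.card_le_three hh ((critical v h lo hi).filter (fun i => ¬ Even i))
    (fun i hi' => hs i (Finset.mem_filter.1 hi').1) (by
      intro i hi' j hj hij
      have e1 := Nat.not_even_iff.1 (Finset.mem_filter.1 hi').2
      have e2 := Nat.not_even_iff.1 (Finset.mem_filter.1 hj).2
      omega)
  omega

theorem card_critical_add (v : ℕ → Plane) (h : ℝ × ℝ × ℝ) {lo mid hi : ℕ} (h1 : lo ≤ mid)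
    (h2 : mid ≤ hi) :
    (critical v h lo hi).card = (critical v h lo mid).card + (critical v h mid hi).card := by
  classical
  unfold critical
  rw [← Finset.card_union_of_disjoint, ← Finset.filter_union,
    Finset.Ico_union_Ico_eq_Ico h1 h2]
  exact Finset.disjoint_filter_filter (Finset.Ico_disjoint_Ico_consecutive lo mid hi)

theorem pos_of_critical_eq_empty {v : ℕ → Plane} {h : ℝ × ℝ × ℝ} {lo hi : ℕ} (hlt : lo < hi)
    (he : critical v h lo hi = ∅) {i : ℕ} (hlo : lo ≤ i) (hi' : i ≤ hi) :
    0 < ev h (v lo) * ev h (v i) := by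
  have hpos : ∀ j, lo ≤ j → j < hi → 0 < ev h (v j) * ev h (v (j + 1)) := by
    intro j h1 h2
    by_contra! hn
    have : j ∈ critical v h lo hi := Finset.mem_filter.2 ⟨Finset.mem_Ico.2 ⟨h1, h2⟩, hn⟩
    simp [he] at this
  induction i, hlo using Nat.le_induction with
  | base => exact mul_self_pos.2 (left_ne_zero_of_mul (hpos lo le_rfl hlt).ne')
  | succ j hj ih =>
    have h1 := ih (by omega)
    have h2 := mul_pos h1 (hpos j hj (by omega))
    have h3 : 0 < ev h (v j) * ev h (v j) :=
      mul_self_pos.2 (right_ne_zero_of_mul h1.ne')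
    have h4 : ev h (v lo) * ev h (v j) * (ev h (v j) * ev h (v (j + 1)))
      = (ev h (v j) * ev h (v j)) * (ev h (v lo) * ev h (v (j + 1))) := by ring
    rw [h4] at h2
    exact pos_of_mul_pos_right h2 h3.le

/-- The vertices of the triangle with index triple `t`. -/
def corners (v : ℕ → Plane) (t : ℕ × ℕ × ℕ) : Set Plane := {v t.1, v t.2.1, v t.2.2}

theorem mem_corners {v : ℕ → Plane} {t : ℕ × ℕ × ℕ} {w : Plane} {lo hi : ℕ} (h1 : lo ≤ t.1)
    (h2 : t.1 < t.2.1) (h3 : t.2.1 < t.2.2) (h4 : t.2.2 ≤ hi) (hw : w ∈ corners v t) :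
    ∃ i, lo ≤ i ∧ i ≤ hi ∧ w = v i := by
  rcases hw with rfl | rfl | rfl
  · exact ⟨_, h1, by omega, rfl⟩
  · exact ⟨_, by omega, by omega, rfl⟩
  · exact ⟨_, by omega, h4, rfl⟩

-- This triangulates the part of the polygon to the right of the chord `v lo`, `v hi`: the triangle
-- on `lo`, `mid`, `hi` is removed and both remaining pieces are treated recursively. A piece is met
-- by a line only if one of its boundary edges is critical, and each critical edge belongs to one
-- piece per level, so `D` levels cost at most `D` triangles per critical edge.
set_option maxHeartbeats 1000000 in
open Classical in
theorem ConvexSeq.exists_balanced_chain {v : ℕ → Plane} {k : ℕ} (hv : ConvexSeq v k) (D : ℕ) :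
    ∀ lo hi, lo < hi → hi < k → hi - lo ≤ 2 ^ D → ∃ 𝒯 : Finset (ℕ × ℕ × ℕ),
      (∀ t ∈ 𝒯, lo ≤ t.1 ∧ t.1 < t.2.1 ∧ t.2.1 < t.2.2 ∧ t.2.2 ≤ hi) ∧
      (∀ x ∈ convexHull ℝ (v '' {i | i < k}), ev (side (v lo) (v hi)) x ≤ 0 →
        (hi = lo + 1 ∧ x ∈ convexHull ℝ {v lo, v hi}) ∨ ∃ t ∈ 𝒯, x ∈ convexHull ℝ (corners v t)) ∧
      (∀ t ∈ 𝒯, ∀ t' ∈ 𝒯, t ≠ t' → convexHull ℝ (corners v t) ∩ convexHull ℝ (corners v t') ⊆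
        convexHull ℝ (corners v t ∩ corners v t')) ∧
      𝒯.card + 1 ≤ hi - lo ∧
      ∀ h, NonConst h → (𝒯.filter (fun t => ∃ x ∈ convexHull ℝ (corners v t), ev h x = 0)).card ≤
        D * (critical v h lo hi).card := by
  -- A boundary edge supports the whole polygon, so nothing but the edge itself remains on its
  -- right.
  have base : ∀ lo hi, hi = lo + 1 → hi < k → ∀ x ∈ convexHull ℝ (v '' {i | i < k}),
      ev (side (v lo) (v hi)) x ≤ 0 → x ∈ convexHull ℝ {v lo, v hi} := by
    rintro lo hi rfl hk x hx hx0
    have hV : ∀ w ∈ v '' {i | i < k}, 0 ≤ ev (side (v lo) (v (lo + 1))) w ∧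
        (ev (side (v lo) (v (lo + 1))) w = 0 → w = v lo ∨ w = v (lo + 1)) := by
      rintro _ ⟨i, hi, rfl⟩
      exact hv.nonneg_outside (by omega) hk hi (by omega)
    refine convexHull_mono ?_ (mem_convexHull_zero (fun w hw => (hV w hw).1) hx
      (le_antisymm hx0 (ev_nonneg_of_mem_convexHull (fun w hw => (hV w hw).1) hx)))
    rintro w ⟨hw, hw0⟩
    exact (hV w hw).2 hw0
  induction D with
  | zero =>
    intro lo hi hlt hk hD
    have he : hi = lo + 1 := by simp at hD; omega
    exact ⟨∅, by simp, fun x hx hx0 => Or.inl ⟨he, base lo hi he hk x hx hx0⟩, by simp,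
      by simp; omega, by simp⟩
  | succ D ih =>
    intro lo hi hlt hk hD
    by_cases he : hi = lo + 1
    · exact ⟨∅, by simp, fun x hx hx0 => Or.inl ⟨he, base lo hi he hk x hx hx0⟩, by simp,
        by simp; omega, by simp⟩
    obtain ⟨mid, hmid⟩ : ∃ mid, mid = (lo + hi) / 2 := ⟨_, rfl⟩
    rw [pow_succ] at hD
    have hlm : lo < mid := by omega
    have hmh : mid < hi := by omega
    obtain ⟨𝒜, a1, a2, a3, a4, a5⟩ := ih lo mid hlm (by omega) (by omega)
    obtain ⟨ℬ, b1, b2, b3, b4, b5⟩ := ih mid hi hmh (by omega) (by omega)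
    have ho := hv lo mid hi hlm hmh hk
    let t₀ : ℕ × ℕ × ℕ := (lo, mid, hi)
    have hsub : ∀ {a b : Plane}, ({a, b} : Set Plane) ⊆ corners v t₀ → ∀ x ∈ convexHull ℝ {a, b},
        x ∈ convexHull ℝ (corners v t₀) := fun h x hx => convexHull_mono h hx
    have cA : ∀ t ∈ 𝒜, ∀ w ∈ corners v t, ∃ i, lo ≤ i ∧ i ≤ mid ∧ w = v i := fun t ht w hw =>
      mem_corners (a1 t ht).1 (a1 t ht).2.1 (a1 t ht).2.2.1 (a1 t ht).2.2.2 hw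
    have cB : ∀ t ∈ ℬ, ∀ w ∈ corners v t, ∃ i, mid ≤ i ∧ i ≤ hi ∧ w = v i := fun t ht w hw =>
      mem_corners (b1 t ht).1 (b1 t ht).2.1 (b1 t ht).2.2.1 (b1 t ht).2.2.2 hw
    have cAo : ∀ t ∈ 𝒜, ∀ w ∈ corners v t, ∃ i, i < k ∧ (i ≤ mid ∨ hi ≤ i) ∧ w = v i := by
      intro t ht w hw
      obtain ⟨i, h1, h2, rfl⟩ := cA t ht w hw
      exact ⟨i, by omega, Or.inl h2, rfl⟩
    have c0A : ∀ w ∈ corners v t₀, ∃ i, i < k ∧ (i ≤ lo ∨ mid ≤ i) ∧ w = v i := by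
      rintro w (rfl | rfl | rfl)
      · exact ⟨lo, by omega, by omega, rfl⟩
      · exact ⟨mid, by omega, by omega, rfl⟩
      · exact ⟨hi, by omega, by omega, rfl⟩
    have c0B : ∀ w ∈ corners v t₀, ∃ i, i < k ∧ (i ≤ mid ∨ hi ≤ i) ∧ w = v i := by
      rintro w (rfl | rfl | rfl)
      · exact ⟨lo, by omega, by omega, rfl⟩
      · exact ⟨mid, by omega, by omega, rfl⟩
      · exact ⟨hi, by omega, by omega, rfl⟩
    have sAB : ∀ t ∈ 𝒜, ∀ t' ∈ ℬ, convexHull ℝ (corners v t) ∩ convexHull ℝ (corners v t') ⊆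
        convexHull ℝ (corners v t ∩ corners v t') := fun t ht t' ht' =>
      hv.inter_subset_of_chord hmh hk (cB t' ht') (cAo t ht)
    have s0A : ∀ t ∈ 𝒜, convexHull ℝ (corners v t₀) ∩ convexHull ℝ (corners v t) ⊆
        convexHull ℝ (corners v t₀ ∩ corners v t) := fun t ht =>
      hv.inter_subset_of_chord hlm (by omega) (cA t ht) c0A
    have s0B : ∀ t ∈ ℬ, convexHull ℝ (corners v t₀) ∩ convexHull ℝ (corners v t) ⊆
        convexHull ℝ (corners v t₀ ∩ corners v t) := fun t ht =>
      hv.inter_subset_of_chord hmh hk (cB t ht) c0B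
    refine ⟨insert t₀ (𝒜 ∪ ℬ), ?_, ?_, ?_, ?_, ?_⟩
    · intro t ht
      rcases Finset.mem_insert.1 ht with rfl | ht
      · exact ⟨le_rfl, hlm, hmh, le_rfl⟩
      rcases Finset.mem_union.1 ht with ht | ht
      · have := a1 t ht; omega
      · have := b1 t ht; omega
    · intro x hx hx0
      refine Or.inr ?_
      -- A point right of one of the short chords belongs to that recursive piece; if the piece
      -- degenerates to an edge, the point lies on a side of `t₀`. A point left of both chords lies
      -- in `t₀`.
      by_cases h1 : ev (side (v lo) (v mid)) x ≤ 0
      · rcases a2 x hx h1 with ⟨-, h⟩ | ⟨t, ht, h⟩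
        · refine ⟨t₀, by simp, hsub ?_ x h⟩
          rintro w (rfl | rfl) <;> simp [corners, t₀]
        · exact ⟨t, by simp [ht], h⟩
      by_cases h2 : ev (side (v mid) (v hi)) x ≤ 0
      · rcases b2 x hx h2 with ⟨-, h⟩ | ⟨t, ht, h⟩
        · refine ⟨t₀, by simp, hsub ?_ x h⟩
          rintro w (rfl | rfl) <;> simp [corners, t₀]
        · exact ⟨t, by simp [ht], h⟩
      refine ⟨t₀, by simp, (mem_convexHull_triple_iff ho).2 ⟨(not_le.1 h1).le, (not_le.1 h2).le, ?_⟩⟩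
      rw [ev_side_swap]; linarith
    · intro t ht t' ht' hne
      rcases Finset.mem_insert.1 ht with rfl | ht <;> rcases Finset.mem_insert.1 ht' with rfl | ht'
      · exact absurd rfl hne
      · rcases Finset.mem_union.1 ht' with ht' | ht'
        · exact s0A t' ht'
        · exact s0B t' ht'
      · rw [Set.inter_comm, Set.inter_comm (corners v t)]
        rcases Finset.mem_union.1 ht with ht | ht
        · exact s0A t ht
        · exact s0B t ht
      · rcases Finset.mem_union.1 ht with ht | ht <;> rcases Finset.mem_union.1 ht' with ht' | ht'
        · exact a3 t ht t' ht' hne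
        · exact sAB t ht t' ht'
        · rw [Set.inter_comm, Set.inter_comm (corners v t)]
          exact sAB t' ht' t ht
        · exact b3 t ht t' ht' hne
    · have h1 := Finset.card_insert_le t₀ (𝒜 ∪ ℬ)
      have h2 := Finset.card_union_le 𝒜 ℬ
      omega
    · intro h hh
      have hA := a5 h hh
      have hB := b5 h hh
      have hadd := card_critical_add v h hlm.le hmh.le
      set f : ℕ × ℕ × ℕ → Prop := fun t => ∃ x ∈ convexHull ℝ (corners v t), ev h x = 0 with hf
      by_cases hc : critical v h lo hi = ∅
      · have : (insert t₀ (𝒜 ∪ ℬ)).filter f = ∅ := by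
          refine Finset.filter_eq_empty_iff.2 fun t ht => ?_
          rintro ⟨x, hx, hx0⟩
          -- Multiplying `h` by its value at `v lo` makes the common strict sign of all vertices of
          -- the piece positive.
          have hw : ∀ w ∈ corners v t, 0 < ev (ev h (v lo) • h) w := by
            intro w hw
            have : ∃ i, lo ≤ i ∧ i ≤ hi ∧ w = v i := by
              rcases Finset.mem_insert.1 ht with rfl | ht
              · exact mem_corners le_rfl hlm hmh le_rfl hw
              rcases Finset.mem_union.1 ht with ht | ht
              · obtain ⟨i, h1, h2, rfl⟩ := cA t ht w hw
                exact ⟨i, by omega, by omega, rfl⟩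
              · obtain ⟨i, h1, h2, rfl⟩ := cB t ht w hw
                exact ⟨i, by omega, by omega, rfl⟩
            obtain ⟨i, h1, h2, rfl⟩ := this
            have := pos_of_critical_eq_empty hlt hc h1 h2
            rwa [ev_smul]
          have h1 := ev_pos_of_mem_convexHull hw hx
          rw [ev_smul, hx0, mul_zero] at h1
          exact lt_irrefl _ h1
        rw [this]; simp
      -- The new triangle is charged to one critical edge, which exists in this case.
      · have hpos : 1 ≤ (critical v h lo hi).card :=
          Finset.card_pos.2 (Finset.nonempty_iff_ne_empty.2 hc)
        have h1 : ((insert t₀ (𝒜 ∪ ℬ)).filter f).card ≤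
            1 + ((𝒜.filter f).card + (ℬ.filter f).card) := by
          have : (insert t₀ (𝒜 ∪ ℬ)).filter f ⊆ insert t₀ (𝒜.filter f ∪ ℬ.filter f) := by
            intro t ht
            simp only [Finset.mem_filter, Finset.mem_insert, Finset.mem_union] at ht ⊢
            obtain ⟨h0 | h0 | h0, hf'⟩ := ht
            · exact Or.inl h0
            · exact Or.inr (Or.inl ⟨h0, hf'⟩)
            · exact Or.inr (Or.inr ⟨h0, hf'⟩)
          refine (Finset.card_le_card this).trans ((Finset.card_insert_le _ _).trans ?_)
          have := Finset.card_union_le (𝒜.filter f) (ℬ.filter f)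
          omega
        calc _ ≤ 1 + ((𝒜.filter f).card + (ℬ.filter f).card) := h1
          _ ≤ (critical v h lo hi).card + (D * (critical v h lo mid).card
              + D * (critical v h mid hi).card) := by gcongr
          _ = (D + 1) * (critical v h lo hi).card := by rw [hadd]; ring

/-! ### Sorting points in convex position by angle -/

/-- A finite set of points in convex position can be listed in counterclockwise order. -/
theorem exists_convexSeq (V : Finset Plane) (hV : ∀ v ∈ V, v ∉ convexHull ℝ ((V : Set Plane) \ {v}))
    (hne : V.Nonempty) :
    ∃ v : ℕ → Plane, ConvexSeq v V.card ∧ v '' {i | i < V.card} = V := by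
  classical
  -- A point `o` farthest from the origin is a convenient pivot: all other points lie strictly on
  -- the inner side φ > 0 of the tangent at `o` to the circle through it, so their angular order
  -- about `o` is the order of the slopes ψ/φ.
  obtain ⟨o, ho, hmax⟩ := V.exists_max_image (fun x => x 0 ^ 2 + x 1 ^ 2) hne
  let φ : Plane → ℝ := fun a => o 0 * (o 0 - a 0) + o 1 * (o 1 - a 1)
  let ψ : Plane → ℝ := fun a => o 1 * (a 0 - o 0) - o 0 * (a 1 - o 1)
  have hφ : ∀ a ∈ V, a ≠ o → 0 < φ a := by
    intro a ha hao
    have h1 := hmax a ha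
    have h2 : 0 < (o 0 - a 0) ^ 2 + (o 1 - a 1) ^ 2 := by
      by_contra! hn
      refine hao (plane_ext ?_ ?_) <;> nlinarith [sq_nonneg (o 0 - a 0), sq_nonneg (o 1 - a 1)]
    simp only [φ]
    nlinarith
  have hO : ∀ a b, (o 0 ^ 2 + o 1 ^ 2) * ev (side o a) b = φ a * ψ b - ψ a * φ b := by
    intro a b; simp only [ev_side, φ, ψ]; ring
  let key : Plane → ℝ := fun a => ψ a / φ a
  have hkey : ∀ a ∈ V, a ≠ o → ∀ b ∈ V, b ≠ o → key a < key b → 0 < ev (side o a) b := by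
    intro a ha hao b hb hbo hlt
    have h1 := hφ a ha hao
    have h2 := hφ b hb hbo
    rw [div_lt_div_iff₀ h1 h2] at hlt
    have h3 := hO a b
    by_contra! hn
    have : (o 0 ^ 2 + o 1 ^ 2) * ev (side o a) b ≤ 0 :=
      mul_nonpos_of_nonneg_of_nonpos (by positivity) hn
    linarith
  have hcol : ∀ a ∈ V, a ≠ o → ∀ b ∈ V, b ≠ o → key a = key b → φ a ≤ φ b → a = b := by
    intro a ha hao b hb hbo heq hle
    by_contra hab
    have h1 := hφ a ha hao
    have h2 := hφ b hb hbo
    have ho2 : 0 < o 0 ^ 2 + o 1 ^ 2 := by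
      by_contra! hn
      have e0 : o 0 = 0 := by nlinarith [sq_nonneg (o 0), sq_nonneg (o 1)]
      have e1 : o 1 = 0 := by nlinarith [sq_nonneg (o 0), sq_nonneg (o 1)]
      simp [φ, e0, e1] at h1
    have h3 : ev (side o a) b = 0 := by
      have e := hO a b
      simp only [key] at heq
      rw [div_eq_div_iff h1.ne' h2.ne'] at heq
      have : (o 0 ^ 2 + o 1 ^ 2) * ev (side o a) b = 0 := by rw [e]; linarith
      exact (mul_eq_zero.1 this).resolve_left ho2.ne'
    rw [ev_side] at h3
    -- Equal slopes put `a` and `b` on one ray from `o`; the one with smaller φ is then between `o`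
    -- and the other, against convex position.
    have ea : a = (1 - φ a / φ b) • o + (φ a / φ b) • b := by
      have hne := h2.ne'
      apply plane_ext
      · simp; field_simp; simp only [φ]; linear_combination - o 1 * h3
      · simp; field_simp; simp only [φ]; linear_combination o 0 * h3
    refine hV a ha ?_
    rw [ea]
    refine convex_convexHull ℝ _ (subset_convexHull ℝ _ ?_) (subset_convexHull ℝ _ ?_) ?_ ?_ ?_
    · exact ⟨ho, fun h => hao (by rw [← ea] at h; exact h.symm)⟩
    · exact ⟨hb, fun h => hab (by rw [← ea] at h; exact h.symm)⟩
    · rw [sub_nonneg]; exact (div_le_one h2).2 hle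
    · positivity
    · ring
  have hinj : Set.InjOn key (V.erase o : Finset Plane) := by
    intro a ha b hb hab
    rw [Finset.coe_erase] at ha hb
    rcases le_total (φ a) (φ b) with h | h
    · exact hcol a ha.1 ha.2 b hb.1 hb.2 hab h
    · exact (hcol b hb.1 hb.2 a ha.1 ha.2 hab.symm h).symm
  let S := (V.erase o).image key
  have hS : S.card = V.card - 1 := by
    rw [Finset.card_image_of_injOn hinj, Finset.card_erase_of_mem ho]
  have hVpos := Finset.card_pos.2 hne
  have hinv : ∀ r : S, ∃ a ∈ V.erase o, key a = r := fun r => Finset.mem_image.1 r.2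
  choose g hg hgk using hinv
  let e := S.orderIsoOfFin hS
  -- Index 0 is the pivot and index i ≥ 1 is the point with the (i − 1)-st smallest slope; indices
  -- out of range default to `o`.
  let v : ℕ → Plane := fun i => if h : i - 1 < V.card - 1 ∧ i ≠ 0 then g (e ⟨i - 1, h.1⟩) else o
  have hv0 : v 0 = o := by simp [v]
  have hvi : ∀ i, 0 < i → i < V.card → v i ∈ V ∧ v i ≠ o := by
    intro i hi hik
    have : v i = g (e ⟨i - 1, by omega⟩) := dif_pos ⟨by omega, by omega⟩
    rw [this]
    have := hg (e ⟨i - 1, by omega⟩)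
    exact ⟨Finset.mem_of_mem_erase this, Finset.ne_of_mem_erase this⟩
  have hvk : ∀ i j, 0 < i → i < j → j < V.card → key (v i) < key (v j) := by
    intro i j hi hij hj
    have h1 : v i = g (e ⟨i - 1, by omega⟩) := dif_pos ⟨by omega, by omega⟩
    have h2 : v j = g (e ⟨j - 1, by omega⟩) := dif_pos ⟨by omega, by omega⟩
    rw [h1, h2, hgk, hgk]
    exact e.strictMono (by rw [Fin.mk_lt_mk]; omega)
  have hvV : ∀ i, i < V.card → v i ∈ V := by
    intro i hi
    rcases Nat.eq_zero_or_pos i with rfl | hp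
    · rwa [hv0]
    · exact (hvi i hp hi).1
  have hvo : ∀ i j, 0 < i → i < j → j < V.card → 0 < ev (side o (v i)) (v j) := by
    intro i j hi hij hj
    have a := hvi i hi (by omega)
    have b := hvi j (by omega) hj
    exact hkey _ a.1 a.2 _ b.1 b.2 (hvk i j hi hij hj)
  refine ⟨v, ?_, ?_⟩
  · intro i j l hij hjl hl
    rcases Nat.eq_zero_or_pos i with rfl | hi
    · rw [hv0]; exact hvo j l hij hjl hl
    by_contra! hn
    refine hV (v j) (hvV j (by omega)) ?_
    have h1 := hvo i j hi hij (by omega)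
    have h2 := hvo j l (by omega) hjl hl
    have h3 := hvo i l hi (by omega) hl
    -- A wrong turn at `v j` puts it inside the triangle spanned by `o`, `v i`, `v l`, since `v j`
    -- is angularly between the last two.
    have hmem : v j ∈ convexHull ℝ ({o, v i, v l} : Set Plane) := by
      rw [mem_convexHull_triple_iff h3]
      refine ⟨h1.le, ?_, ?_⟩
      · rw [ev_side_rotate, ev_side_rotate, ev_side_swap]; linarith
      · rw [ev_side_rotate]; exact h2.le
    refine convexHull_mono ?_ hmem
    rintro w (rfl | rfl | rfl)
    · exact ⟨ho, fun h => (hvi j (by omega) (by omega)).2 h.symm⟩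
    · exact ⟨hvV i (by omega), fun h => (hvk i j hi hij (by omega)).ne (by rw [h])⟩
    · exact ⟨hvV l hl, fun h => (hvk j l (by omega) hjl hl).ne (by rw [h])⟩
  · ext w
    constructor
    · rintro ⟨i, hi, rfl⟩
      exact hvV i hi
    · intro hw
      by_cases hwo : w = o
      · exact ⟨0, hVpos, by rw [hv0, hwo]⟩
      have hwS : key w ∈ S := Finset.mem_image_of_mem _ (Finset.mem_erase.2 ⟨hwo, hw⟩)
      let i := e.symm ⟨key w, hwS⟩
      have hi := i.2
      refine ⟨i + 1, by simp only [Set.mem_ofPred_eq]; omega, ?_⟩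
      have h1 : v (i + 1) = g (e i) := dif_pos ⟨by omega, by omega⟩
      have h2 : e i = ⟨key w, hwS⟩ := e.apply_symm_apply _
      rw [h1, h2]
      exact hinj (hg _) (Finset.mem_coe.2 (Finset.mem_erase.2 ⟨hwo, hw⟩)) (hgk _)

/-! ### Cells of a line arrangement and their vertices -/

/-- The determinant of the normals of two lines; it vanishes iff they are parallel. -/
def cross (h h' : ℝ × ℝ × ℝ) : ℝ := h.1 * h'.2.1 - h.2.1 * h'.1

/-- The intersection point of two nonparallel lines. -/
noncomputable def meet (h h' : ℝ × ℝ × ℝ) : Plane :=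
  !₂[(h.2.2 * h'.2.1 - h.2.1 * h'.2.2) / cross h h', (h.1 * h'.2.2 - h.2.2 * h'.1) / cross h h']

theorem eq_meet {h h' : ℝ × ℝ × ℝ} (hc : cross h h' ≠ 0) {x : Plane} (hx : ev h x = 0)
    (hx' : ev h' x = 0) : x = meet h h' := by
  simp only [ev] at hx hx'
  apply plane_ext
  · simp only [meet, PiLp.toLp_apply, Matrix.cons_val_zero]
    rw [eq_div_iff hc]; simp only [cross]; linear_combination h'.2.1 * hx - h.2.1 * hx'
  · simp only [meet, PiLp.toLp_apply, Matrix.cons_val_one, Matrix.cons_val_zero]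
    rw [eq_div_iff hc]; simp only [cross]; linear_combination h.1 * hx' - h'.1 * hx

section Cells

variable {J : Type*} (g : J → ℝ × ℝ × ℝ)

/-- The closed cell of the arrangement `g` with sign vector `S`. -/
def cell (S : Finset J) : Set Plane :=
  {x | (∀ j ∈ S, 0 ≤ ev (g j) x) ∧ ∀ j ∉ S, ev (g j) x ≤ 0}

/-- `y` is an interior point of the cell with sign vector `S`. -/
def InteriorPt (S : Finset J) (y : Plane) : Prop :=
  (∀ j ∈ S, 0 < ev (g j) y) ∧ ∀ j ∉ S, ev (g j) y < 0

variable {g} {S S' : Finset J}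

theorem InteriorPt.mem_cell {y : Plane} (hy : InteriorPt g S y) : y ∈ cell g S :=
  ⟨fun j hj => (hy.1 j hj).le, fun j hj => (hy.2 j hj).le⟩

theorem convex_cell : Convex ℝ (cell g S) := by
  have : cell g S = (⋂ j ∈ S, {x | 0 ≤ ev (g j) x}) ∩ ⋂ j ∉ S, {x | ev (g j) x ≤ 0} := by
    ext x; simp [cell]
  rw [this]
  exact (convex_iInter₂ fun j _ => convex_le_ev _ _).inter
    (convex_iInter₂ fun j _ => convex_ev_le _ _)

theorem isClosed_cell : IsClosed (cell g S) := by
  have : cell g S = (⋂ j ∈ S, {x | 0 ≤ ev (g j) x}) ∩ ⋂ j ∉ S, {x | ev (g j) x ≤ 0} := by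
    ext x; simp [cell]
  rw [this]
  exact (isClosed_biInter fun j _ => isClosed_le continuous_const (continuous_ev _)).inter
    (isClosed_biInter fun j _ => isClosed_le (continuous_ev _) continuous_const)

theorem InteriorPt.eventually [Fintype J] {y : Plane} (hy : InteriorPt g S y) (w : Plane) :
    ∀ᶠ δ : ℝ in nhds 0, InteriorPt g S (y + δ • w) := by
  have hc : ∀ j, Continuous fun δ : ℝ => ev (g j) (y + δ • w) := fun j =>
    (continuous_ev _).comp (by fun_prop)
  have h1 : ∀ j, ∀ᶠ δ : ℝ in nhds 0, j ∈ S → 0 < ev (g j) (y + δ • w) := by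
    intro j
    by_cases hj : j ∈ S
    · have := (hc j).tendsto 0
      filter_upwards [this.eventually_const_lt (u := 0) (by simpa using hy.1 j hj)] with δ hδ _
      exact hδ
    · exact Filter.Eventually.of_forall fun δ h => absurd h hj
  have h2 : ∀ j, ∀ᶠ δ : ℝ in nhds 0, j ∉ S → ev (g j) (y + δ • w) < 0 := by
    intro j
    by_cases hj : j ∈ S
    · exact Filter.Eventually.of_forall fun δ h => absurd hj h
    · have := (hc j).tendsto 0
      filter_upwards [this.eventually_lt_const (u := 0) (by simpa using hy.2 j hj)] with δ hδ _
      exact hδ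
  filter_upwards [Filter.eventually_all.2 h1, Filter.eventually_all.2 h2] with δ a b
  exact ⟨a, b⟩

theorem ev_add_smul (h : ℝ × ℝ × ℝ) (x w : Plane) (δ : ℝ) :
    ev h (x + δ • w) = ev h x + δ * (h.1 * w 0 + h.2.1 * w 1) := by
  simp [ev]; ring

/-- A vertex of a cell is the intersection of two nonparallel lines of the arrangement. -/
theorem exists_cross_ne_of_mem_extremePoints [Fintype J] (hg : ∀ j, NonConst (g j)) {v : Plane}
    (hv : v ∈ Set.extremePoints ℝ (cell g S)) :
    ∃ i j, cross (g i) (g j) ≠ 0 ∧ ev (g i) v = 0 ∧ ev (g j) v = 0 := by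
  by_contra! hcon
  -- If no two lines through `v` cross, there is a direction `w` parallel to all of them (any
  -- direction if there are none). Then `v` can move slightly both ways along `w` inside the cell,
  -- so it is not extreme.
  obtain ⟨w, hw, hact⟩ : ∃ w : Plane, w ≠ 0 ∧
      ∀ j, ev (g j) v = 0 → (g j).1 * w 0 + (g j).2.1 * w 1 = 0 := by
    by_cases hex : ∃ i, ev (g i) v = 0
    · obtain ⟨i, hi⟩ := hex
      refine ⟨!₂[-(g i).2.1, (g i).1], ?_, ?_⟩
      · intro h0
        rcases hg i with hh | hh
        · exact hh (by simpa using congrArg (fun x : Plane => x 1) h0)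
        · exact hh (by simpa using congrArg (fun x : Plane => x 0) h0)
      · intro j hj
        have : cross (g i) (g j) = 0 := by
          by_contra hne
          exact hcon i j hne hi hj
        simp only [cross] at this
        simp; linarith
    · push Not at hex
      refine ⟨!₂[1, 0], ?_, fun j hj => absurd hj (hex j)⟩
      intro h0
      simpa using congrArg (fun x : Plane => x 0) h0
  have hev : ∀ᶠ δ : ℝ in nhds 0, v + δ • w ∈ cell g S := by
    have h1 : ∀ j, ∀ᶠ δ : ℝ in nhds 0, (j ∈ S → 0 ≤ ev (g j) (v + δ • w)) ∧
        (j ∉ S → ev (g j) (v + δ • w) ≤ 0) := by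
      intro j
      by_cases hj : ev (g j) v = 0
      · refine Filter.Eventually.of_forall fun δ => ?_
        rw [ev_add_smul, hj, hact j hj]; simp
      · have hc : Filter.Tendsto (fun δ : ℝ => ev (g j) (v + δ • w)) (nhds 0)
            (nhds (ev (g j) v)) := by
          have : Continuous fun δ : ℝ => ev (g j) (v + δ • w) :=
            (continuous_ev _).comp (by fun_prop)
          simpa using this.tendsto 0
        by_cases hjS : j ∈ S
        · have := lt_of_le_of_ne (hv.1.1 j hjS) (Ne.symm hj)
          filter_upwards [hc.eventually_const_lt this] with δ hδ
          exact ⟨fun _ => hδ.le, fun h => absurd hjS h⟩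
        · have := lt_of_le_of_ne (hv.1.2 j hjS) hj
          filter_upwards [hc.eventually_lt_const this] with δ hδ
          exact ⟨fun h => absurd h hjS, fun _ => hδ.le⟩
    filter_upwards [Filter.eventually_all.2 h1] with δ hδ
    exact ⟨fun j => (hδ j).1, fun j => (hδ j).2⟩
  obtain ⟨ε, hε, hball⟩ := Metric.eventually_nhds_iff.1 hev
  have hp : v + (ε / 2) • w ∈ cell g S := hball (by simp [abs_of_pos hε]; linarith)
  have hm : v + (-(ε / 2)) • w ∈ cell g S := hball (by simp [abs_of_pos hε]; linarith)
  have := hv.2 hp hm ⟨1 / 2, 1 / 2, by norm_num, by norm_num, by norm_num, by module⟩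
  have h2 : (ε / 2) • w = 0 := by simpa using this
  rcases smul_eq_zero.1 h2 with h | h
  · linarith
  · exact hw h

theorem finite_extremePoints_cell [Fintype J] (hg : ∀ j, NonConst (g j)) :
    (Set.extremePoints ℝ (cell g S)).Finite := by
  refine (Set.finite_range fun p : J × J => meet (g p.1) (g p.2)).subset fun v hv => ?_
  obtain ⟨i, j, hc, hi, hj⟩ := exists_cross_ne_of_mem_extremePoints hg hv
  exact ⟨(i, j), (eq_meet hc hi hj).symm⟩

/-- The vertices of a cell. -/
noncomputable def vertices [Fintype J] (hg : ∀ j, NonConst (g j)) (S : Finset J) : Finset Plane :=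
  (finite_extremePoints_cell (S := S) hg).toFinset

theorem coe_vertices [Fintype J] (hg : ∀ j, NonConst (g j)) :
    (vertices hg S : Set Plane) = Set.extremePoints ℝ (cell g S) :=
  Set.Finite.coe_toFinset _

theorem mem_vertices [Fintype J] (hg : ∀ j, NonConst (g j)) {v : Plane} :
    v ∈ vertices hg S ↔ v ∈ Set.extremePoints ℝ (cell g S) :=
  Set.Finite.mem_toFinset _

theorem convexHull_vertices [Fintype J] (hg : ∀ j, NonConst (g j)) (hb : Bornology.IsBounded (cell g S)) :
    convexHull ℝ (vertices hg S : Set Plane) = cell g S := by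
  have hc : IsCompact (cell g S) := Metric.isCompact_of_isClosed_isBounded isClosed_cell hb
  rw [← closure_convexHull_extremePoints hc convex_cell, coe_vertices]
  exact ((finite_extremePoints_cell hg).isClosed_convexHull ℝ).closure_eq.symm

theorem vertices_convexPosition [Fintype J] (hg : ∀ j, NonConst (g j)) {v : Plane} (hv : v ∈ vertices hg S) :
    v ∉ convexHull ℝ ((vertices hg S : Set Plane) \ {v}) := by
  have h1 := (mem_vertices hg).1 hv
  have h2 := (convex_cell.mem_extremePoints_iff_convex_sdiff.1 h1).2
  intro h
  have h3 : convexHull ℝ ((vertices hg S : Set Plane) \ {v}) ⊆ cell g S \ {v} := by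
    refine convexHull_min (Set.sdiff_subset_sdiff_left ?_) h2
    rw [coe_vertices]; exact extremePoints_subset
  exact (h3 h).2 rfl

-- Among three points of a line, ordered by the coordinate τ along it, the middle one lies in an
-- open segment and is not extreme.
open Classical in
theorem card_extreme_on_line_le {A : Set Plane} (V : Finset Plane)
    (hV : ∀ v ∈ V, v ∈ Set.extremePoints ℝ A) {h : ℝ × ℝ × ℝ} (hh : NonConst h) :
    (V.filter (fun v => ev h v = 0)).card ≤ 2 := by
  by_contra! hlt
  set F := V.filter (fun v => ev h v = 0) with hF
  let τ : Plane → ℝ := fun x => h.1 * x 1 - h.2.1 * x 0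
  have hpos : 0 < h.1 ^ 2 + h.2.1 ^ 2 := by
    rcases hh with hh | hh
    · have := pow_pos (abs_pos.2 hh) 2; rw [sq_abs] at this; positivity
    · have := pow_pos (abs_pos.2 hh) 2; rw [sq_abs] at this; positivity
  have hline : ∀ x y z : Plane, ev h x = 0 → ev h y = 0 → ev h z = 0 → ∀ a b : ℝ, a + b = 1 →
      τ z = a * τ x + b * τ y → a • x + b • y = z := by
    intro x y z hx hy hz a b hab ht
    obtain rfl : b = 1 - a := by linarith
    simp only [ev, τ] at *
    apply plane_ext
    · refine mul_left_cancel₀ hpos.ne' ?_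
      simp only [PiLp.add_apply, PiLp.smul_apply, smul_eq_mul]
      linear_combination h.1 * (a * hx + (1 - a) * hy - hz) + h.2.1 * ht
    · refine mul_left_cancel₀ hpos.ne' ?_
      simp only [PiLp.add_apply, PiLp.smul_apply, smul_eq_mul]
      linear_combination h.2.1 * (a * hx + (1 - a) * hy - hz) - h.1 * ht
  have hinj : ∀ x ∈ F, ∀ y ∈ F, τ x = τ y → x = y := by
    intro x hx y hy hxy
    have := hline x x y (Finset.mem_filter.1 hx).2 (Finset.mem_filter.1 hx).2
      (Finset.mem_filter.1 hy).2 1 0 (by norm_num) (by linarith)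
    simpa using this
  have hne : F.Nonempty := Finset.card_pos.1 (by omega)
  obtain ⟨a, ha, hmax⟩ := F.exists_max_image τ hne
  obtain ⟨c, hc, hmin⟩ := F.exists_min_image τ hne
  obtain ⟨b, hb, hbn⟩ : ∃ b ∈ F, b ∉ ({a, c} : Finset Plane) := by
    by_contra! hsub
    have := (Finset.card_le_card (fun b hb => hsub b hb)).trans (Finset.card_le_two (a := a) (b := c))
    omega
  simp only [Finset.mem_insert, Finset.mem_singleton, not_or] at hbn
  have h1 : τ b < τ a := lt_of_le_of_ne (hmax b hb) fun h => hbn.1 (hinj b hb a ha h)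
  have h2 : τ c < τ b := lt_of_le_of_ne (hmin b hb) fun h => hbn.2 (hinj c hc b hb h).symm
  have h3 : 0 < τ a - τ c := by linarith
  have hseg : b ∈ openSegment ℝ a c := by
    refine ⟨(τ b - τ c) / (τ a - τ c), (τ a - τ b) / (τ a - τ c), div_pos (by linarith) h3,
      div_pos (by linarith) h3, by field_simp; ring, ?_⟩
    refine hline a c b (Finset.mem_filter.1 ha).2 (Finset.mem_filter.1 hc).2
      (Finset.mem_filter.1 hb).2 _ _ (by field_simp; ring) (by field_simp; ring)
  have hVF : ∀ v ∈ F, v ∈ Set.extremePoints ℝ A := fun v hv => hV v (Finset.mem_filter.1 hv).1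
  have := (hVF b hb).2 (hVF a ha).1 (hVF c hc).1 hseg
  exact hbn.1 this.symm

-- Every vertex lies on some line of the arrangement touching the cell, and each such line carries
-- at most two vertices.
open Classical in
theorem card_vertices_le [Fintype J] (hg : ∀ j, NonConst (g j)) :
    (vertices hg S).card ≤
      2 * (Finset.univ.filter (fun j => (cell g S ∩ {x | ev (g j) x = 0}).Nonempty)).card := by
  set T := Finset.univ.filter (fun j => (cell g S ∩ {x | ev (g j) x = 0}).Nonempty)
  have hsub : vertices hg S ⊆ T.biUnion (fun j => (vertices hg S).filter (fun v => ev (g j) v = 0)) := by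
    intro v hv
    have hv' := (mem_vertices hg).1 hv
    obtain ⟨i, -, -, hi, -⟩ := exists_cross_ne_of_mem_extremePoints hg hv'
    exact Finset.mem_biUnion.2 ⟨i, Finset.mem_filter.2 ⟨Finset.mem_univ _, v, hv'.1, hi⟩,
      Finset.mem_filter.2 ⟨hv, hi⟩⟩
  refine (Finset.card_le_card hsub).trans (Finset.card_biUnion_le.trans ?_)
  rw [mul_comm]
  exact Finset.sum_le_card_nsmul _ _ _ fun j _ =>
    card_extreme_on_line_le _ (fun v hv => (mem_vertices hg).1 hv) (hg j)

/-- With at most two vertices the cell would lie on a line, but it has an interior point. -/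
theorem two_lt_card_vertices [Fintype J] (hg : ∀ j, NonConst (g j)) (hb : Bornology.IsBounded (cell g S))
    {y : Plane} (hy : InteriorPt g S y) : 2 < (vertices hg S).card := by
  by_contra! hle
  obtain ⟨h, hh, h0⟩ : ∃ h, NonConst h ∧ ∀ v ∈ vertices hg S, ev h v = 0 := by
    obtain ⟨p, q, hpq⟩ : ∃ p q : Plane, p ≠ q ∧ ∀ v ∈ vertices hg S, v = p ∨ v = q := by
      have hle' := hle
      interval_cases hc : (vertices hg S).card
      · exact ⟨!₂[0, 0], !₂[1, 0], fun h => by simpa using congrArg (fun x : Plane => x 0) h, by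
          rw [Finset.card_eq_zero.1 hc]; simp⟩
      · obtain ⟨p, hp⟩ := Finset.card_eq_one.1 hc
        refine ⟨p, p + !₂[1, 0], fun h => by simpa using congrArg (fun x : Plane => x 0) h, ?_⟩
        rw [hp]; simp
      · obtain ⟨p, q, hne, hpq⟩ := Finset.card_eq_two.1 hc
        exact ⟨p, q, hne, by rw [hpq]; simp⟩
    refine ⟨side p q, ?_, ?_⟩
    · by_contra hn
      simp only [NonConst, side, not_or, not_not] at hn
      exact hpq.1 (plane_ext (by linarith) (by linarith))
    · intro v hv
      rcases hpq.2 v hv with rfl | rfl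
      · exact ev_side_left _ _
      · exact ev_side_right _ _
  have hzero : ∀ x ∈ cell g S, ev h x = 0 := by
    intro x hx
    rw [← convexHull_vertices hg hb] at hx
    exact le_antisymm (ev_nonpos_of_mem_convexHull (fun v hv => (h0 v hv).le) hx)
      (ev_nonneg_of_mem_convexHull (fun v hv => (h0 v hv).ge) hx)
  -- Moving the interior point along the normal of `h` stays in the cell and changes the value of
  -- `h`.
  obtain ⟨ε, hε, hball⟩ := Metric.eventually_nhds_iff.1 (hy.eventually !₂[h.1, h.2.1])
  have h1 := hzero _ (hball (y := ε / 2) (by simp [abs_of_pos hε]; linarith)).mem_cell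
  rw [ev_add_smul, hzero y hy.mem_cell] at h1
  simp only [Matrix.cons_val_zero, Matrix.cons_val_one, zero_add] at h1
  have h2 : h.1 * h.1 + h.2.1 * h.2.1 = 0 := (mul_eq_zero.1 h1).resolve_left (by positivity)
  rcases hh with hh | hh
  · exact hh (by nlinarith [mul_self_nonneg h.1, mul_self_nonneg h.2.1])
  · exact hh (by nlinarith [mul_self_nonneg h.1, mul_self_nonneg h.2.1])

/-- Distinct cells are separated by a line cutting out their common face from both. -/
theorem exists_ev_cell_inter (g : J → ℝ × ℝ × ℝ) (S S' : Finset J) :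
    ∃ h, (∀ x ∈ cell g S, 0 ≤ ev h x) ∧ (∀ x ∈ cell g S', ev h x ≤ 0) ∧
      cell g S ∩ {x | ev h x = 0} = cell g S ∩ cell g S' ∧
      cell g S' ∩ {x | ev h x = 0} = cell g S ∩ cell g S' := by
  classical
  -- The separating function adds up, with the sign of `S`, the functions on which the two sign
  -- vectors differ. All summands are nonnegative on the cell of `S`, so the sum vanishes only where
  -- each of them does, which is on the cell of `S'`.
  have key : ∀ S S' : Finset J, ∀ x ∈ cell g S,
      0 ≤ ev (∑ j ∈ S \ S', g j - ∑ j ∈ S' \ S, g j) x ∧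
      (ev (∑ j ∈ S \ S', g j - ∑ j ∈ S' \ S, g j) x = 0 ↔ x ∈ cell g S') := by
    intro S S' x hx
    have e : ev (∑ j ∈ S \ S', g j - ∑ j ∈ S' \ S, g j) x
        = ∑ j ∈ S \ S', ev (g j) x + ∑ j ∈ S' \ S, -ev (g j) x := by
      have : ∀ a b : ℝ × ℝ × ℝ, ev (a - b) x = ev a x - ev b x := fun a b => by
        simp [ev]; ring
      rw [this, ev_sum, ev_sum, Finset.sum_neg_distrib]; ring
    have p1 : ∀ j ∈ S \ S', 0 ≤ ev (g j) x := fun j hj => hx.1 j (Finset.mem_sdiff.1 hj).1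
    have p2 : ∀ j ∈ S' \ S, 0 ≤ -ev (g j) x := fun j hj => by
      have := hx.2 j (Finset.mem_sdiff.1 hj).2; linarith
    have q1 := Finset.sum_nonneg p1
    have q2 := Finset.sum_nonneg p2
    rw [e]
    refine ⟨by linarith, fun h0 => ?_, fun hx' => ?_⟩
    · have z1 := (Finset.sum_eq_zero_iff_of_nonneg p1).1 (by linarith)
      have z2 := (Finset.sum_eq_zero_iff_of_nonneg p2).1 (by linarith)
      refine ⟨fun j hj => ?_, fun j hj => ?_⟩
      · by_cases hjS : j ∈ S
        · exact hx.1 j hjS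
        · have := z2 j (Finset.mem_sdiff.2 ⟨hj, hjS⟩); linarith
      · by_cases hjS : j ∈ S
        · exact (z1 j (Finset.mem_sdiff.2 ⟨hjS, hj⟩)).le
        · exact hx.2 j hjS
    · rw [Finset.sum_eq_zero, Finset.sum_eq_zero, add_zero]
      · intro j hj
        have h1 := hx'.1 j (Finset.mem_sdiff.1 hj).1
        have := p2 j hj
        linarith
      · intro j hj
        exact le_antisymm (hx'.2 j (Finset.mem_sdiff.1 hj).2) (p1 j hj)
  have hneg : ∀ x, ev (∑ j ∈ S' \ S, g j - ∑ j ∈ S \ S', g j) x =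
      -ev (∑ j ∈ S \ S', g j - ∑ j ∈ S' \ S, g j) x := fun x => by
    rw [← ev_neg, neg_sub]
  refine ⟨∑ j ∈ S \ S', g j - ∑ j ∈ S' \ S, g j, fun x hx => (key S S' x hx).1, fun x hx => ?_,
    ?_, ?_⟩
  · have := (key S' S x hx).1
    rw [hneg] at this; linarith
  · ext x
    exact and_congr_right fun hx => (key S S' x hx).2
  · ext x
    rw [Set.inter_comm (cell g S)]
    refine and_congr_right fun hx => ?_
    have := (key S' S x hx).2
    rwa [hneg, neg_eq_zero] at this

/-- Cells have the same vertices on their common face. -/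
theorem vertex_iff_of_mem_inter [Fintype J] (hg : ∀ j, NonConst (g j)) {x : Plane} (hx : x ∈ cell g S)
    (hx' : x ∈ cell g S') : x ∈ vertices hg S ↔ x ∈ vertices hg S' := by
  obtain ⟨h, h1, h2, h3, h4⟩ := exists_ev_cell_inter g S S'
  have e1 := (isExposed_zero h1).isExtreme.extremePoints_eq
  have e2 := (isExposed_zero (h := -h) (A := cell g S')
    (fun x hx => by rw [ev_neg]; linarith [h2 x hx])).isExtreme.extremePoints_eq
  have h5 : {x | ev (-h) x = 0} = {x | ev h x = 0} := by ext x; simp [ev_neg]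
  rw [h5, h4] at e2
  rw [h3, e2] at e1
  have := Set.ext_iff.1 e1 x
  simp only [Set.mem_inter_iff, hx, hx', true_and] at this
  rw [mem_vertices, mem_vertices, this]

/-- Together with the bound on extreme points of a line, this shows that two distinct cells share at
most two vertices. -/
theorem exists_ev_zero_of_ne (hne : S ≠ S') :
    ∃ j, ∀ x ∈ cell g S, x ∈ cell g S' → ev (g j) x = 0 := by
  obtain ⟨j, hj⟩ : ∃ j, ¬ (j ∈ S ↔ j ∈ S') := by
    by_contra! h; exact hne (Finset.ext h)
  refine ⟨j, fun x hx hx' => ?_⟩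
  by_cases h1 : j ∈ S
  · have h2 : j ∉ S' := fun h2 => hj (by simp [h1, h2])
    exact le_antisymm (hx'.2 j h2) (hx.1 j h1)
  · have h2 : j ∈ S' := by by_contra h2; exact hj (by simp [h1, h2])
    exact le_antisymm (hx.2 j h1) (hx'.1 j h2)

theorem subset_pair_of_card_le_two (F : Finset Plane) (hF : F.card ≤ 2) :
    ∃ p q, ∀ v ∈ F, v = p ∨ v = q := by
  classical
  interval_cases hc : F.card
  · exact ⟨0, 0, by rw [Finset.card_eq_zero.1 hc]; simp⟩
  · obtain ⟨p, hp⟩ := Finset.card_eq_one.1 hc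
    exact ⟨p, p, by rw [hp]; simp⟩
  · obtain ⟨p, q, -, hpq⟩ := Finset.card_eq_two.1 hc
    exact ⟨p, q, by rw [hpq]; simp⟩

/-- Hulls of vertices of two distinct cells meet in the hull of the common vertices. -/
theorem convexHull_inter_subset_of_cells [Fintype J] (hg : ∀ j, NonConst (g j)) (hne : S ≠ S')
    {W W' : Set Plane} (hW : W ⊆ vertices hg S) (hW' : W' ⊆ vertices hg S') :
    convexHull ℝ W ∩ convexHull ℝ W' ⊆ convexHull ℝ (W ∩ W') := by
  classical
  obtain ⟨h, h1, h2, h3, h4⟩ := exists_ev_cell_inter g S S'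
  obtain ⟨j, hj⟩ := exists_ev_zero_of_ne (g := g) hne
  obtain ⟨p, q, hpq⟩ := subset_pair_of_card_le_two _
    (card_extreme_on_line_le (vertices hg S) (fun v hv => (mem_vertices hg).1 hv) (hg j))
  have hc : ∀ {S : Finset J} {w}, w ∈ vertices hg S → w ∈ cell g S := fun hw =>
    ((mem_vertices hg).1 hw).1
  have hF : ∀ w ∈ vertices hg S, w ∈ cell g S' → w = p ∨ w = q := fun w hw hw' =>
    hpq w (Finset.mem_filter.2 ⟨hw, hj w (hc hw) hw'⟩)
  -- The zero line of `h` touches each cell in their common face, which lies on the line `g j` and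
  -- so contains at most the two vertices `p` and `q`.
  refine convexHull_inter_subset_of_separated (h := h) (p := p) (q := q)
    (fun w hw => h1 w (hc (hW hw))) (fun w hw => h2 w (hc (hW' hw))) ?_ ?_
  · intro w hw h0
    have : w ∈ cell g S ∩ {x | ev h x = 0} := ⟨hc (hW hw), h0⟩
    rw [h3] at this
    exact hF w (hW hw) this.2
  · intro w hw h0
    have : w ∈ cell g S' ∩ {x | ev h x = 0} := ⟨hc (hW' hw), h0⟩
    rw [h4] at this
    exact hF w ((vertex_iff_of_mem_inter hg this.1 this.2).2 (hW' hw)) this.2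

/-- A balanced triangulation of a bounded cell. -/
theorem exists_cell_triangulation [Fintype J] (hg : ∀ j, NonConst (g j)) (hb : Bornology.IsBounded (cell g S))
    {y : Plane} (hy : InteriorPt g S y) {D : ℕ} (hD : (vertices hg S).card ≤ 2 ^ D) :
    ∃ 𝒯 : Finset (Fin 3 → Plane),
      (∀ t ∈ 𝒯, Set.range t ⊆ vertices hg S ∧ 0 < ev (side (t 0) (t 1)) (t 2)) ∧
      (∀ x ∈ cell g S, ∃ t ∈ 𝒯, x ∈ convexHull ℝ (Set.range t)) ∧
      (∀ t ∈ 𝒯, ∀ t' ∈ 𝒯, t ≠ t' → convexHull ℝ (Set.range t) ∩ convexHull ℝ (Set.range t') ⊆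
        convexHull ℝ (Set.range t ∩ Set.range t')) ∧
      𝒯.card ≤ (vertices hg S).card ∧
      ∀ h, NonConst h →
        {t | t ∈ 𝒯 ∧ ∃ x ∈ convexHull ℝ (Set.range t), ev h x = 0}.ncard ≤ 6 * D := by
  classical
  have h3 := two_lt_card_vertices hg hb hy
  obtain ⟨v, hv, hvr⟩ := exists_convexSeq (vertices hg S)
    (fun v hv => vertices_convexPosition hg hv) (Finset.card_pos.1 (by omega))
  set k := (vertices hg S).card with hk
  obtain ⟨𝒯, t1, t2, t3, t4, t5⟩ := hv.exists_balanced_chain D 0 (k - 1) (by omega) (by omega)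
    (by omega)
  let F : ℕ × ℕ × ℕ → Fin 3 → Plane := fun t => ![v t.1, v t.2.1, v t.2.2]
  have hF : ∀ t, Set.range (F t) = corners v t := by
    intro t
    ext w
    constructor
    · rintro ⟨i, rfl⟩
      fin_cases i <;> simp [F, corners]
    · rintro (rfl | rfl | rfl)
      exacts [⟨0, rfl⟩, ⟨1, rfl⟩, ⟨2, rfl⟩]
  refine ⟨𝒯.image F, ?_, ?_, ?_, ?_, ?_⟩
  · intro _ hmem
    obtain ⟨t, ht, rfl⟩ := Finset.mem_image.1 hmem
    have h1 := t1 t ht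
    refine ⟨?_, hv t.1 t.2.1 t.2.2 h1.2.1 h1.2.2.1 (by omega)⟩
    rw [hF]
    intro w hw
    obtain ⟨i, -, hi, rfl⟩ := mem_corners h1.1 h1.2.1 h1.2.2.1 h1.2.2.2 hw
    rw [← hvr]
    exact ⟨i, by simp only [Set.mem_ofPred_eq]; omega, rfl⟩
  · intro x hx
    rw [← convexHull_vertices hg hb, ← hvr] at hx
    have hle : ∀ w ∈ v '' {i | i < k}, ev (side (v 0) (v (k - 1))) w ≤ 0 := by
      rintro _ ⟨i, hi, rfl⟩
      simp only [Set.mem_ofPred_eq] at hi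
      exact (hv.nonpos_between (by omega) (Nat.zero_le _) (by omega)).1
    rcases t2 x hx (ev_nonpos_of_mem_convexHull hle hx) with ⟨h, -⟩ | ⟨t, ht, hxt⟩
    · exfalso; omega
    · exact ⟨F t, Finset.mem_image_of_mem _ ht, by rwa [hF]⟩
  · intro _ hmem _ hmem' hne
    obtain ⟨t, ht, rfl⟩ := Finset.mem_image.1 hmem
    obtain ⟨t', ht', rfl⟩ := Finset.mem_image.1 hmem'
    rw [hF, hF]
    exact t3 t ht t' ht' fun h => hne (by rw [h])
  · exact Finset.card_image_le.trans (by omega)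
  · intro h hh
    have : {t | t ∈ 𝒯.image F ∧ ∃ x ∈ convexHull ℝ (Set.range t), ev h x = 0} ⊆
        F '' (𝒯.filter (fun t => ∃ x ∈ convexHull ℝ (corners v t), ev h x = 0) : Finset _) := by
      rintro _ ⟨hmem, hx⟩
      obtain ⟨t, ht, rfl⟩ := Finset.mem_image.1 hmem
      rw [hF] at hx
      exact ⟨t, by simpa using ⟨ht, hx⟩, rfl⟩
    refine (Set.ncard_le_ncard this (Set.toFinite _)).trans ((Set.ncard_image_le
      (Set.toFinite _)).trans ?_)
    rw [Set.ncard_coe_finset]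
    refine (t5 h hh).trans ?_
    rw [mul_comm]
    exact Nat.mul_le_mul_right _ (hv.card_critical_le hh 0 (k - 1) (by omega))

end Cells

/-! ### Cells met by a line; generic perturbation -/

section Cells

variable {J : Type*} {g : J → ℝ × ℝ × ℝ} {S S' : Finset J}

theorem InteriorPt.combo {x y : Plane} (hx : x ∈ cell g S) (hy : InteriorPt g S y) {a b : ℝ}
    (ha : 0 ≤ a) (hb : 0 < b) (hab : a + b = 1) : InteriorPt g S (a • x + b • y) := by
  refine ⟨fun j hj => ?_, fun j hj => ?_⟩ <;> rw [ev_combo _ _ _ hab]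
  · have := mul_nonneg ha (hx.1 j hj)
    have := mul_pos hb (hy.1 j hj)
    linarith
  · have := mul_nonpos_of_nonneg_of_nonpos ha (hx.2 j hj)
    have := mul_neg_of_pos_of_neg hb (hy.2 j hj)
    linarith

open Classical in
/-- A line meets a linear number of closed cells. -/
theorem card_cells_meeting_line_le [Fintype J] (𝒮 : Finset (Finset J))
    (h𝒮 : ∀ S ∈ 𝒮, ∃ y, InteriorPt g S y) {h : ℝ × ℝ × ℝ} (hh : NonConst h) :
    (𝒮.filter (fun S => (cell g S ∩ {x | ev h x = 0}).Nonempty)).card ≤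
      3 * (1 + Fintype.card J) := by
  have hY : ∀ S, ∃ y, S ∈ 𝒮 → InteriorPt g S y := fun S => by
    by_cases hS : S ∈ 𝒮
    · obtain ⟨y, hy⟩ := h𝒮 S hS
      exact ⟨y, fun _ => hy⟩
    · exact ⟨0, fun h => absurd h hS⟩
  choose Y hY using hY
  -- For the cells with a chosen interior point on the positive side, the line is translated to the
  -- lowest level of these points. The translate meets the interiors of all these cells, where the
  -- sign-vector bound applies. The negative side and the line itself give the other two thirds.
  have hpos : ∀ h, NonConst h → (𝒮.filter (fun S => (cell g S ∩ {x | ev h x = 0}).Nonempty ∧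
      0 < ev h (Y S))).card ≤ 1 + Fintype.card J := by
    intro h hh
    set 𝒵 := 𝒮.filter (fun S => (cell g S ∩ {x | ev h x = 0}).Nonempty ∧ 0 < ev h (Y S)) with h𝒵
    rcases 𝒵.eq_empty_or_nonempty with he | hne
    · rw [he]; simp
    obtain ⟨S₀, hS₀, hmin⟩ := 𝒵.exists_min_image (fun S => ev h (Y S)) hne
    have hp₀ := (Finset.mem_filter.1 hS₀).2.2
    refine card_le_of_interior_on_line g hh (ev h (Y S₀)) 𝒵 fun S hS => ?_
    obtain ⟨hS1, ⟨x, hx, hx0⟩, hSp⟩ := Finset.mem_filter.1 hS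
    have hx0 : ev h x = 0 := hx0
    have hle := hmin S hS
    -- The point at the common level on the segment from a point of the cell on the line to its
    -- interior point; the segment is interior except possibly at its start.
    refine ⟨(1 - ev h (Y S₀) / ev h (Y S)) • x + (ev h (Y S₀) / ev h (Y S)) • Y S, ?_,
      InteriorPt.combo hx (hY S hS1) ?_ (by positivity) (by ring)⟩
    · rw [ev_combo _ _ _ (by ring), hx0, mul_zero, zero_add, div_mul_cancel₀ _ hSp.ne']
    · rw [sub_nonneg, div_le_one hSp]; exact hle
  have h1 := hpos h hh
  have h2 := hpos (-h) (by simpa [NonConst] using hh)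
  have h3 : (𝒮.filter (fun S => (cell g S ∩ {x | ev h x = 0}).Nonempty ∧
      ev h (Y S) = 0)).card ≤ 1 + Fintype.card J :=
    card_le_of_interior_on_line g hh 0 _ fun S hS =>
      ⟨Y S, (Finset.mem_filter.1 hS).2.2, hY S (Finset.mem_filter.1 hS).1⟩
  have hsub : 𝒮.filter (fun S => (cell g S ∩ {x | ev h x = 0}).Nonempty) ⊆
      𝒮.filter (fun S => (cell g S ∩ {x | ev h x = 0}).Nonempty ∧ 0 < ev h (Y S)) ∪
      (𝒮.filter (fun S => (cell g S ∩ {x | ev (-h) x = 0}).Nonempty ∧ 0 < ev (-h) (Y S)) ∪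
      𝒮.filter (fun S => (cell g S ∩ {x | ev h x = 0}).Nonempty ∧ ev h (Y S) = 0)) := by
    intro S hS
    simp only [Finset.mem_filter, Finset.mem_union, ev_neg, neg_eq_zero, Left.neg_pos_iff] at hS ⊢
    rcases lt_trichotomy (ev h (Y S)) 0 with h | h | h
    · exact Or.inr (Or.inl ⟨hS.1, hS.2, h⟩)
    · exact Or.inr (Or.inr ⟨hS.1, hS.2, h⟩)
    · exact Or.inl ⟨hS.1, hS.2, h⟩
  have h4 := (Finset.card_le_card hsub).trans ((Finset.card_union_le _ _).trans
    (Nat.add_le_add_left (Finset.card_union_le _ _) _))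
  omega

/-- A line meets the parabola (t, t²) in at most two points, so for small t > 0 the parabola avoids
all the lines, while strict inequalities at the origin persist. -/
theorem exists_generic_point [Finite J] (hg : ∀ j, NonConst (g j)) {B : Finset J}
    (hB : ∀ j ∈ B, 0 < ev (g j) 0) :
    ∃ o, (∀ j, ev (g j) o ≠ 0) ∧ ∀ j ∈ B, 0 < ev (g j) o := by
  have h1 : ∀ j, ∀ᶠ t : ℝ in nhdsWithin 0 (Set.Ioi 0), ev (g j) !₂[t, t ^ 2] ≠ 0 := by
    intro j
    have e : ∀ t : ℝ, ev (g j) !₂[t, t ^ 2] = (g j).1 * t + (g j).2.1 * t ^ 2 - (g j).2.2 := by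
      intro t; simp [ev]
    simp only [e]
    by_cases hc : (g j).2.2 = 0
    · have hf : ∀ᶠ t : ℝ in nhdsWithin 0 (Set.Ioi 0), (g j).1 + (g j).2.1 * t ≠ 0 := by
        by_cases ha : (g j).1 = 0
        · have hb : (g j).2.1 ≠ 0 := (hg j).resolve_left (not_not.2 ha)
          filter_upwards [self_mem_nhdsWithin] with t ht
          have ht : 0 < t := ht
          simp [ha, hb, ht.ne']
        · have : Filter.Tendsto (fun t : ℝ => (g j).1 + (g j).2.1 * t) (nhds 0)
              (nhds ((g j).1 + (g j).2.1 * 0)) :=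
            (by fun_prop : Continuous fun t : ℝ => (g j).1 + (g j).2.1 * t).tendsto 0
          exact (this.mono_left nhdsWithin_le_nhds).eventually_ne (by simpa using ha)
      filter_upwards [hf, self_mem_nhdsWithin] with t h1 h2
      have h2 : 0 < t := h2
      rw [hc, show (g j).1 * t + (g j).2.1 * t ^ 2 - 0 = ((g j).1 + (g j).2.1 * t) * t by ring]
      exact mul_ne_zero h1 h2.ne'
    · have := (by fun_prop : Continuous fun t : ℝ =>
        (g j).1 * t + (g j).2.1 * t ^ 2 - (g j).2.2).tendsto 0
      exact (this.mono_left nhdsWithin_le_nhds).eventually_ne (by simpa using hc)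
  have h2 : ∀ j, ∀ᶠ t : ℝ in nhdsWithin 0 (Set.Ioi 0), j ∈ B → 0 < ev (g j) !₂[t, t ^ 2] := by
    intro j
    by_cases hj : j ∈ B
    · have hc : Continuous fun t : ℝ => ev (g j) !₂[t, t ^ 2] :=
        (continuous_ev _).comp (by fun_prop)
      have h0 : 0 < ev (g j) !₂[(0 : ℝ), 0 ^ 2] := by
        have := hB j hj
        simpa [ev] using this
      filter_upwards [((hc.tendsto 0).mono_left nhdsWithin_le_nhds).eventually_const_lt h0]
        with t ht _ using ht
    · exact Filter.Eventually.of_forall fun t h => absurd h hj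
  obtain ⟨t, ht⟩ := ((Filter.eventually_all.2 h1).and (Filter.eventually_all.2 h2)).exists
  exact ⟨_, ht.1, ht.2⟩

/-- A point of the box and a nearby one lie in a common cell inside the box. -/
theorem exists_cell_of_pair [Fintype J] {B : Finset J} {o x y : Plane}
    (ho : ∀ j, ev (g j) o ≠ 0) (hoB : ∀ j ∈ B, 0 < ev (g j) o) (hy : ∀ j ∈ B, 0 ≤ ev (g j) y)
    (hxy : ∀ j, ev (g j) x ≠ 0 → 0 < ev (g j) x * ev (g j) y) :
    ∃ S, B ⊆ S ∧ (∃ z, InteriorPt g S z) ∧ x ∈ cell g S ∧ y ∈ cell g S := by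
  classical
  have e : ∀ j (δ : ℝ), ev (g j) ((1 - δ) • y + δ • o) = (1 - δ) * ev (g j) y + δ * ev (g j) o :=
    fun j δ => ev_combo _ _ _ (by ring)
  have h1 : ∀ j, ∀ᶠ δ : ℝ in nhdsWithin 0 (Set.Ioi 0),
      ev (g j) ((1 - δ) • y + δ • o) ≠ 0 ∧
      (ev (g j) y ≠ 0 → 0 < ev (g j) y * ev (g j) ((1 - δ) • y + δ • o)) := by
    intro j
    by_cases hj : ev (g j) y = 0
    · filter_upwards [self_mem_nhdsWithin] with δ hδ
      have hδ : 0 < δ := hδ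
      rw [e, hj]
      simp [hδ.ne', ho j]
    · have hc : Continuous fun δ : ℝ => ev (g j) y * ev (g j) ((1 - δ) • y + δ • o) :=
        continuous_const.mul ((continuous_ev _).comp (by fun_prop))
      have h0 : 0 < ev (g j) y * ev (g j) ((1 - (0 : ℝ)) • y + (0 : ℝ) • o) := by
        simpa using mul_self_pos.2 hj
      filter_upwards [((hc.tendsto 0).mono_left nhdsWithin_le_nhds).eventually_const_lt h0]
        with δ hδ
      exact ⟨right_ne_zero_of_mul hδ.ne', fun _ => hδ⟩
  obtain ⟨δ, hδ, hδ0, hδ1⟩ := ((Filter.eventually_all.2 h1).and (Filter.Eventually.and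
    self_mem_nhdsWithin (mem_nhdsWithin_of_mem_nhds (gt_mem_nhds one_pos)))).exists
  have hδ0 : 0 < δ := hδ0
  have hδ1 : δ < 1 := hδ1
  -- Nudging `y` towards the generic point `o` makes every value nonzero without changing the
  -- nonzero signs at `y`. Wherever `x` has a nonzero sign, `y` shares it, so the cell of `z`
  -- contains both.
  set z := (1 - δ) • y + δ • o with hz
  have hyz : ∀ j, (0 < ev (g j) z → 0 ≤ ev (g j) y) ∧ (ev (g j) z < 0 → ev (g j) y ≤ 0) := by
    intro j
    refine ⟨fun h => ?_, fun h => ?_⟩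
    · by_contra! hn
      exact absurd ((hδ j).2 hn.ne) (not_lt.2 (mul_nonpos_of_nonpos_of_nonneg hn.le h.le))
    · by_contra! hn
      exact absurd ((hδ j).2 hn.ne') (not_lt.2 (mul_nonpos_of_nonneg_of_nonpos hn.le h.le))
  have hneg : ∀ j, ¬ 0 < ev (g j) z → ev (g j) z < 0 := fun j h =>
    lt_of_le_of_ne (not_lt.1 h) (hδ j).1
  refine ⟨Finset.univ.filter (fun j => 0 < ev (g j) z), ?_, ⟨z, ?_, ?_⟩, ⟨?_, ?_⟩, ⟨?_, ?_⟩⟩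
  · intro j hj
    refine Finset.mem_filter.2 ⟨Finset.mem_univ _, ?_⟩
    rw [hz, e]
    have := mul_nonneg (by linarith : 0 ≤ 1 - δ) (hy j hj)
    have := mul_pos hδ0 (hoB j hj)
    linarith
  · intro j hj; exact (Finset.mem_filter.1 hj).2
  · intro j hj; exact hneg j (by simpa using hj)
  · intro j hj
    have h := (hyz j).1 (Finset.mem_filter.1 hj).2
    by_contra! hn
    exact absurd (hxy j hn.ne) (not_lt.2 (mul_nonpos_of_nonpos_of_nonneg hn.le h))
  · intro j hj
    have h := (hyz j).2 (hneg j (by simpa using hj))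
    by_contra! hn
    exact absurd (hxy j hn.ne') (not_lt.2 (mul_nonpos_of_nonneg_of_nonpos hn.le h))
  · intro j hj; exact (hyz j).1 (Finset.mem_filter.1 hj).2
  · intro j hj; exact (hyz j).2 (hneg j (by simpa using hj))

end Cells

/-! ### Unbounded triangles outside the box -/

/-- The unbounded region cut off from the cone over `E` by the hull of `E`. -/
def outer (E : Set Plane) : Set Plane :=
  {y | ∃ t : ℝ, 1 ≤ t ∧ ∃ x ∈ convexHull ℝ E, y = t • x}

theorem outer_empty : outer ∅ = ∅ := by
  ext y; simp [outer]

theorem mem_outer_singleton {u y : Plane} : y ∈ outer {u} ↔ ∃ t : ℝ, 1 ≤ t ∧ y = t • u := by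
  simp [outer]

theorem mem_outer_pair {u v y : Plane} :
    y ∈ outer {u, v} ↔ ∃ a b : ℝ, 0 ≤ a ∧ 0 ≤ b ∧ 1 ≤ a + b ∧ y = a • u + b • v := by
  constructor
  · rintro ⟨t, ht, x, hx, rfl⟩
    rw [convexHull_pair] at hx
    obtain ⟨a, b, ha, hb, hab, rfl⟩ := hx
    have ht0 : 0 ≤ t := by linarith
    refine ⟨t * a, t * b, by positivity, by positivity, by rw [← mul_add, hab, mul_one]; exact ht,
      by module⟩
  · rintro ⟨a, b, ha, hb, hab, rfl⟩
    have hpos : 0 < a + b := by linarith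
    refine ⟨a + b, hab, (a / (a + b)) • u + (b / (a + b)) • v, ?_, ?_⟩
    · rw [convexHull_pair]
      exact ⟨_, _, by positivity, by positivity, by field_simp, rfl⟩
    · rw [smul_add, smul_smul, smul_smul, mul_div_cancel₀ _ hpos.ne', mul_div_cancel₀ _ hpos.ne']

section Dual

variable {u v : Plane}

/-- The affine function taking `s • u + t • v` to `a s + b t - c`. -/
noncomputable def dual (u v : Plane) (a b c : ℝ) : ℝ × ℝ × ℝ :=
  ((a * v 1 - b * u 1) / (u 0 * v 1 - u 1 * v 0), (b * u 0 - a * v 0) / (u 0 * v 1 - u 1 * v 0), c)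

theorem ev_dual (hD : u 0 * v 1 - u 1 * v 0 ≠ 0) (a b c s t : ℝ) :
    ev (dual u v a b c) (s • u + t • v) = a * s + b * t - c := by
  simp only [ev, dual, PiLp.add_apply, PiLp.smul_apply, smul_eq_mul]
  obtain ⟨D, hDe⟩ : ∃ D, D = u 0 * v 1 - u 1 * v 0 := ⟨_, rfl⟩
  rw [← hDe] at hD ⊢
  field_simp
  rw [hDe]; ring

theorem exists_coords (hD : u 0 * v 1 - u 1 * v 0 ≠ 0) (y : Plane) :
    ∃ s t : ℝ, y = s • u + t • v := by
  refine ⟨(y 0 * v 1 - y 1 * v 0) / (u 0 * v 1 - u 1 * v 0),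
    (u 0 * y 1 - u 1 * y 0) / (u 0 * v 1 - u 1 * v 0), ?_⟩
  obtain ⟨D, hDe⟩ : ∃ D, D = u 0 * v 1 - u 1 * v 0 := ⟨_, rfl⟩
  rw [← hDe] at hD ⊢
  apply plane_ext <;> simp only [PiLp.add_apply, PiLp.smul_apply, smul_eq_mul] <;> field_simp <;>
    rw [hDe] <;> ring

theorem coords_unique (hD : u 0 * v 1 - u 1 * v 0 ≠ 0) {s t s' t' : ℝ}
    (h : s • u + t • v = s' • u + t' • v) : s = s' ∧ t = t' := by
  have h1 := congrArg (ev (dual u v 1 0 0)) h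
  have h2 := congrArg (ev (dual u v 0 1 0)) h
  rw [ev_dual hD, ev_dual hD] at h1 h2
  exact ⟨by linarith, by linarith⟩

/-- In the coordinates s, t with respect to `u`, `v` the region is s ≥ 0, t ≥ 0, s + t ≥ 1. -/
theorem isTriangle_outer (hD : u 0 * v 1 - u 1 * v 0 ≠ 0) : IsTriangle (outer {u, v}) := by
  have : outer {u, v} = {y | ∀ i, 0 ≤ ev ((![dual u v 1 0 0, dual u v 0 1 0, dual u v 1 1 1] :
      Fin 3 → ℝ × ℝ × ℝ) i) y} := by
    ext y
    obtain ⟨s, t, rfl⟩ := exists_coords hD y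
    rw [mem_outer_pair]
    simp only [Set.mem_ofPred_eq, Fin.forall_fin_succ, Matrix.cons_val_zero, Matrix.cons_val_succ,
      ev_dual hD, IsEmpty.forall_iff, and_true]
    constructor
    · rintro ⟨a, b, ha, hb, hab, h⟩
      obtain ⟨rfl, rfl⟩ := coords_unique hD h
      exact ⟨by linarith, by linarith, by linarith⟩
    · rintro ⟨h1, h2, h3⟩
      exact ⟨s, t, by linarith, by linarith, by linarith, rfl⟩
  rw [this]
  have e0 : (0 : Plane) = (0 : ℝ) • u + (0 : ℝ) • v := by simp
  refine isTriangle_of_ev _ (fun i => ?_) ⟨(1 : ℝ) • u + (1 : ℝ) • v, fun i => ?_⟩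
  · refine nonConst_of_ev_ne (x := (1 : ℝ) • u + (1 : ℝ) • v) (y := (0 : ℝ) • u + (0 : ℝ) • v) ?_
    fin_cases i <;> simp only [Fin.zero_eta, Fin.mk_one, Fin.reduceFinMk, Matrix.cons_val,
      ev_dual hD] <;> norm_num
  · fin_cases i <;> simp only [Fin.zero_eta, Fin.mk_one, Fin.reduceFinMk, Matrix.cons_val,
      ev_dual hD] <;> norm_num

theorem isExposed_outer_of_dual (hD : u 0 * v 1 - u 1 * v 0 ≠ 0) {a b c : ℝ} {X : Set Plane}
    (h0 : ∀ s t : ℝ, 0 ≤ s → 0 ≤ t → 1 ≤ s + t → 0 ≤ a * s + b * t - c)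
    (hX : ∀ y, y ∈ X ↔ ∃ s t : ℝ, 0 ≤ s ∧ 0 ≤ t ∧ 1 ≤ s + t ∧ a * s + b * t - c = 0 ∧
      y = s • u + t • v) : IsExposed ℝ (outer {u, v}) X := by
  have hnn : ∀ y ∈ outer {u, v}, 0 ≤ ev (dual u v a b c) y := by
    intro y hy
    obtain ⟨s, t, hs, ht, hst, rfl⟩ := mem_outer_pair.1 hy
    rw [ev_dual hD]; exact h0 s t hs ht hst
  have : X = outer {u, v} ∩ {y | ev (dual u v a b c) y = 0} := by
    ext y
    rw [hX, Set.mem_inter_iff, mem_outer_pair]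
    constructor
    · rintro ⟨s, t, hs, ht, hst, h1, rfl⟩
      exact ⟨⟨s, t, hs, ht, hst, rfl⟩, by rw [Set.mem_ofPred_eq, ev_dual hD]; exact h1⟩
    · rintro ⟨⟨s, t, hs, ht, hst, rfl⟩, h1⟩
      rw [Set.mem_ofPred_eq, ev_dual hD] at h1
      exact ⟨s, t, hs, ht, hst, h1, rfl⟩
  rw [this]
  exact isExposed_zero hnn

/-- The supporting functions in these coordinates are s + 2t − 1 and 2s + t − 1 for the corners, t
and s for the two rays, and s + t − 1 for the bounded side. -/
theorem isExposed_outer (hD : u 0 * v 1 - u 1 * v 0 ≠ 0) {A : Set Plane} (hA : A ⊆ {u, v}) :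
    IsExposed ℝ (outer {u, v}) (convexHull ℝ A) ∧ IsExposed ℝ (outer {u, v}) (outer A) := by
  rcases Set.subset_pair_iff_eq.1 hA with rfl | rfl | rfl | rfl
  · rw [outer_empty, convexHull_empty]
    exact ⟨isExposed_empty, isExposed_empty⟩
  · refine ⟨isExposed_outer_of_dual hD (a := 1) (b := 2) (c := 1)
      (fun s t hs ht hst => by linarith) fun y => ?_,
      isExposed_outer_of_dual hD (a := 0) (b := 1) (c := 0)
      (fun s t hs ht hst => by linarith) fun y => ?_⟩
    · rw [convexHull_singleton, Set.mem_singleton_iff]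
      constructor
      · rintro rfl; exact ⟨1, 0, by norm_num, le_rfl, by norm_num, by norm_num, by simp⟩
      · rintro ⟨s, t, hs, ht, hst, h, rfl⟩
        obtain rfl : t = 0 := by linarith
        obtain rfl : s = 1 := by linarith
        simp
    · rw [mem_outer_singleton]
      constructor
      · rintro ⟨t, ht, rfl⟩
        exact ⟨t, 0, by linarith, le_rfl, by linarith, by norm_num, by simp⟩
      · rintro ⟨s, t, hs, ht, hst, h, rfl⟩
        obtain rfl : t = 0 := by linarith
        exact ⟨s, by linarith, by simp⟩
  · refine ⟨isExposed_outer_of_dual hD (a := 2) (b := 1) (c := 1)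
      (fun s t hs ht hst => by linarith) fun y => ?_,
      isExposed_outer_of_dual hD (a := 1) (b := 0) (c := 0)
      (fun s t hs ht hst => by linarith) fun y => ?_⟩
    · rw [convexHull_singleton, Set.mem_singleton_iff]
      constructor
      · rintro rfl; exact ⟨0, 1, le_rfl, by norm_num, by norm_num, by norm_num, by simp⟩
      · rintro ⟨s, t, hs, ht, hst, h, rfl⟩
        obtain rfl : s = 0 := by linarith
        obtain rfl : t = 1 := by linarith
        simp
    · rw [mem_outer_singleton]
      constructor
      · rintro ⟨t, ht, rfl⟩
        exact ⟨0, t, le_rfl, by linarith, by linarith, by norm_num, by simp⟩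
      · rintro ⟨s, t, hs, ht, hst, h, rfl⟩
        obtain rfl : s = 0 := by linarith
        exact ⟨t, by linarith, by simp⟩
  · refine ⟨isExposed_outer_of_dual hD (a := 1) (b := 1) (c := 1)
      (fun s t hs ht hst => by linarith) fun y => ?_, IsExposed.refl _⟩
    rw [convexHull_pair]
    constructor
    · rintro ⟨s, t, hs, ht, hst, rfl⟩
      exact ⟨s, t, hs, ht, hst.ge, by linarith, rfl⟩
    · rintro ⟨s, t, hs, ht, -, hst, rfl⟩
      exact ⟨s, t, hs, ht, by linarith, rfl⟩

end Dual

theorem range_fin_three (t : Fin 3 → Plane) : Set.range t = {t 0, t 1, t 2} := by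
  ext w
  constructor
  · rintro ⟨i, rfl⟩
    fin_cases i <;> simp
  · rintro (rfl | rfl | rfl)
    exacts [⟨0, rfl⟩, ⟨1, rfl⟩, ⟨2, rfl⟩]

theorem ev_smul_right (h : ℝ × ℝ × ℝ) (t : ℝ) (x : Plane) :
    ev h (t • x) = t * ev h x + (t - 1) * h.2.2 := by
  simp [ev]; ring

/-! ### Radial structure around a bounding box -/

/-- The lines `g b`, `b ∈ B`, all at the same affine height `M` from the origin, bound a convex
polygon with the origin in its interior. -/
structure IsBox {J : Type*} (g : J → ℝ × ℝ × ℝ) (B : Finset J) (M : ℝ) : Prop where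
  pos : 0 < M
  const : ∀ b ∈ B, (g b).2.2 = -M
  bounded : Bornology.IsBounded {x | ∀ b ∈ B, 0 ≤ ev (g b) x}
  side : ∀ b ∈ B, ∃ z z', z ≠ z' ∧ (∀ j ∈ B, 0 ≤ ev (g j) z) ∧ (∀ j ∈ B, 0 ≤ ev (g j) z') ∧
    ev (g b) z = 0 ∧ ev (g b) z' = 0

section Box

variable {J : Type*} {g : J → ℝ × ℝ × ℝ} {B S S' : Finset J} {M : ℝ}

/-- The equal constants make scaling act on all box functions by one formula; this is what makes
radial projection to the boundary work. -/
theorem IsBox.ev_smul (hB : IsBox g B M) {b : J} (hb : b ∈ B) (t : ℝ) (x : Plane) :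
    ev (g b) (t • x) = t * ev (g b) x - (t - 1) * M := by
  rw [ev_smul_right, hB.const b hb]; ring

theorem IsBox.scale_le (hB : IsBox g B M) {b : J} (hb : b ∈ B) {x x' : Plane}
    (hx : ev (g b) x = 0) (hx' : 0 ≤ ev (g b) x') {t t' : ℝ} (ht' : 0 ≤ t')
    (h : t • x = t' • x') : t ≤ t' := by
  have := congrArg (ev (g b)) h
  rw [hB.ev_smul hb, hB.ev_smul hb, hx] at this
  have h1 := mul_nonneg ht' hx'
  have h2 := hB.pos
  by_contra! hlt
  nlinarith

/-- Radial coordinates are unique: each of the two points lies on a box line that the other does not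
cross, so each factor bounds the other. -/
theorem IsBox.scale_unique (hB : IsBox g B M) {b b' : J} (hb : b ∈ B) (hb' : b' ∈ B)
    {x x' : Plane} (hx : ∀ j ∈ B, 0 ≤ ev (g j) x) (hx' : ∀ j ∈ B, 0 ≤ ev (g j) x')
    (hbx : ev (g b) x = 0) (hbx' : ev (g b') x' = 0) {t t' : ℝ} (ht : 1 ≤ t) (ht' : 1 ≤ t')
    (h : t • x = t' • x') : t = t' ∧ x = x' := by
  have e : t = t' := le_antisymm (hB.scale_le hb hbx (hx' b hb) (by linarith) h)
    (hB.scale_le hb' hbx' (hx b' hb') (by linarith) h.symm)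
  subst e
  exact ⟨rfl, smul_right_injective Plane (by linarith : t ≠ 0) h⟩

theorem IsBox.isBounded_cell (hB : IsBox g B M) (hS : B ⊆ S) : Bornology.IsBounded (cell g S) :=
  hB.bounded.subset fun _ hx b hb => hx.1 b (hS hb)

/-- A box line misses the origin, so two distinct points on it are linearly independent. -/
theorem IsBox.det_ne_zero (hB : IsBox g B M) {b : J} (hb : b ∈ B) {u v : Plane} (hne : u ≠ v)
    (hu : ev (g b) u = 0) (hv : ev (g b) v = 0) : u 0 * v 1 - u 1 * v 0 ≠ 0 := by
  intro h0
  have hc := hB.const b hb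
  have hM := hB.pos.ne'
  simp only [ev, hc] at hu hv
  refine hne (plane_ext (mul_left_cancel₀ hM ?_) (mul_left_cancel₀ hM ?_))
  · linear_combination u 0 * hv - v 0 * hu - (g b).2.1 * h0
  · linear_combination u 1 * hv - v 1 * hu + (g b).1 * h0

variable [Fintype J]

open Classical in
/-- The vertices of the cell `S` on the line `b`. -/
noncomputable def edge (hg : ∀ j, NonConst (g j)) (S : Finset J) (b : J) : Finset Plane :=
  (vertices hg S).filter (fun v => ev (g b) v = 0)

theorem mem_edge (hg : ∀ j, NonConst (g j)) {b : J} {v : Plane} :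
    v ∈ edge hg S b ↔ v ∈ vertices hg S ∧ ev (g b) v = 0 := by
  classical
  exact Finset.mem_filter

theorem vertices_subset_cell (hg : ∀ j, NonConst (g j)) :
    (vertices hg S : Set Plane) ⊆ cell g S := by
  rw [coe_vertices]; exact extremePoints_subset

theorem convexHull_subset_cell (hg : ∀ j, NonConst (g j)) {W : Set Plane}
    (hW : W ⊆ vertices hg S) : convexHull ℝ W ⊆ cell g S :=
  convexHull_min (hW.trans (vertices_subset_cell hg)) convex_cell

theorem convexHull_edge_subset (hg : ∀ j, NonConst (g j)) {b : J} {x : Plane}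
    (hx : x ∈ convexHull ℝ (edge hg S b : Set Plane)) : x ∈ cell g S ∧ ev (g b) x = 0 :=
  ⟨convexHull_subset_cell hg (fun _ hv => ((mem_edge hg).1 hv).1) hx,
    le_antisymm (ev_nonpos_of_mem_convexHull (fun _ hv => ((mem_edge hg).1 hv).2.le) hx)
      (ev_nonneg_of_mem_convexHull (fun _ hv => ((mem_edge hg).1 hv).2.ge) hx)⟩

/-- Within one cell the line `g b` itself separates the hull from the edge; distinct cells are
separated already. -/
theorem convexHull_inter_edge (hg : ∀ j, NonConst (g j)) {b : J} (hb : b ∈ S) {W : Set Plane}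
    (hW : W ⊆ vertices hg S) :
    convexHull ℝ W ∩ convexHull ℝ (edge hg S' b : Set Plane) ⊆
      convexHull ℝ (W ∩ edge hg S' b) := by
  classical
  by_cases hne : S = S'
  · subst hne
    obtain ⟨p, q, hpq⟩ := subset_pair_of_card_le_two _
      (card_extreme_on_line_le (vertices hg S) (fun v hv => (mem_vertices hg).1 hv) (hg b))
    refine convexHull_inter_subset_of_separated (h := g b) (p := p) (q := q)
      (fun w hw => (vertices_subset_cell hg (hW hw)).1 b hb)
      (fun w hw => ((mem_edge hg).1 hw).2.le) (fun w hw h0 => hpq w ?_) (fun w hw h0 => hpq w ?_)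
    · exact Finset.mem_filter.2 ⟨hW hw, h0⟩
    · exact Finset.mem_filter.2 ⟨((mem_edge hg).1 hw).1, h0⟩
  · exact convexHull_inter_subset_of_cells hg hne hW fun _ hv => ((mem_edge hg).1 hv).1

/-- By uniqueness of radial coordinates a common point projects to a common point of the two edges.
-/
theorem IsBox.outer_inter_outer (hB : IsBox g B M) (hg : ∀ j, NonConst (g j)) (hS : B ⊆ S)
    (hS' : B ⊆ S') {b b' : J} (hb : b ∈ B) (hb' : b' ∈ B) :
    outer (edge hg S b : Set Plane) ∩ outer (edge hg S' b' : Set Plane) =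
      outer ((edge hg S b : Set Plane) ∩ edge hg S' b') := by
  refine Set.Subset.antisymm ?_ ?_
  · rintro _ ⟨⟨t, ht, x, hx, rfl⟩, ⟨t', ht', x', hx', h⟩⟩
    have h1 := convexHull_edge_subset hg hx
    have h2 := convexHull_edge_subset hg hx'
    obtain ⟨rfl, rfl⟩ := hB.scale_unique hb hb' (fun j hj => h1.1.1 j (hS hj))
      (fun j hj => h2.1.1 j (hS' hj)) h1.2 h2.2 ht ht' h
    exact ⟨t, ht, x, convexHull_inter_edge hg (hS hb') (fun _ hv => ((mem_edge hg).1 hv).1)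
      ⟨hx, hx'⟩, rfl⟩
  · rintro _ ⟨t, ht, x, hx, rfl⟩
    exact ⟨⟨t, ht, x, convexHull_mono Set.inter_subset_left hx, rfl⟩,
      ⟨t, ht, x, convexHull_mono Set.inter_subset_right hx, rfl⟩⟩

/-- A point of an outer region that also satisfies the box inequality of its side has scaling factor
1, so it lies on the edge. -/
theorem IsBox.convexHull_inter_outer (hB : IsBox g B M) (hg : ∀ j, NonConst (g j)) (hS : B ⊆ S)
    {b : J} (hb : b ∈ B) {W : Set Plane} (hW : W ⊆ vertices hg S) :
    convexHull ℝ W ∩ outer (edge hg S' b : Set Plane) =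
      convexHull ℝ (W ∩ edge hg S' b) := by
  refine Set.Subset.antisymm ?_ fun x hx => ⟨convexHull_mono Set.inter_subset_left hx,
    1, le_rfl, x, convexHull_mono Set.inter_subset_right hx, (one_smul _ _).symm⟩
  rintro _ ⟨hy, t, ht, x, hx, rfl⟩
  have h1 := convexHull_edge_subset hg hx
  have h2 : 0 ≤ ev (g b) (t • x) := (convexHull_subset_cell hg hW hy).1 b (hS hb)
  have h3 : t ≤ 1 := hB.scale_le hb h1.2 h2 zero_le_one (one_smul ℝ (t • x)).symm
  obtain rfl : t = 1 := le_antisymm h3 ht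
  rw [one_smul] at hy ⊢
  exact convexHull_inter_edge hg (hS hb) hW ⟨hy, hx⟩

theorem IsBox.exists_pair (hB : IsBox g B M) (hg : ∀ j, NonConst (g j)) {b : J} (hb : b ∈ B)
    (hcard : (edge hg S b).card = 2) :
    ∃ u v, (edge hg S b : Set Plane) = {u, v} ∧ u 0 * v 1 - u 1 * v 0 ≠ 0 := by
  obtain ⟨u, v, hne, huv⟩ := Finset.card_eq_two.1 hcard
  refine ⟨u, v, by rw [huv]; simp, hB.det_ne_zero hb hne ?_ ?_⟩
  · exact ((mem_edge hg (S := S)).1 (by rw [huv]; simp)).2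
  · exact ((mem_edge hg (S := S)).1 (by rw [huv]; simp)).2

/-- Every point outside the box lies in the unbounded region over an edge of a cell. -/
theorem IsBox.exists_outer (hB : IsBox g B M) (hg : ∀ j, NonConst (g j)) {x : Plane}
    (hx : ∃ b ∈ B, ev (g b) x < 0) :
    ∃ S, B ⊆ S ∧ (∃ y, InteriorPt g S y) ∧ ∃ b ∈ B, (edge hg S b).card = 2 ∧
      x ∈ outer (edge hg S b : Set Plane) := by
  classical
  obtain ⟨b₁, hb₁, hx₁⟩ := hx
  -- The most violated side is the one through which the segment from the origin to `x` leaves the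
  -- box; `y` is the exit point.
  obtain ⟨b, hb, hmin⟩ := B.exists_min_image (fun b => ev (g b) x) ⟨b₁, hb₁⟩
  have hbx : ev (g b) x < 0 := (hmin b₁ hb₁).trans_lt hx₁
  have hM := hB.pos
  set μ := M - ev (g b) x with hμ
  have hμpos : 0 < μ := by linarith
  set y := (M / μ) • x with hy
  have hyb : ∀ j ∈ B, ev (g j) y = M / μ * (ev (g j) x - ev (g b) x) := by
    intro j hj
    rw [hy, hB.ev_smul hj, hμ]
    have : M - ev (g b) x ≠ 0 := by linarith
    field_simp; ring
  have hybox : ∀ j ∈ B, 0 ≤ ev (g j) y := by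
    intro j hj
    rw [hyb j hj]
    have := hmin j hj
    exact mul_nonneg (by positivity) (by linarith)
  have hy0 : ev (g b) y = 0 := by rw [hyb b hb]; ring
  have hxy : x = (μ / M) • y := by
    rw [hy, smul_smul, div_mul_div_cancel₀ hM.ne', div_self hμpos.ne', one_smul]
  -- A second point of the same side gives a direction in which to move `y` along it. A cell
  -- containing both `y` and the moved point meets the line `b` in a segment, hence in two vertices.
  obtain ⟨z, hzy, hzbox, hz0⟩ : ∃ z, z ≠ y ∧ (∀ j ∈ B, 0 ≤ ev (g j) z) ∧ ev (g b) z = 0 := by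
    obtain ⟨z, z', hne, h1, h2, h3, h4⟩ := hB.side b hb
    by_cases h : z = y
    · exact ⟨z', fun h' => hne (h.trans h'.symm), h2, h4⟩
    · exact ⟨z, h, h1, h3⟩
  have h1 : ∀ j, ∀ᶠ δ : ℝ in nhdsWithin 0 (Set.Ioi 0),
      ev (g j) y ≠ 0 → 0 < ev (g j) y * ev (g j) ((1 - δ) • y + δ • z) := by
    intro j
    by_cases hj : ev (g j) y = 0
    · exact Filter.Eventually.of_forall fun δ h => absurd hj h
    · have hc : Continuous fun δ : ℝ => ev (g j) y * ev (g j) ((1 - δ) • y + δ • z) :=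
        continuous_const.mul ((continuous_ev _).comp (by fun_prop))
      have h0 : 0 < ev (g j) y * ev (g j) ((1 - (0 : ℝ)) • y + (0 : ℝ) • z) := by
        simpa using mul_self_pos.2 hj
      filter_upwards [((hc.tendsto 0).mono_left nhdsWithin_le_nhds).eventually_const_lt h0]
        with δ hδ _ using hδ
  obtain ⟨δ, hδ, hδ0, hδ1⟩ := ((Filter.eventually_all.2 h1).and (Filter.Eventually.and
    self_mem_nhdsWithin (mem_nhdsWithin_of_mem_nhds (gt_mem_nhds one_pos)))).exists
  have hδ0 : 0 < δ := hδ0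
  have hδ1 : δ < 1 := hδ1
  obtain ⟨o, ho, hoB⟩ := exists_generic_point hg (B := B) (fun j hj => by
    simp [ev, hB.const j hj, hM])
  obtain ⟨S, hS, hint, hyS, hzS⟩ := exists_cell_of_pair ho hoB (x := y)
    (y := (1 - δ) • y + δ • z) (fun j hj => by
      rw [ev_combo _ _ _ (by ring)]
      have := mul_nonneg (by linarith : 0 ≤ 1 - δ) (hybox j hj)
      have := mul_nonneg hδ0.le (hzbox j hj)
      linarith) hδ
  have hface : ∀ w ∈ cell g S, ev (g b) w = 0 → w ∈ convexHull ℝ (edge hg S b : Set Plane) := by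
    intro w hw hw0
    rw [← convexHull_vertices hg (hB.isBounded_cell hS)] at hw
    refine convexHull_mono ?_ (mem_convexHull_zero (h := g b)
      (fun v hv => (vertices_subset_cell hg hv).1 b (hS hb)) hw hw0)
    rintro v ⟨hv, hv0⟩
    exact (mem_edge hg).2 ⟨hv, hv0⟩
  have hye := hface y hyS hy0
  have hze := hface _ hzS (by rw [ev_combo _ _ _ (by ring), hy0, hz0]; ring)
  refine ⟨S, hS, hint, b, hb, ?_, μ / M, ?_, y, hye, hxy⟩
  · refine le_antisymm
      (card_extreme_on_line_le (vertices hg S) (fun v hv => (mem_vertices hg).1 hv) (hg b)) ?_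
    by_contra! hlt
    have hle : (edge hg S b).card ≤ 1 := by omega
    have hsub : (convexHull ℝ (edge hg S b : Set Plane)).Subsingleton := by
      have := Finset.card_le_one.1 hle
      rcases (edge hg S b).eq_empty_or_nonempty with he | ⟨p, hp⟩
      · rw [he]; simp
      · have : (edge hg S b : Set Plane) ⊆ {p} := fun q hq => this q hq p hp
        refine Set.Subsingleton.anti ?_ (convexHull_mono this)
        rw [convexHull_singleton]; exact Set.subsingleton_singleton
    have h := hsub hye hze
    have h2 : δ • (z - y) = 0 := by
      have : (1 - δ) • y + δ • z = y + δ • (z - y) := by module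
      rw [this] at h
      simpa using h
    rcases smul_eq_zero.1 h2 with h3 | h3
    · exact hδ0.ne' h3
    · exact hzy (sub_eq_zero.1 h3)
  · rw [one_le_div hM]; linarith

/-- Double counting of incidences between cells and lines touching them. -/
theorem sum_card_vertices_le [DecidableEq J] (hg : ∀ j, NonConst (g j)) (𝒞 : Finset (Finset J))
    (h𝒞 : ∀ S ∈ 𝒞, ∃ y, InteriorPt g S y) :
    ∑ S ∈ 𝒞, (vertices hg S).card ≤ 6 * (Fintype.card J * (1 + Fintype.card J)) := by
  classical
  calc ∑ S ∈ 𝒞, (vertices hg S).card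
      ≤ ∑ S ∈ 𝒞, 2 * (Finset.univ.filter
          (fun j => (cell g S ∩ {x | ev (g j) x = 0}).Nonempty)).card :=
        Finset.sum_le_sum fun S _ => card_vertices_le hg
    _ = 2 * ∑ j, (𝒞.filter (fun S => (cell g S ∩ {x | ev (g j) x = 0}).Nonempty)).card := by
        rw [← Finset.mul_sum]
        simp only [Finset.card_filter]
        rw [Finset.sum_comm]
    _ ≤ 2 * ∑ _j : J, 3 * (1 + Fintype.card J) := by
        gcongr with j _
        exact card_cells_meeting_line_le 𝒞 h𝒞 (hg j)
    _ = 6 * (Fintype.card J * (1 + Fintype.card J)) := by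
        rw [Finset.sum_const, Finset.card_univ, smul_eq_mul]; ring

end Box

/-! ### Assembling the triangulation of the plane -/

/-- The plane has a triangulation refining the arrangement `g` inside the box `B`, with few
triangles and such that every line meets few of them. -/
theorem exists_arrangement_triangulation {J : Type*} [Fintype J] {g : J → ℝ × ℝ × ℝ}
    {B : Finset J} {M : ℝ} (hB : IsBox g B M) (hg : ∀ j, NonConst (g j)) {D : ℕ}
    (hD : 2 * Fintype.card J ≤ 2 ^ D) :
    ∃ 𝒯 : Finset (Set Plane), IsPlaneTriangulation 𝒯 ∧
      𝒯.card ≤ 6 * (Fintype.card J * (1 + Fintype.card J)) + B.card * (3 * (1 + Fintype.card J)) ∧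
      (∀ T ∈ 𝒯, (∀ x ∈ T, ∃ b ∈ B, ev (g b) x ≤ 0) ∨
        ∃ t : Fin 3 → Plane, T = convexHull ℝ (Set.range t) ∧
          (∀ i, ∃ j j', t i = meet (g j) (g j')) ∧
          ∀ j i i', 0 ≤ ev (g j) (t i) * ev (g j) (t i')) ∧
      ∀ h, NonConst h → {T | T ∈ 𝒯 ∧ (T ∩ {x | ev h x = 0}).Nonempty}.ncard ≤
        3 * (1 + Fintype.card J) * (6 * D) + B.card * (3 * (1 + Fintype.card J)) := by
  classical
  let 𝒞 : Finset (Finset J) := Finset.univ.filter (fun S => B ⊆ S ∧ ∃ y, InteriorPt g S y)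
  have h𝒞 : ∀ S ∈ 𝒞, B ⊆ S ∧ ∃ y, InteriorPt g S y := fun S hS => (Finset.mem_filter.1 hS).2
  have hvD : ∀ S, (vertices hg S).card ≤ 2 ^ D := fun S =>
    (card_vertices_le hg).trans (le_trans (Nat.mul_le_mul_left _ (Finset.card_le_univ _)) hD)
  have hex : ∀ S, ∃ 𝒯 : Finset (Fin 3 → Plane), S ∈ 𝒞 →
      (∀ t ∈ 𝒯, Set.range t ⊆ vertices hg S ∧ 0 < ev (side (t 0) (t 1)) (t 2)) ∧
      (∀ x ∈ cell g S, ∃ t ∈ 𝒯, x ∈ convexHull ℝ (Set.range t)) ∧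
      (∀ t ∈ 𝒯, ∀ t' ∈ 𝒯, t ≠ t' → convexHull ℝ (Set.range t) ∩ convexHull ℝ (Set.range t') ⊆
        convexHull ℝ (Set.range t ∩ Set.range t')) ∧
      𝒯.card ≤ (vertices hg S).card ∧
      ∀ h, NonConst h →
        {t | t ∈ 𝒯 ∧ ∃ x ∈ convexHull ℝ (Set.range t), ev h x = 0}.ncard ≤ 6 * D := by
    intro S
    by_cases hS : S ∈ 𝒞
    · obtain ⟨hBS, y, hy⟩ := h𝒞 S hS
      obtain ⟨𝒯, h⟩ := exists_cell_triangulation hg (hB.isBounded_cell hBS) hy (hvD S)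
      exact ⟨𝒯, fun _ => h⟩
    · exact ⟨∅, fun h => absurd h hS⟩
  choose 𝒲 h𝒲 using hex
  let hull : (Fin 3 → Plane) → Set Plane := fun t => convexHull ℝ (Set.range t)
  let ℐ : Finset (Set Plane) := 𝒞.biUnion fun S => (𝒲 S).image hull
  -- A cell may touch a box line in a single vertex only; such degenerate edges span no unbounded
  -- triangle.
  let 𝒟 : Finset (Finset J × J) := (𝒞 ×ˢ B).filter (fun p => (edge hg p.1 p.2).card = 2)
  let 𝒪 : Finset (Set Plane) := 𝒟.image fun p => outer (edge hg p.1 p.2 : Set Plane)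
  have hℐ : ∀ T, T ∈ ℐ ↔ ∃ S ∈ 𝒞, ∃ t ∈ 𝒲 S, hull t = T := fun T => by
    simp [ℐ]
  have h𝒪 : ∀ T, T ∈ 𝒪 ↔ ∃ S ∈ 𝒞, ∃ b ∈ B, (edge hg S b).card = 2 ∧
      outer (edge hg S b : Set Plane) = T := fun T => by
    simp only [𝒪, 𝒟, Finset.mem_image, Finset.mem_filter, Finset.mem_product, Prod.exists]
    constructor
    · rintro ⟨S, b, ⟨⟨h1, h2⟩, h3⟩, h4⟩; exact ⟨S, h1, b, h2, h3, h4⟩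
    · rintro ⟨S, h1, b, h2, h3, h4⟩; exact ⟨S, b, ⟨⟨h1, h2⟩, h3⟩, h4⟩
  have hface : ∀ S ∈ 𝒞, ∀ t ∈ 𝒲 S, ∀ A ⊆ Set.range t,
      IsExposed ℝ (hull t) (convexHull ℝ A) := by
    intro S hS t ht A hA
    have h1 := ((h𝒲 S hS).1 t ht).2
    simp only [hull]
    rw [range_fin_three] at hA ⊢
    exact isExposed_convexHull_of_subset_triple h1 hA
  have hinner : ∀ S ∈ 𝒞, ∀ t ∈ 𝒲 S, ∀ S' ∈ 𝒞, ∀ t' ∈ 𝒲 S', hull t ≠ hull t' →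
      IsExposed ℝ (hull t) (hull t ∩ hull t') := by
    intro S hS t ht S' hS' t' ht' hne
    have : hull t ∩ hull t' = convexHull ℝ (Set.range t ∩ Set.range t') := by
      refine Set.Subset.antisymm ?_ fun x hx => ⟨convexHull_mono Set.inter_subset_left hx,
        convexHull_mono Set.inter_subset_right hx⟩
      by_cases hSS : S = S'
      · subst hSS
        exact (h𝒲 S hS).2.2.1 t ht t' ht' fun h => hne (by rw [h])
      · exact convexHull_inter_subset_of_cells hg hSS ((h𝒲 S hS).1 t ht).1
          ((h𝒲 S' hS').1 t' ht').1
    rw [this]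
    exact hface S hS t ht _ Set.inter_subset_left
  have hmixed : ∀ S ∈ 𝒞, ∀ t ∈ 𝒲 S, ∀ S' ∈ 𝒞, ∀ b ∈ B, (edge hg S' b).card = 2 →
      IsExposed ℝ (hull t) (hull t ∩ outer (edge hg S' b : Set Plane)) ∧
      IsExposed ℝ (outer (edge hg S' b : Set Plane))
        (hull t ∩ outer (edge hg S' b : Set Plane)) := by
    intro S hS t ht S' hS' b hb hc
    rw [hB.convexHull_inter_outer hg (h𝒞 S hS).1 hb ((h𝒲 S hS).1 t ht).1]
    refine ⟨hface S hS t ht _ Set.inter_subset_left, ?_⟩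
    obtain ⟨u, v, huv, hdet⟩ := hB.exists_pair hg hb hc
    rw [huv]
    exact (isExposed_outer hdet Set.inter_subset_right).1
  have houter : ∀ S ∈ 𝒞, ∀ b ∈ B, (edge hg S b).card = 2 → ∀ S' ∈ 𝒞, ∀ b' ∈ B,
      IsExposed ℝ (outer (edge hg S b : Set Plane))
        (outer (edge hg S b : Set Plane) ∩ outer (edge hg S' b' : Set Plane)) := by
    intro S hS b hb hc S' hS' b' hb'
    rw [hB.outer_inter_outer hg (h𝒞 S hS).1 (h𝒞 S' hS').1 hb hb']
    obtain ⟨u, v, huv, hdet⟩ := hB.exists_pair hg hb hc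
    rw [huv]
    exact (isExposed_outer hdet Set.inter_subset_left).2
  have hOcard : 𝒪.card ≤ B.card * (3 * (1 + Fintype.card J)) := by
    refine Finset.card_image_le.trans ?_
    have hsub : 𝒟 ⊆ B.biUnion fun b => (𝒞.filter
        (fun S => (cell g S ∩ {x | ev (g b) x = 0}).Nonempty)).image fun S => (S, b) := by
      rintro ⟨S, b⟩ hp
      obtain ⟨h1, h2⟩ := Finset.mem_filter.1 hp
      obtain ⟨h1, h3⟩ := Finset.mem_product.1 h1
      obtain ⟨v, hv⟩ : (edge hg S b).Nonempty := Finset.card_pos.1 (by simp only at h2; omega)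
      refine Finset.mem_biUnion.2 ⟨b, h3, Finset.mem_image.2 ⟨S, Finset.mem_filter.2 ⟨h1, v, ?_⟩,
        rfl⟩⟩
      exact ⟨vertices_subset_cell hg ((mem_edge hg).1 hv).1, ((mem_edge hg).1 hv).2⟩
    refine (Finset.card_le_card hsub).trans (Finset.card_biUnion_le.trans ?_)
    refine Finset.sum_le_card_nsmul _ _ _ fun b _ => Finset.card_image_le.trans ?_
    exact card_cells_meeting_line_le 𝒞 (fun S hS => (h𝒞 S hS).2) (hg b)
  refine ⟨ℐ ∪ 𝒪, ⟨?_, ?_, ?_⟩, ?_, ?_, ?_⟩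
  · intro T hT
    rcases Finset.mem_union.1 hT with hT | hT
    · obtain ⟨S, hS, t, ht, rfl⟩ := (hℐ T).1 hT
      simp only [hull]
      rw [range_fin_three]
      exact isTriangle_convexHull ((h𝒲 S hS).1 t ht).2
    · obtain ⟨S, hS, b, hb, hc, rfl⟩ := (h𝒪 T).1 hT
      obtain ⟨u, v, huv, hdet⟩ := hB.exists_pair hg hb hc
      rw [huv]
      exact isTriangle_outer hdet
  · intro x
    by_cases hx : ∃ b ∈ B, ev (g b) x < 0
    · obtain ⟨S, hS, hint, b, hb, hc, hxo⟩ := hB.exists_outer hg hx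
      exact ⟨_, Finset.mem_union_right _ ((h𝒪 _).2 ⟨S, Finset.mem_filter.2
        ⟨Finset.mem_univ _, hS, hint⟩, b, hb, hc, rfl⟩), hxo⟩
    · push Not at hx
      obtain ⟨o, ho, hoB⟩ := exists_generic_point hg (B := B) (fun j hj => by
        simp [ev, hB.const j hj, hB.pos])
      obtain ⟨S, hS, hint, hxS, -⟩ := exists_cell_of_pair ho hoB (x := x) hx
        fun j hj => mul_self_pos.2 hj
      have hSC : S ∈ 𝒞 := Finset.mem_filter.2 ⟨Finset.mem_univ _, hS, hint⟩
      obtain ⟨t, ht, hxt⟩ := (h𝒲 S hSC).2.1 x hxS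
      exact ⟨_, Finset.mem_union_left _ ((hℐ _).2 ⟨S, hSC, t, ht, rfl⟩), hxt⟩
  · intro T hT T' hT' hne
    rcases Finset.mem_union.1 hT with hT | hT <;> rcases Finset.mem_union.1 hT' with hT' | hT'
    · obtain ⟨S, hS, t, ht, rfl⟩ := (hℐ T).1 hT
      obtain ⟨S', hS', t', ht', rfl⟩ := (hℐ T').1 hT'
      refine ⟨hinner S hS t ht S' hS' t' ht' hne, ?_⟩
      rw [Set.inter_comm]
      exact hinner S' hS' t' ht' S hS t ht hne.symm
    · obtain ⟨S, hS, t, ht, rfl⟩ := (hℐ T).1 hT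
      obtain ⟨S', hS', b, hb, hc, rfl⟩ := (h𝒪 T').1 hT'
      exact hmixed S hS t ht S' hS' b hb hc
    · obtain ⟨S, hS, t, ht, rfl⟩ := (hℐ T').1 hT'
      obtain ⟨S', hS', b, hb, hc, rfl⟩ := (h𝒪 T).1 hT
      rw [Set.inter_comm]
      exact (hmixed S hS t ht S' hS' b hb hc).symm
    · obtain ⟨S, hS, b, hb, hc, rfl⟩ := (h𝒪 T).1 hT
      obtain ⟨S', hS', b', hb', hc', rfl⟩ := (h𝒪 T').1 hT'
      refine ⟨houter S hS b hb hc S' hS' b' hb', ?_⟩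
      rw [Set.inter_comm]
      exact houter S' hS' b' hb' hc' S hS b hb
  · refine (Finset.card_union_le _ _).trans (Nat.add_le_add ?_ hOcard)
    refine Finset.card_biUnion_le.trans (le_trans (Finset.sum_le_sum fun S hS => ?_)
      (sum_card_vertices_le hg 𝒞 fun S hS => (h𝒞 S hS).2))
    exact Finset.card_image_le.trans (h𝒲 S hS).2.2.2.1
  · intro T hT
    rcases Finset.mem_union.1 hT with hT | hT
    · obtain ⟨S, hS, t, ht, rfl⟩ := (hℐ T).1 hT
      have hv : ∀ i, t i ∈ vertices hg S := fun i => ((h𝒲 S hS).1 t ht).1 ⟨i, rfl⟩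
      refine Or.inr ⟨t, rfl, fun i => ?_, fun j i i' => ?_⟩
      · obtain ⟨j, j', hc, h1, h2⟩ :=
          exists_cross_ne_of_mem_extremePoints hg ((mem_vertices hg).1 (hv i))
        exact ⟨j, j', eq_meet hc h1 h2⟩
      · have h1 := vertices_subset_cell hg (hv i)
        have h2 := vertices_subset_cell hg (hv i')
        by_cases hj : j ∈ S
        · exact mul_nonneg (h1.1 j hj) (h2.1 j hj)
        · exact mul_nonneg_of_nonpos_of_nonpos (h1.2 j hj) (h2.2 j hj)
    · obtain ⟨S, hS, b, hb, hc, rfl⟩ := (h𝒪 T).1 hT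
      refine Or.inl ?_
      rintro _ ⟨t, ht, x, hx, rfl⟩
      refine ⟨b, hb, ?_⟩
      rw [hB.ev_smul hb, (convexHull_edge_subset hg hx).2]
      have := mul_nonneg (sub_nonneg.2 ht) hB.pos.le
      linarith
  · intro h hh
    let 𝒵 := 𝒞.filter (fun S => (cell g S ∩ {x | ev h x = 0}).Nonempty)
    let F : Finset J → Finset (Set Plane) := fun S =>
      ((𝒲 S).filter (fun t => ∃ x ∈ convexHull ℝ (Set.range t), ev h x = 0)).image hull
    have hsub : {T | T ∈ ℐ ∪ 𝒪 ∧ (T ∩ {x | ev h x = 0}).Nonempty} ⊆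
        ((𝒵.biUnion F ∪ 𝒪 : Finset (Set Plane)) : Set (Set Plane)) := by
      rintro T ⟨hT, x, hx, hx0⟩
      rw [Finset.coe_union]
      rcases Finset.mem_union.1 hT with hT | hT
      · left
        obtain ⟨S, hS, t, ht, rfl⟩ := (hℐ T).1 hT
        refine Finset.mem_coe.2 (Finset.mem_biUnion.2 ⟨S, Finset.mem_filter.2 ⟨hS, x, ?_, hx0⟩,
          Finset.mem_image_of_mem _ (Finset.mem_filter.2 ⟨ht, x, hx, hx0⟩)⟩)
        exact convexHull_subset_cell hg ((h𝒲 S hS).1 t ht).1 hx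
      · exact Or.inr hT
    refine (Set.ncard_le_ncard hsub (Finset.finite_toSet _)).trans ?_
    rw [Set.ncard_coe_finset]
    refine (Finset.card_union_le _ _).trans (Nat.add_le_add ?_ hOcard)
    refine Finset.card_biUnion_le.trans ((Finset.sum_le_card_nsmul _ _ (6 * D) fun S hS =>
      ?_).trans ?_)
    · refine Finset.card_image_le.trans ?_
      have := (h𝒲 S (Finset.mem_filter.1 hS).1).2.2.2.2 h hh
      rw [← Set.ncard_coe_finset]
      simpa using this
    · rw [smul_eq_mul]
      exact Nat.mul_le_mul_right _ (card_cells_meeting_line_le 𝒞 (fun S hS => (h𝒞 S hS).2) hh)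

/-! ### Random sampling -/

/-- Random sampling: if configurations are defined by four elements, some sample of size `s` meets
the conflict set of each configuration it defines whose conflict set has at least `k` elements. -/
theorem exists_sample {Λ β : Type*} [Fintype Λ] [Fintype β] {s k : ℕ} (hs : 4 ≤ s)
    (H : (Fin 4 → Λ ⊕ β) → Finset Λ)
    (hlt : (s + Fintype.card β) ^ 4 * ((Fintype.card Λ - k) ^ (s - 4) * Fintype.card Λ ^ 4) <
      Fintype.card Λ ^ s) :
    ∃ f : Fin s → Λ, ∀ e : Fin 4 → Fin s ⊕ β, (∀ t, f t ∉ H (Sum.map f id ∘ e)) →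
      (H (Sum.map f id ∘ e)).card < k := by
  classical
  by_contra! hcon
  let bad : (Fin 4 → Fin s ⊕ β) → Finset (Fin s → Λ) := fun e => Finset.univ.filter fun f =>
    (∀ t, f t ∉ H (Sum.map f id ∘ e)) ∧ k ≤ (H (Sum.map f id ∘ e)).card
  have hbad : ∀ e, (bad e).card ≤ (Fintype.card Λ - k) ^ (s - 4) * Fintype.card Λ ^ 4 := by
    intro e
    let D₀ : Finset (Fin s) := Finset.univ.biUnion fun i =>
      Sum.elim (fun t => {t}) (fun _ => ∅) (e i)
    have hD₀ : D₀.card ≤ 4 := by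
      refine Finset.card_biUnion_le.trans ((Finset.sum_le_card_nsmul _ _ 1 fun i _ => ?_).trans
        (by simp))
      cases e i <;> simp
    -- The defining positions may coincide or be fixed elements of `β`; padding them to exactly four
    -- makes the exponent uniform.
    obtain ⟨D, hDsub, hD⟩ := Finset.exists_superset_card_eq hD₀ (by simpa using hs)
    have hDe : ∀ i t, e i = Sum.inl t → t ∈ D := fun i t h =>
      hDsub (Finset.mem_biUnion.2 ⟨i, Finset.mem_univ _, by rw [h]; simp⟩)
    -- Fixing the draws on `D` fixes the configuration and its conflict set. Each remaining draw
    -- must then avoid at least `k` elements, which bounds the fibres of `ρ`.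
    let ρ : (Fin s → Λ) → (D → Λ) := fun f t => f t
    refine (Finset.card_le_mul_card_image (f := ρ) (bad e)
      ((Fintype.card Λ - k) ^ (s - 4)) ?_).trans (Nat.mul_le_mul_left _ ?_)
    · intro a ha
      obtain ⟨f₀, hf₀, rfl⟩ := Finset.mem_image.1 ha
      obtain ⟨-, -, hk⟩ := Finset.mem_filter.1 hf₀
      have hsub : (bad e).filter (fun f => ρ f = ρ f₀) ⊆ Fintype.piFinset fun t =>
          if t ∈ D then {f₀ t} else (H (Sum.map f₀ id ∘ e))ᶜ := by
        intro f hf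
        obtain ⟨hf, hρ⟩ := Finset.mem_filter.1 hf
        obtain ⟨-, hf, -⟩ := Finset.mem_filter.1 hf
        have hag : ∀ t ∈ D, f t = f₀ t := fun t ht => congrFun hρ ⟨t, ht⟩
        have he : Sum.map f id ∘ e = Sum.map f₀ id ∘ e := by
          funext i
          simp only [Function.comp_apply]
          cases hi : e i with
          | inl t => simp [hag t (hDe i t hi)]
          | inr b => simp
        rw [he] at hf
        refine Fintype.mem_piFinset.2 fun t => ?_
        split_ifs with ht
        · simp [hag t ht]
        · simpa using hf t
      refine (Finset.card_le_card hsub).trans ?_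
      rw [Fintype.card_piFinset, ← Finset.prod_mul_prod_compl D,
        Finset.prod_congr rfl (g := fun _ => 1) (fun t ht => by simp [ht]), Finset.prod_const_one,
        one_mul, Finset.prod_congr rfl (g := fun _ => (H (Sum.map f₀ id ∘ e))ᶜ.card)
          (fun t ht => by rw [if_neg (Finset.mem_compl.1 ht)]), Finset.prod_const,
        Finset.card_compl, Finset.card_compl, hD, Fintype.card_fin]
      exact Nat.pow_le_pow_left (Nat.sub_le_sub_left hk _) _
    · refine (Finset.card_le_univ _).trans ?_
      simp [hD]
  have hcover : (Finset.univ : Finset (Fin s → Λ)) ⊆ Finset.univ.biUnion bad := by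
    intro f _
    obtain ⟨e, h1, h2⟩ := hcon f
    exact Finset.mem_biUnion.2 ⟨e, Finset.mem_univ _, Finset.mem_filter.2
      ⟨Finset.mem_univ _, h1, h2⟩⟩
  have h1 := (Finset.card_le_card hcover).trans
    (Finset.card_biUnion_le.trans (Finset.sum_le_card_nsmul _ _ _ fun e _ => hbad e))
  simp only [Finset.card_univ, Fintype.card_pi, Fintype.card_sum, Fintype.card_fin,
    Finset.prod_const, smul_eq_mul] at h1
  omega

/-- The size of the sample suffices for the union bound over all configurations. -/
theorem sample_size_bound {u : ℝ} (hu : 8 ≤ u) {s m k : ℕ} (hs : 16 * (u * Real.log u) ≤ s)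
    (hs' : (s : ℝ) ≤ 16 * (u * Real.log u) + 1) (hm : 0 < m) (hk : (m : ℝ) / u ≤ k) :
    (s + 4 + 4) ^ 4 * ((m - k) ^ (s + 4 - 4) * m ^ 4) < m ^ (s + 4) := by
  have hu0 : 0 < u := by linarith
  have hm' : (0 : ℝ) < m := by exact_mod_cast hm
  have hlog : Real.log u ≤ u - 1 := Real.log_le_sub_one_of_pos hu0
  have hsub : ((m - k : ℕ) : ℝ) ≤ m * Real.exp (-(1 / u)) := by
    have h1 : 1 - 1 / u ≤ Real.exp (-(1 / u)) := by
      have := Real.add_one_le_exp (-(1 / u)); linarith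
    rcases le_total k m with h | h
    · rw [Nat.cast_sub h]
      calc (m : ℝ) - k ≤ m - m / u := by linarith
        _ = m * (1 - 1 / u) := by ring
        _ ≤ _ := by gcongr
    · rw [Nat.sub_eq_zero_of_le h, Nat.cast_zero]; positivity
  -- The constant 16 is 4 · 4: there are (s + 8)⁴ < u¹⁶ configurations, while the survival
  -- probability is at most exp(−s/u) ≤ u⁻¹⁶.
  have hs8 : (s : ℝ) + 8 < u ^ 4 := by
    have h1 : 16 * (u * Real.log u) ≤ 16 * (u * (u - 1)) := by gcongr
    have h2 : 64 * u ^ 2 ≤ u ^ 4 := by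
      have : (64 : ℝ) ≤ u ^ 2 := by nlinarith
      nlinarith [sq_nonneg u]
    nlinarith
  have hexp : u ^ 16 ≤ Real.exp ((1 / u) * s) := by
    rw [← Real.exp_log hu0, ← Real.exp_nat_mul, Real.exp_log hu0]
    refine Real.exp_le_exp.2 ?_
    have : (1 / u) * (16 * (u * Real.log u)) ≤ (1 / u) * s := by gcongr
    have e : (1 / u) * (16 * (u * Real.log u)) = 16 * Real.log u := by field_simp
    rw [e] at this
    exact_mod_cast this
  have hpow : ((s : ℝ) + 8) ^ 4 < Real.exp ((1 / u) * s) := by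
    calc ((s : ℝ) + 8) ^ 4 < (u ^ 4) ^ 4 := by gcongr
      _ = u ^ 16 := by ring
      _ ≤ _ := hexp
  have key : ((s : ℝ) + 4 + 4) ^ 4 * (((m - k : ℕ) : ℝ) ^ s * m ^ 4) < m ^ (s + 4) := by
    calc ((s : ℝ) + 4 + 4) ^ 4 * (((m - k : ℕ) : ℝ) ^ s * m ^ 4)
        ≤ ((s : ℝ) + 8) ^ 4 * ((m * Real.exp (-(1 / u))) ^ s * m ^ 4) := by
          have : (s : ℝ) + 4 + 4 = s + 8 := by ring
          rw [this]
          gcongr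
      _ = ((s : ℝ) + 8) ^ 4 * Real.exp (-((1 / u) * s)) * m ^ (s + 4) := by
          rw [mul_pow, ← Real.exp_nat_mul, pow_add]
          have : (s : ℝ) * -(1 / u) = -((1 / u) * s) := by ring
          rw [this]; ring
      _ < 1 * m ^ (s + 4) := by
          refine mul_lt_mul_of_pos_right ?_ (by positivity)
          rw [Real.exp_neg, ← div_eq_mul_inv, div_lt_one (Real.exp_pos _)]
          exact hpow
      _ = _ := one_mul _
  rw [Nat.add_sub_cancel]
  exact_mod_cast key

/-! ### Separating lines and the enclosing square -/

/-- A line is the zero set of a nonconstant affine function. -/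
theorem IsLine.exists_ev {ℓ : AffineSubspace ℝ Plane} (hℓ : IsLine ℓ) :
    ∃ h, NonConst h ∧ ∀ x, x ∈ ℓ ↔ ev h x = 0 := by
  obtain ⟨v, hv, hspan⟩ := finrank_eq_one_iff'.1 hℓ
  have hne : (ℓ : Set Plane).Nonempty := by
    rw [Set.nonempty_iff_ne_empty]
    intro h
    have : ℓ = ⊥ := by rwa [AffineSubspace.coe_eq_bot_iff] at h
    rw [IsLine, this, AffineSubspace.direction_bot, finrank_bot] at hℓ
    exact zero_ne_one hℓ
  obtain ⟨p, hp⟩ := hne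
  have hv0 : (v : Plane) ≠ 0 := fun h => hv (Subtype.ext h)
  have hc : (v : Plane) 0 ≠ 0 ∨ (v : Plane) 1 ≠ 0 := by
    by_contra! h
    exact hv0 (plane_ext h.1 h.2)
  refine ⟨side p (p + v), ?_, fun x => ?_⟩
  · rcases hc with h | h
    · right; simpa [side] using h
    · left; simpa [side] using h
  · have e : ev (side p (p + v)) x = (v : Plane) 0 * (x 1 - p 1) - (v : Plane) 1 * (x 0 - p 0) := by
      rw [ev_side]; simp
    rw [e, ← AffineSubspace.vsub_right_mem_direction_iff_mem hp]
    constructor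
    · intro hx
      obtain ⟨c, hcx⟩ := hspan ⟨_, hx⟩
      have h := congrArg Subtype.val hcx
      have h0 := congrArg (fun y : Plane => y 0) h
      have h1 := congrArg (fun y : Plane => y 1) h
      simp at h0 h1
      rw [← h0, ← h1]; ring
    · intro hx
      have : ∃ c : ℝ, c • (v : Plane) = x -ᵥ p := by
        rcases hc with h | h
        · refine ⟨(x 0 - p 0) / (v : Plane) 0, plane_ext ?_ ?_⟩
          · simp; field_simp
          · simp; field_simp; linarith
        · refine ⟨(x 1 - p 1) / (v : Plane) 1, plane_ext ?_ ?_⟩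
          · simp; field_simp; linarith
          · simp; field_simp
      obtain ⟨c, hcx⟩ := this
      rw [← hcx]
      exact Submodule.smul_mem _ c v.2

theorem ev_mul_neg_of_sOppSide {ℓ : AffineSubspace ℝ Plane} {h : ℝ × ℝ × ℝ}
    (hℓ : ∀ x, x ∈ ℓ ↔ ev h x = 0) {p q : Plane} (hpq : ℓ.SOppSide p q) :
    ev h p * ev h q < 0 := by
  obtain ⟨hw, hp, hq⟩ := hpq
  obtain ⟨z, hz, t, ⟨ht0, ht1⟩, rfl⟩ := AffineSubspace.wOppSide_iff_exists_wbtw.1 hw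
  rw [hℓ] at hp hq hz
  rw [AffineMap.lineMap_apply_module, ev_combo _ _ _ (by ring)] at hz
  have hp2 := mul_self_pos.2 hp
  have hq2 := mul_self_pos.2 hq
  have e1 : (1 - t) * (ev h p * ev h p) = - t * (ev h p * ev h q) := by
    linear_combination ev h p * hz
  have e2 : t * (ev h q * ev h q) = - (1 - t) * (ev h p * ev h q) := by
    linear_combination ev h q * hz
  by_contra! hn
  have h1 := mul_nonneg ht0 hn
  have h2 := mul_nonneg (sub_nonneg.2 ht1) hn
  have h3 := mul_nonneg ht0 hq2.le
  have h4 := mul_nonneg (sub_nonneg.2 ht1) hp2.le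
  have h5 : t = 0 := (mul_eq_zero.1 (by linarith : t * (ev h q * ev h q) = 0)).resolve_right hq2.ne'
  have h6 : 1 - t = 0 :=
    (mul_eq_zero.1 (by linarith : (1 - t) * (ev h p * ev h p) = 0)).resolve_right hp2.ne'
  linarith

/-- A line strictly separating two points of a hull strictly separates two of its generators. -/
theorem exists_separated_generators {ι : Type*} {t : ι → Plane} {h : ℝ × ℝ × ℝ} {p q : Plane}
    (hp : p ∈ convexHull ℝ (Set.range t)) (hq : q ∈ convexHull ℝ (Set.range t))
    (hpq : ev h p * ev h q < 0) : ∃ i i', ev h (t i) * ev h (t i') < 0 := by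
  by_contra! hcon
  by_cases hpos : ∃ i, 0 < ev h (t i)
  · obtain ⟨i, hi⟩ := hpos
    have : ∀ v ∈ Set.range t, 0 ≤ ev h v := by
      rintro _ ⟨i', rfl⟩
      exact nonneg_of_mul_nonneg_right (hcon i i') hi
    exact absurd hpq (not_lt.2 (mul_nonneg (ev_nonneg_of_mem_convexHull this hp)
      (ev_nonneg_of_mem_convexHull this hq)))
  · push Not at hpos
    have : ∀ v ∈ Set.range t, ev h v ≤ 0 := by
      rintro _ ⟨i', rfl⟩
      exact hpos i'
    exact absurd hpq (not_lt.2 (mul_nonneg_of_nonpos_of_nonpos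
      (ev_nonpos_of_mem_convexHull this hp) (ev_nonpos_of_mem_convexHull this hq)))

/-- The four sides of the square of half side length `M`. -/
def square (M : ℝ) : Fin 4 → ℝ × ℝ × ℝ := ![(1, 0, -M), (-1, 0, -M), (0, 1, -M), (0, -1, -M)]

theorem nonConst_square (M : ℝ) (i : Fin 4) : NonConst (square M i) := by
  fin_cases i <;> simp [square, NonConst]

theorem isBox_square {α : Type*} (g : α → ℝ × ℝ × ℝ) {M : ℝ} (hM : 0 < M) :
    IsBox (Sum.elim g (square M)) (Finset.univ.map Function.Embedding.inr) M where
  pos := hM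
  const := by
    intro b hb
    obtain ⟨i, -, rfl⟩ := Finset.mem_map.1 hb
    fin_cases i <;> simp [square]
  bounded := by
    refine (Metric.isBounded_closedBall (x := (0 : Plane)) (r := 2 * M)).subset fun x hx => ?_
    have h : ∀ i, 0 ≤ ev (square M i) x := fun i => hx (Sum.inr i) (by simp)
    have h0 := h 0
    have h1 := h 1
    have h2 := h 2
    have h3 := h 3
    simp [square, ev] at h0 h1 h2 h3
    rw [mem_closedBall_zero_iff, EuclideanSpace.norm_eq, Real.sqrt_le_left (by linarith),
      Fin.sum_univ_two]
    simp only [Real.norm_eq_abs, sq_abs]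
    nlinarith
  side := by
    intro b hb
    obtain ⟨i, -, rfl⟩ := Finset.mem_map.1 hb
    have hne : M ≠ -M := by linarith
    have key : ∀ z : Plane, (∀ i, 0 ≤ ev (square M i) z) →
        ∀ j ∈ Finset.univ.map (Function.Embedding.inr : Fin 4 ↪ α ⊕ Fin 4),
          0 ≤ ev (Sum.elim g (square M) j) z := by
      intro z hz j hj
      obtain ⟨i, -, rfl⟩ := Finset.mem_map.1 hj
      exact hz i
    have hc : ∀ a b : ℝ, (a = M ∨ a = -M) → (b = M ∨ b = -M) →
        ∀ i, 0 ≤ ev (square M i) !₂[a, b] := by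
      rintro a b (rfl | rfl) (rfl | rfl) i <;> fin_cases i <;> simp [square, ev] <;> linarith
    fin_cases i
    · refine ⟨!₂[-M, M], !₂[-M, -M], fun h => hne ?_, key _ (hc _ _ (by simp) (by simp)),
        key _ (hc _ _ (by simp) (by simp)), by simp [square, ev], by simp [square, ev]⟩
      simpa using congrArg (fun x : Plane => x 1) h
    · refine ⟨!₂[M, M], !₂[M, -M], fun h => hne ?_, key _ (hc _ _ (by simp) (by simp)),
        key _ (hc _ _ (by simp) (by simp)), by simp [square, ev], by simp [square, ev]⟩
      simpa using congrArg (fun x : Plane => x 1) h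
    · refine ⟨!₂[M, -M], !₂[-M, -M], fun h => hne ?_, key _ (hc _ _ (by simp) (by simp)),
        key _ (hc _ _ (by simp) (by simp)), by simp [square, ev], by simp [square, ev]⟩
      simpa using congrArg (fun x : Plane => x 0) h
    · refine ⟨!₂[M, M], !₂[-M, M], fun h => hne ?_, key _ (hc _ _ (by simp) (by simp)),
        key _ (hc _ _ (by simp) (by simp)), by simp [square, ev], by simp [square, ev]⟩
      simpa using congrArg (fun x : Plane => x 0) h

/-! ### Constants and numerical bounds -/

/-- The sample size, the number of cells and the depth of the triangulations, in terms of `r`. -/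
theorem exists_growth_constants {a : ℝ} (ha : 6 ≤ a) :
    ∃ K K' : ℝ, 0 < K ∧ 0 < K' ∧ ∀ r : ℝ, 2 ≤ r → ∀ s D : ℕ,
      (s : ℝ) ≤ 16 * (a * √r * Real.log (a * √r)) + 1 → D = Nat.clog 2 (2 * (s + 8)) →
      ((s + 8 : ℕ) : ℝ) ≤ K * (√r * Real.log r) ∧ (D : ℝ) ≤ K' * Real.log r := by
  have ha0 : 0 < a := by linarith
  have hla : 0 < Real.log a := Real.log_pos (by linarith)
  -- Since r ≥ 2, log r > 1/2, so additive constants are absorbed into multiples of log r. The 18 in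
  -- `K` absorbs the additive 1 + 8 in this way.
  have hl2 : 1 / 2 < Real.log 2 := by have := Real.log_two_gt_d9; linarith
  set A := 2 * Real.log a + 1 with hA
  set K := 16 * a * A + 18 with hK
  have hK18 : 18 ≤ K := by rw [hK]; have : 0 ≤ 16 * a * A := by positivity
                           linarith
  have hlK : 0 < Real.log (4 * K) := Real.log_pos (by linarith)
  -- From 2^D ≤ 4K r²: D log 2 ≤ log(4K) + 2 log r, and both log 2 and log r exceed 1/2.
  set K' := 2 * (2 * Real.log (4 * K) + 2) with hK'
  refine ⟨K, K', by linarith, by positivity, fun r hr s D hs hD => ?_⟩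
  have hr0 : 0 < r := by linarith
  have hlr : 1 / 2 < Real.log r := hl2.trans_le (Real.log_le_log (by norm_num) hr)
  have hsq1 : 1 ≤ √r := Real.one_le_sqrt.2 (by linarith)
  have hsq0 : 0 < √r := by linarith
  have hsqr : √r ≤ r := by nlinarith [Real.sq_sqrt hr0.le]
  have hu : Real.log (a * √r) ≤ A * Real.log r := by
    rw [Real.log_mul ha0.ne' hsq0.ne', Real.log_sqrt hr0.le, hA]
    nlinarith
  have hN : ((s + 8 : ℕ) : ℝ) ≤ K * (√r * Real.log r) := by
    push_cast
    have h1 : 16 * (a * √r * Real.log (a * √r)) ≤ 16 * (a * √r * (A * Real.log r)) := by gcongr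
    have h2 : 1 / 2 ≤ √r * Real.log r := by nlinarith
    rw [hK]
    nlinarith
  refine ⟨hN, ?_⟩
  have hD1 : 1 ≤ D := by rw [hD]; exact Nat.clog_pos (b := 2) (n := 2 * (s + 8)) (by norm_num) (by omega)
  have hpow : 2 ^ (D - 1) < 2 * (s + 8) := by
    have := Nat.pow_pred_clog_lt_self one_lt_two (x := 2 * (s + 8)) (by omega)
    rwa [← hD] at this
  have hpow' : (2 : ℝ) ^ D ≤ 4 * K * (r * r) := by
    have h1 : 2 ^ D ≤ 4 * (s + 8) := by
      obtain ⟨d, rfl⟩ : ∃ d, D = d + 1 := ⟨D - 1, by omega⟩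
      rw [Nat.add_sub_cancel] at hpow
      rw [pow_succ]; omega
    have h2 : (2 : ℝ) ^ D ≤ 4 * ((s + 8 : ℕ) : ℝ) := by exact_mod_cast h1
    have h3 : Real.log r ≤ r := (Real.log_le_sub_one_of_pos hr0).trans (by linarith)
    have h4 : √r * Real.log r ≤ r * r := mul_le_mul hsqr h3 (by linarith) hr0.le
    have h5 : K * (√r * Real.log r) ≤ K * (r * r) := by gcongr
    linarith
  have hlog := Real.log_le_log (by positivity) hpow'
  rw [Real.log_pow, Real.log_mul (by positivity) (by positivity), Real.log_mul hr0.ne' hr0.ne']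
    at hlog
  have h1 : (D : ℝ) * (1 / 2) ≤ D * Real.log 2 := by gcongr
  rw [hK']
  nlinarith

open Classical in
/-- If every two corners of a triangle are strictly separated by at most `κ` of the lines `g`, which
strictly separate the points of `P` pairwise, then the triangle contains few points of `P`. -/
theorem card_filter_mem_hull_le {Λ : Type*} [Fintype Λ] (g : Λ → ℝ × ℝ × ℝ) (P : Finset Plane)
    (hP : ∀ p ∈ P, ∀ q ∈ P, p ≠ q → ∃ a, ev (g a) p * ev (g a) q < 0) (t : Fin 3 → Plane) {κ : ℕ}
    (hκ : ∀ i i', (Finset.univ.filter fun a => ev (g a) (t i) * ev (g a) (t i') < 0).card ≤ κ) :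
    (P.filter (fun p => p ∈ convexHull ℝ (Set.range t))).card ≤ 1 + (3 * κ) ^ 2 := by
  let H : Fin 3 → Fin 3 → Finset Λ := fun i i' =>
    Finset.univ.filter fun a => ev (g a) (t i) * ev (g a) (t i') < 0
  let K : Finset Λ := H 0 1 ∪ (H 0 2 ∪ H 1 2)
  -- Only lines separating two corners can separate two points of the triangle; three unordered
  -- pairs of corners account for the factor 3.
  have hK : K.card ≤ 3 * κ := by
    have h1 := Finset.card_union_le (H 0 1) (H 0 2 ∪ H 1 2)
    have h2 := Finset.card_union_le (H 0 2) (H 1 2)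
    have h3 := hκ 0 1
    have h4 := hκ 0 2
    have h5 := hκ 1 2
    have h6 : K.card ≤ (H 0 1).card + ((H 0 2).card + (H 1 2).card) :=
      h1.trans (Nat.add_le_add_left h2 _)
    have h7 : (H 0 1).card ≤ κ := h3
    have h8 : (H 0 2).card ≤ κ := h4
    have h9 : (H 1 2).card ≤ κ := h5
    omega
  have hmem : ∀ a i i', ev (g a) (t i) * ev (g a) (t i') < 0 → a ∈ K := by
    intro a i i' h
    have hsq : ∀ i, ¬ ev (g a) (t i) * ev (g a) (t i) < 0 := fun i =>
      not_lt.2 (mul_self_nonneg _)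
    have h' := h
    rw [mul_comm] at h'
    simp only [K, H, Finset.mem_union, Finset.mem_filter, Finset.mem_univ, true_and]
    fin_cases i <;> fin_cases i' <;> simp only [Fin.zero_eta, Fin.mk_one, Fin.reduceFinMk] at h h' <;>
      first
      | exact absurd h (hsq _)
      | exact Or.inl h
      | exact Or.inl h'
      | exact Or.inr (Or.inl h)
      | exact Or.inr (Or.inl h')
      | exact Or.inr (Or.inr h)
      | exact Or.inr (Or.inr h')
  have hle := card_le_of_pairwise_separated (fun a : K => g a)
    (P.filter (fun p => p ∈ convexHull ℝ (Set.range t))) (by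
      intro p hp q hq hne
      obtain ⟨hp, hpt⟩ := Finset.mem_filter.1 hp
      obtain ⟨hq, hqt⟩ := Finset.mem_filter.1 hq
      obtain ⟨a, ha⟩ := hP p hp q hq hne
      obtain ⟨i, i', hii⟩ := exists_separated_generators hpt hqt ha
      exact ⟨⟨a, hmem a i i' hii⟩, ha⟩)
  rw [Fintype.card_coe] at hle
  have h2 : K.card + K.card.choose 2 ≤ K.card ^ 2 := by
    rw [Nat.choose_two_right]
    rcases Nat.eq_zero_or_pos K.card with h | h
    · rw [h]; simp
    · obtain ⟨k, hk⟩ : ∃ k, K.card = k + 1 := ⟨K.card - 1, by omega⟩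
      rw [hk, Nat.add_sub_cancel]
      have : (k + 1) * k / 2 ≤ (k + 1) * k := Nat.div_le_self _ _
      nlinarith
  have h3 : K.card ^ 2 ≤ (3 * κ) ^ 2 := Nat.pow_le_pow_left hK 2
  omega

/-- If the floor is 0, the bound is 1 ≤ x. Otherwise its square is at least 1, so 1 is absorbed and
10 · x/36 ≤ x remains. -/
theorem one_add_sq_floor_le {x : ℝ} (hx : 1 ≤ x) : 1 + (3 * (⌊√x / 6⌋₊ : ℝ)) ^ 2 ≤ x := by
  have hfl : (⌊√x / 6⌋₊ : ℝ) ≤ √x / 6 := Nat.floor_le (by positivity)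
  rcases Nat.eq_zero_or_pos ⌊√x / 6⌋₊ with h0 | h0
  · rw [h0]; simpa using hx
  · have h1 : (1 : ℝ) ≤ (⌊√x / 6⌋₊ : ℝ) ^ 2 := one_le_pow₀ (by exact_mod_cast h0)
    have h2 : (⌊√x / 6⌋₊ : ℝ) ^ 2 ≤ (√x / 6) ^ 2 := by gcongr
    rw [div_pow, Real.sq_sqrt (by linarith)] at h2
    linarith

/-- All terms are bounded by N², using N ≥ 1: 6 + 6 + 12 + 12 = 36. -/
theorem total_count_le {N K r l : ℝ} (hr : 0 ≤ r) (hN : 1 ≤ N) (hNK : N ≤ K * (√r * l)) :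
    6 * (N * (1 + N)) + 4 * (3 * (1 + N)) ≤ 36 * K ^ 2 * (r * l ^ 2) := by
  have h2 : N ^ 2 ≤ (K * (√r * l)) ^ 2 := by gcongr
  have h3 : (K * (√r * l)) ^ 2 = K ^ 2 * (r * l ^ 2) := by
    rw [mul_pow, mul_pow, Real.sq_sqrt hr]
  have h5 : N ≤ N ^ 2 := le_self_pow₀ hN two_ne_zero
  linarith

/-- All terms are bounded by N D, using N, D ≥ 1: 18 + 18 + 12 + 12 = 60. -/
theorem crossing_count_le {N D K K' q l : ℝ} (hN : 1 ≤ N) (hD : 1 ≤ D) (hK : 0 < K) (hl : 0 < l)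
    (hq : 0 ≤ q) (hNK : N ≤ K * (q * l)) (hDK : D ≤ K' * l) :
    3 * (1 + N) * (6 * D) + 4 * (3 * (1 + N)) ≤ 60 * (K * K') * (q * l ^ 2) := by
  have h2 : N * D ≤ K * (q * l) * (K' * l) := by gcongr
  have h4 : N ≤ N * D := le_mul_of_one_le_right (by linarith) hD
  have h5 : D ≤ N * D := le_mul_of_one_le_left (by linarith) hN
  linarith

/-! ### The main theorem -/

theorem mainTheorem5 (c : ℝ) :
    ∃ C : ℝ, 0 < C ∧ ∀ (P : Finset Plane) (r : ℝ), 2 ≤ r → r ≤ (P.card : ℝ) →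
      (separability P : ℝ) ≤ c * Real.sqrt (P.card : ℝ) →
      ∃ 𝒯 : Finset (Set Plane), IsPlaneTriangulation 𝒯 ∧
        (𝒯.card : ℝ) ≤ C * (r * Real.log r ^ 2) ∧
        (∀ T ∈ 𝒯, (((P : Set Plane) ∩ T).ncard : ℝ) ≤ (P.card : ℝ) / r) ∧
        (∀ ℓ : AffineSubspace ℝ Plane, IsLine ℓ →
          (({T : Set Plane | T ∈ 𝒯 ∧ (T ∩ (ℓ : Set Plane)).Nonempty}.ncard : ℕ) : ℝ) ≤
            C * (Real.sqrt r * Real.log r ^ 2)) := by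
  classical
  -- Raising `c` to at least 1 makes it positive and ensures u ≥ 8 below.
  set c' := max c 1 with hc'
  have hc1 : 1 ≤ c' := le_max_right _ _
  obtain ⟨K, K', hK, hK', hgrow⟩ := exists_growth_constants (a := 6 * c') (by linarith)
  refine ⟨36 * K ^ 2 + 60 * (K * K'), by positivity, fun P r hr hrn hsep => ?_⟩
  obtain ⟨L, hL, hLsep, hLcard⟩ := exists_separates_card_eq_separability P
  have hgex : ∀ ℓ : L, ∃ h, NonConst h ∧ ∀ x, x ∈ ℓ.1 ↔ ev h x = 0 := fun ℓ =>
    (hL ℓ ℓ.2).exists_ev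
  choose gL hgL hgL0 using hgex
  have hPsep : ∀ p ∈ P, ∀ q ∈ P, p ≠ q → ∃ a, ev (gL a) p * ev (gL a) q < 0 := by
    intro p hp q hq hne
    obtain ⟨ℓ, hℓ, hs⟩ := hLsep p hp q hq hne
    exact ⟨⟨ℓ, hℓ⟩, ev_mul_neg_of_sOppSide (hgL0 ⟨ℓ, hℓ⟩) hs⟩
  set n : ℝ := (P.card : ℝ) with hn
  have hr0 : 0 < r := by linarith
  have hn2 : 2 ≤ n := hr.trans hrn
  have hn0 : 0 < n := by linarith
  set m := Fintype.card L with hm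
  have hm0 : 0 < m := by
    have : 1 < P.card := by
      have : (2 : ℝ) ≤ P.card := hn2
      exact_mod_cast this
    obtain ⟨p, hp, q, hq, hne⟩ := Finset.one_lt_card.1 this
    obtain ⟨a, -⟩ := hPsep p hp q hq hne
    exact Fintype.card_pos_iff.2 ⟨a⟩
  have hmc : (m : ℝ) ≤ c' * √n := by
    rw [hm, Fintype.card_coe, hLcard]
    refine hsep.trans ?_
    gcongr
    exact le_max_left _ _
  set u : ℝ := 6 * c' * √r with hu
  have hsr : 4 / 3 ≤ √r := by
    rw [Real.le_sqrt (by norm_num) hr0.le]; norm_num; linarith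
  have hu8 : 8 ≤ u := by
    calc (8 : ℝ) = 6 * 1 * (4 / 3) := by norm_num
      _ ≤ 6 * c' * √r := by gcongr
  set κ : ℝ := √(n / r) / 6 with hκ
  have hκ0 : 0 ≤ κ := by positivity
  -- With this off-by-one, fewer than `k` conflicts means at most ⌊κ⌋.
  set k := ⌊κ⌋₊ + 1 with hk
  have hku : (m : ℝ) / u ≤ k := by
    have h1 : (m : ℝ) / u ≤ κ := by
      rw [div_le_iff₀ (by linarith), hκ, hu, Real.sqrt_div hn0.le]
      have : √n / √r / 6 * (6 * c' * √r) = c' * √n := by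
        have : √r ≠ 0 := by positivity
        field_simp
      rw [this]; exact hmc
    have h2 := Nat.lt_floor_add_one κ
    rw [hk]; push_cast; linarith
  have hul : 0 ≤ u * Real.log u := mul_nonneg (by linarith) (Real.log_nonneg (by linarith))
  set s := ⌈16 * (u * Real.log u)⌉₊ with hs
  have hs1 : 16 * (u * Real.log u) ≤ s := Nat.le_ceil _
  have hs2 : (s : ℝ) ≤ 16 * (u * Real.log u) + 1 := (Nat.ceil_lt_add_one (by linarith)).le
  obtain ⟨M, hM, hPM⟩ : ∃ M : ℝ, 0 < M ∧ ∀ p ∈ P, ∀ i, 0 < ev (square M i) p := by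
    refine ⟨1 + ∑ p ∈ P, (|p 0| + |p 1|), by positivity, fun p hp i => ?_⟩
    have h1 : |p 0| + |p 1| ≤ ∑ p ∈ P, (|p 0| + |p 1|) :=
      Finset.single_le_sum (f := fun p : Plane => |p 0| + |p 1|) (fun q _ => by positivity) hp
    have h2 := abs_le.1 (le_refl |p 0|)
    have h3 := abs_le.1 (le_refl |p 1|)
    have h4 := abs_nonneg (p 0)
    have h5 := abs_nonneg (p 1)
    fin_cases i <;> simp [square, ev] <;> linarith
  let G : L ⊕ Fin 4 → ℝ × ℝ × ℝ := Sum.elim gL (square M)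
  -- A configuration is a pair of intersection points given by four lines, and its conflicts are the
  -- separating lines between the two points. The square sides may define vertices but are not
  -- sampled.
  obtain ⟨f, hf⟩ := exists_sample (Λ := L) (β := Fin 4) (s := s + 4) (k := k) (by omega)
    (fun e => Finset.univ.filter fun a => ev (gL a) (meet (G (e 0)) (G (e 1))) *
      ev (gL a) (meet (G (e 2)) (G (e 3))) < 0)
    (by simpa [← hm] using sample_size_bound hu8 hs1 hs2 hm0 hku)
  let g : Fin (s + 4) ⊕ Fin 4 → ℝ × ℝ × ℝ := Sum.elim (gL ∘ f) (square M)
  have hgG : ∀ j, g j = G (Sum.map f id j) := fun j => by cases j <;> rfl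
  have hg : ∀ j, NonConst (g j) := by
    rintro (j | j)
    · exact hgL _
    · exact nonConst_square M j
  set N := s + 8 with hN
  have hcard : Fintype.card (Fin (s + 4) ⊕ Fin 4) = N := by simp [hN]
  -- A cell of an arrangement of N lines has at most 2N vertices, so `D` halvings suffice.
  set D := Nat.clog 2 (2 * N) with hD
  obtain ⟨hNK, hDK⟩ := hgrow r hr s D hs2 rfl
  obtain ⟨𝒯, h𝒯, hT1, hT2, hT3⟩ := exists_arrangement_triangulation (isBox_square (gL ∘ f) hM) hg
    (D := D) (by rw [hcard]; exact Nat.le_pow_clog (by norm_num) _)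
  rw [hcard] at hT1 hT3
  rw [Finset.card_map, Finset.card_univ, Fintype.card_fin] at hT1 hT3
  have hlr : 0 < Real.log r := Real.log_pos (by linarith)
  have hN1 : 1 ≤ N := by omega
  have hD1 : 1 ≤ D := Nat.clog_pos (b := 2) (n := 2 * N) (by norm_num) (by omega)
  have hNr : (1 : ℝ) ≤ N := by exact_mod_cast hN1
  have hDr : (1 : ℝ) ≤ D := by exact_mod_cast hD1
  refine ⟨𝒯, h𝒯, ?_, ?_, ?_⟩
  · have h1 : (𝒯.card : ℝ) ≤ 6 * (N * (1 + N)) + 4 * (3 * (1 + N)) := by exact_mod_cast hT1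
    exact (h1.trans (total_count_le hr0.le hNr hNK)).trans
      (mul_le_mul_of_nonneg_right (le_add_of_nonneg_right (by positivity)) (by positivity))
  · intro T hT
    have hcount : ∀ q : ℕ, (P.filter (fun p => p ∈ T)).card ≤ q →
        (((P : Set Plane) ∩ T).ncard : ℝ) ≤ q := by
      intro q hq
      have : (P : Set Plane) ∩ T = (P.filter (fun p => p ∈ T) : Finset Plane) := by
        ext p; simp
      rw [this, Set.ncard_coe_finset]
      exact_mod_cast hq
    rcases hT2 T hT with hout | ⟨t, rfl, ht1, ht2⟩
    · have : P.filter (fun p => p ∈ T) = ∅ := by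
        refine Finset.filter_eq_empty_iff.2 fun p hp hpT => ?_
        obtain ⟨b, hb, hle⟩ := hout p hpT
        obtain ⟨i, -, rfl⟩ := Finset.mem_map.1 hb
        exact absurd (hPM p hp i) (not_lt.2 hle)
      refine (hcount 0 (by rw [this]; simp)).trans ?_
      simp only [Nat.cast_zero]; positivity
    -- No sampled line strictly separates two corners of a triangle, so the guarantee of the sample
    -- applies to each pair of corners.
    · have hpair : ∀ i i', (Finset.univ.filter fun a =>
          ev (gL a) (t i) * ev (gL a) (t i') < 0).card ≤ ⌊κ⌋₊ := by
        intro i i'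
        obtain ⟨j₁, j₂, h1⟩ : ∃ j j', t i = meet (g j) (g j') := ht1 i
        obtain ⟨j₃, j₄, h2⟩ : ∃ j j', t i' = meet (g j) (g j') := ht1 i'
        have := hf ![j₁, j₂, j₃, j₄] (by
          intro τ hτ
          have h3 := (Finset.mem_filter.1 hτ).2
          simp only [Function.comp_apply, Matrix.cons_val, ← hgG] at h3
          rw [← h1, ← h2] at h3
          exact absurd h3 (not_lt.2 (ht2 (Sum.inl τ) i i')))
        simp only [Function.comp_apply, Matrix.cons_val, ← hgG] at this
        rw [← h1, ← h2] at this
        exact Nat.lt_succ_iff.1 this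
      refine (hcount _ (card_filter_mem_hull_le gL P hPsep t hpair)).trans ?_
      exact_mod_cast one_add_sq_floor_le ((one_le_div hr0).2 hrn)
  · intro ℓ hℓ
    obtain ⟨h, hh, hℓh⟩ := hℓ.exists_ev
    have hset : (ℓ : Set Plane) = {x | ev h x = 0} := by
      ext x; exact hℓh x
    rw [hset]
    have h1 : ({T | T ∈ 𝒯 ∧ (T ∩ {x | ev h x = 0}).Nonempty}.ncard : ℝ) ≤
        3 * (1 + N) * (6 * D) + 4 * (3 * (1 + N)) := by exact_mod_cast hT3 h hh
    exact (h1.trans (crossing_count_le hNr hDr hK hlr (Real.sqrt_nonneg r) hNK hDK)).trans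
      (mul_le_mul_of_nonneg_right (le_add_of_nonneg_left (by positivity)) (by positivity))
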